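/- **Definitions.** Let $\mathbb R_+=(0,\infty)$. For $\gamma,\xi\in\mathbb R$ let $H[\gamma,\xi]=-\frac{d^2}{dt^2}+(t-\xi)^2$ in $L^2(\mathbb R_+)$, with domain $$\{u\in H^2(\mathbb R_+):\ t^2u\in L^2(\mathbb R_+),\ u'(0)=\gamma u(0)\},$$ and let $\mu^{(1)}(\gamma,\xi)$ be its lowest eigenvalue. Let $A_0(x_1,x_2)=\tfrac12(-x_2,x_1)$ on the half-plane $\mathbb R\times\mathbb R_+$, let $H^1_{A_0}(\mathbb R\times\mathbb R_+)=\{u\in L^2:\ (\nabla-iA_0)u\in L^2\}$, and let $$\Theta(\gamma)=\inf_{u\in H^1_{A_0}(\mathbb R\times\mathbb R_+),\,u\neq0}\ \frac{\|(\nabla-iA_0)u\|_{L^2(\mathbb R\times\mathbb R_+)}^2+\gamma\int_{\mathbb R}|u(x_1,0)|^2\,dx_1}{\|u\|_{L^2(\mathbb R\times\mathbb R_+)}^2},$$ where $u(\cdot,0)$ is the boundary trace of $u$. **Theorem.** Let $\gamma\in\mathbb R$. Then $\Theta(\gamma)$ is finite and $H[\gamma,\xi]$ has a lowest eigenvalue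 for every $\xi\in\mathbb R$. Moreover $\Theta(\gamma)<1$, and the function $\mathbb R\ni\xi\mapsto\mu^{(1)}(\gamma,\xi)$ attains its minimum over $\mathbb R$ at exactly one point $\xi(\gamma)$; this point is positive and satisfies $$\xi(\gamma)^2=\Theta(\gamma)+\gamma^2 .$$ -/

import Mathlib

open MeasureTheory Set
open scoped ContDiff

namespace RobinModel

/-- `w` is the weak (distributional) derivative of `u` in the direction `e` on the open set `Ω`:
`∫_Ω u ∂_e φ = - ∫_Ω w φ` for every test function `φ ∈ C_c^∞(Ω)`. -/
def HasWeakDirDeriv {E : Type*} [NormedAddCommGroup E] [NormedSpace ℝ E] [MeasureSpace E]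
    (Ω : Set E) (e : E) (u w : E → ℂ) : Prop :=
  ∀ φ : E → ℂ, ContDiff ℝ ∞ φ → HasCompactSupport φ → tsupport φ ⊆ Ω →
    ∫ x in Ω, u x * fderiv ℝ φ x e = -∫ x in Ω, w x * φ x

/-! ### The family of operators on the half-line -/

/-- `u` belongs to `B²(ℝ₊) = {u ∈ H²(ℝ₊) ; t² u ∈ L²(ℝ₊)}`, with weak derivatives `u' = u₁` and
`u'' = u₂`.  Both `u` and `u₁` are taken as the representatives that are continuous on `[0, ∞)`
(they exist by Sobolev embedding), so that `u 0` and `u₁ 0` are the boundary values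
`u(0)` and `u'(0)`. -/
structure MemB2 (u u₁ u₂ : ℝ → ℂ) : Prop where
  memLp : MemLp u 2 (volume.restrict (Ioi 0))
  memLp_deriv : MemLp u₁ 2 (volume.restrict (Ioi 0))
  memLp_deriv2 : MemLp u₂ 2 (volume.restrict (Ioi 0))
  hasWeakDeriv : HasWeakDirDeriv (Ioi (0 : ℝ)) 1 u u₁
  hasWeakDeriv2 : HasWeakDirDeriv (Ioi (0 : ℝ)) 1 u₁ u₂
  continuousOn : ContinuousOn u (Ici 0)
  continuousOn_deriv : ContinuousOn u₁ (Ici 0)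
  memLp_weight : MemLp (fun t : ℝ => (t : ℂ) ^ 2 * u t) 2 (volume.restrict (Ioi 0))

/-- The set of eigenvalues of `H[γ, ξ] = -d²/dt² + (t - ξ)²` in `L²(ℝ₊)` with domain
`{u ∈ B²(ℝ₊) ; u'(0) = γ u(0)}`. -/
def eigenvalues (γ ξ : ℝ) : Set ℝ :=
  {lam | ∃ u u₁ u₂ : ℝ → ℂ, MemB2 u u₁ u₂ ∧ u₁ 0 = (γ : ℂ) * u 0 ∧
    ¬ (u =ᵐ[volume.restrict (Ioi 0)] 0) ∧
    ∀ᵐ t ∂(volume.restrict (Ioi (0 : ℝ))),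
      -u₂ t + ((t : ℂ) - (ξ : ℂ)) ^ 2 * u t = (lam : ℂ) * u t}

/-- The first eigenvalue `μ⁽¹⁾(γ, ξ)` of `H[γ, ξ]`. -/
noncomputable def mu (γ ξ : ℝ) : ℝ := sInf (eigenvalues γ ξ)

/-! ### The magnetic quadratic form on the half-plane -/

/-- The half-plane `ℝ × ℝ₊`. -/
def halfPlane : Set (ℝ × ℝ) := {x | 0 < x.2}

/-- The magnetic potential `A₀(x₁, x₂) = ½ (-x₂, x₁)`. -/
noncomputable def A₀ (x : ℝ × ℝ) : ℝ × ℝ := (-x.2 / 2, x.1 / 2)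

/-- `u` belongs to `H¹_{A₀}(ℝ × ℝ₊) = {u ∈ L² ; (∇ - i A₀) u ∈ L²}`, and
`(v₁, v₂) = (∇ - i A₀) u`, that is `∂ⱼ u = vⱼ + i A₀ⱼ u` weakly. -/
structure MemMagneticH1 (u v₁ v₂ : ℝ × ℝ → ℂ) : Prop where
  memLp : MemLp u 2 (volume.restrict halfPlane)
  memLp_fst : MemLp v₁ 2 (volume.restrict halfPlane)
  memLp_snd : MemLp v₂ 2 (volume.restrict halfPlane)
  hasWeakDeriv_fst : HasWeakDirDeriv halfPlane (1, 0) u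
    (fun x => v₁ x + Complex.I * ((A₀ x).1 : ℂ) * u x)
  hasWeakDeriv_snd : HasWeakDirDeriv halfPlane (0, 1) u
    (fun x => v₂ x + Complex.I * ((A₀ x).2 : ℂ) * u x)

/-- `g ∈ L²(ℝ)` is the boundary trace `u(·, 0)` of a function `u` on the half-plane whose weak
derivative `∂₂ u` is `w`.  It is characterised by Green's formula
`∫_{x₂>0} u ∂₂φ = - ∫_{x₂>0} (∂₂u) φ - ∫_ℝ g(x₁) φ(x₁, 0) dx₁`
for all smooth compactly supported `φ` (not necessarily vanishing on the boundary). -/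
structure IsTrace (u w : ℝ × ℝ → ℂ) (g : ℝ → ℂ) : Prop where
  memLp : MemLp g 2 volume
  green : ∀ φ : ℝ × ℝ → ℂ, ContDiff ℝ ∞ φ → HasCompactSupport φ →
    ∫ x in halfPlane, u x * fderiv ℝ φ x (0, 1)
      = -(∫ x in halfPlane, w x * φ x) - ∫ s : ℝ, g s * φ (s, 0)

/-- The set of Rayleigh quotients
`(‖(∇ - i A₀) u‖² + γ ∫_ℝ |u(x₁, 0)|² dx₁) / ‖u‖²`, for `0 ≠ u ∈ H¹_{A₀}(ℝ × ℝ₊)`. -/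
def rayleighQuotients (γ : ℝ) : Set ℝ :=
  {r | ∃ (u v₁ v₂ : ℝ × ℝ → ℂ) (g : ℝ → ℂ), MemMagneticH1 u v₁ v₂ ∧
    IsTrace u (fun x => v₂ x + Complex.I * ((A₀ x).2 : ℂ) * u x) g ∧
    ¬ (u =ᵐ[volume.restrict halfPlane] 0) ∧
    r = ((∫ x in halfPlane, (‖v₁ x‖ ^ 2 + ‖v₂ x‖ ^ 2)) + γ * ∫ s : ℝ, ‖g s‖ ^ 2) /
      ∫ x in halfPlane, ‖u x‖ ^ 2}

/-- `Θ(γ)`, the ground state energy of the half-plane model. -/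
noncomputable def Theta (γ : ℝ) : ℝ := sInf (rayleighQuotients γ)

end RobinModel

namespace RobinModel

open Filter Topology

/-! ### Decaying solutions of the harmonic oscillator equation -/

/-! Write an energy as λ = 1 - 2α. Up to a factor, the only solution of -f'' + s²f = λf that is
square integrable at +∞ is f = `cyl α`, and λ is an eigenvalue of H[γ,ξ] exactly when f'(-ξ) = γ
f(-ξ) (`mem_eigenvalues_iff`, a Wronskian argument). The spectrum is thus read off from the values
of one family of functions on the whole line.

Two facts settle the half-line problem. For α > 0 the function f is positive and f'/f is strictly
decreasing in α (`cylDeriv_mul_cyl_lt`). Moreover G(s) = e^{γs}(f' - γf) satisfies G' = (s² - (λ +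
γ²)) f e^{γs}. With R² = λ + γ², R > 0, G increases up to -R, decreases on [-R,R], increases after
R, and is negative from R on; hence its strict maximum is at -R whenever G(-R) = 0. The intermediate
value theorem supplies an α > 0 for which this happens (`exists_critical_level`). For that α, f' ≤
γf everywhere with equality only at -R, so λ is an eigenvalue for ξ = R, no eigenvalue at any ξ lies
below it, and it is attained at no other ξ. Existence of some eigenvalue for each ξ comes from the
oscillation of Hermite polynomials in their degree (`exists_robinCharacteristic_eq_zero`).

It remains to see that Θ(γ) = λ; then Θ(γ) < 1 is α > 0, and R² = Θ(γ) + γ² is the choice of R.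
Lower bound: a tangential cutoff, a change of gauge and a Fourier series turn the magnetic form into
a sum of half-line forms, each at least λ times the squared norm (`halfLine_form_ge`, by completing
the square with f'/f); the cutoff is then removed (`form_ge`). Upper bound: a Gaussian packet of
tangential frequency matched to R, times f(t - R), has Rayleigh quotient exactly λ + ε
(`add_mem_rayleighQuotients`). -/

/-- `∫₀^∞ y^{α-1} e^{-2sy-y²} dy`. -/
noncomputable def gaussMellin (α s : ℝ) : ℝ :=
  ∫ y in Ioi (0 : ℝ), y ^ (α - 1) * Real.exp (-2 * s * y - y ^ 2)

lemma integrableOn_rpow_mul_exp_neg {a : ℝ} (ha : 0 < a) (C : ℝ) :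
    IntegrableOn (fun y : ℝ => C * (Real.exp (-y) * y ^ (a - 1))) (Ioi 0) :=
  (Real.GammaIntegral_convergent ha).const_mul C

/-- Complete the square in (2S+1)y - y². One factor e^{-y} is kept so that Gamma integrals serve as
dominating functions. -/
lemma exp_quadratic_le {s S y : ℝ} (hs : |s| ≤ S) (hy : 0 ≤ y) :
    Real.exp (-2 * s * y - y ^ 2) ≤ Real.exp ((2 * S + 1) ^ 2 / 4) * Real.exp (-y) := by
  rw [← Real.exp_add]
  apply Real.exp_le_exp.2
  have h1 := (abs_le.1 hs).1
  nlinarith [sq_nonneg (y - (2 * S + 1) / 2), mul_nonneg (by linarith : 0 ≤ s + S) hy]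

/-- One power dominates for y ≤ 1 and the other for y ≥ 1, which gives a majorant uniform for α in a
compact range. -/
lemma rpow_le_add_rpow {a b α y : ℝ} (ha : a ≤ α) (hb : α ≤ b) (hy : 0 < y) :
    y ^ (α - 1) ≤ y ^ (a - 1) + y ^ (b - 1) := by
  have h1 := Real.rpow_pos_of_pos hy (a - 1)
  have h2 := Real.rpow_pos_of_pos hy (b - 1)
  rcases le_total y 1 with h | h
  · have := Real.rpow_le_rpow_of_exponent_ge hy h (by linarith : a - 1 ≤ α - 1)
    linarith
  · have := Real.rpow_le_rpow_of_exponent_le h (by linarith : α - 1 ≤ b - 1)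
    linarith

lemma norm_gaussMellin_integrand_le {a b α s S y : ℝ} (ha : a ≤ α) (hb : α ≤ b) (hs : |s| ≤ S)
    (hy : 0 < y) :
    ‖y ^ (α - 1) * Real.exp (-2 * s * y - y ^ 2)‖ ≤
      Real.exp ((2 * S + 1) ^ 2 / 4) * (Real.exp (-y) * y ^ (a - 1)) +
      Real.exp ((2 * S + 1) ^ 2 / 4) * (Real.exp (-y) * y ^ (b - 1)) := by
  rw [Real.norm_of_nonneg (by positivity)]
  calc _ ≤ (y ^ (a - 1) + y ^ (b - 1)) * (Real.exp ((2 * S + 1) ^ 2 / 4) * Real.exp (-y)) := by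
        gcongr
        · exact rpow_le_add_rpow ha hb hy
        · exact exp_quadratic_le hs hy.le
    _ = _ := by ring

lemma measurable_gaussMellin_integrand (α s : ℝ) :
    Measurable fun y : ℝ => y ^ (α - 1) * Real.exp (-2 * s * y - y ^ 2) := by
  fun_prop

lemma integrableOn_gaussMellin {α : ℝ} (hα : 0 < α) (s : ℝ) :
    IntegrableOn (fun y : ℝ => y ^ (α - 1) * Real.exp (-2 * s * y - y ^ 2)) (Ioi 0) := by
  refine Integrable.mono'
    ((integrableOn_rpow_mul_exp_neg hα (Real.exp ((2 * |s| + 1) ^ 2 / 4))).add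
      (integrableOn_rpow_mul_exp_neg hα (Real.exp ((2 * |s| + 1) ^ 2 / 4))))
    (measurable_gaussMellin_integrand α s).aestronglyMeasurable ?_
  filter_upwards [ae_restrict_mem measurableSet_Ioi] with y hy
  exact norm_gaussMellin_integrand_le le_rfl le_rfl le_rfl hy

lemma gaussMellin_pos {α : ℝ} (hα : 0 < α) (s : ℝ) : 0 < gaussMellin α s := by
  unfold gaussMellin
  rw [setIntegral_pos_iff_support_of_nonneg_ae _ (integrableOn_gaussMellin hα s)]
  · have : Ioi (0 : ℝ) ⊆ (Function.support fun y : ℝ =>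
        y ^ (α - 1) * Real.exp (-2 * s * y - y ^ 2)) := by
      intro y hy
      have := Real.rpow_pos_of_pos hy (α - 1)
      simp only [Function.mem_support]
      positivity
    rw [inter_eq_right.2 this]
    simp
  · filter_upwards [ae_restrict_mem measurableSet_Ioi] with y hy
    have := Real.rpow_pos_of_pos hy (α - 1)
    simp only [Pi.zero_apply]
    positivity

lemma continuousAt_gaussMellin {α : ℝ} (hα : 0 < α) (s : ℝ) :
    ContinuousAt (fun q : ℝ × ℝ => gaussMellin q.1 q.2) (α, s) := by
  unfold gaussMellin
  have h2 : 0 < α / 2 := by positivity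
  refine continuousAt_of_dominated (bound := fun y =>
      Real.exp ((2 * (|s| + 1) + 1) ^ 2 / 4) * (Real.exp (-y) * y ^ (α / 2 - 1)) +
      Real.exp ((2 * (|s| + 1) + 1) ^ 2 / 4) * (Real.exp (-y) * y ^ (α + 1 - 1))) ?_ ?_ ?_ ?_
  · exact .of_forall fun q => (measurable_gaussMellin_integrand q.1 q.2).aestronglyMeasurable
  · have h1 : ∀ᶠ q : ℝ × ℝ in 𝓝 (α, s), q.1 ∈ Icc (α / 2) (α + 1) :=
      continuousAt_fst.eventually_mem (Icc_mem_nhds (by simp; linarith) (by simp))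
    have h2 : ∀ᶠ q : ℝ × ℝ in 𝓝 (α, s), |q.2| < |s| + 1 := by
      have : ContinuousAt (fun q : ℝ × ℝ => |q.2|) (α, s) := by fun_prop
      exact this.eventually_lt continuousAt_const (by simp)
    filter_upwards [h1, h2] with q hq hq'
    filter_upwards [ae_restrict_mem measurableSet_Ioi] with y hy
    exact norm_gaussMellin_integrand_le hq.1 hq.2 hq'.le hy
  · exact (integrableOn_rpow_mul_exp_neg h2 _).add
      (integrableOn_rpow_mul_exp_neg (by linarith) _)
  · filter_upwards [ae_restrict_mem measurableSet_Ioi] with y hy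
    have : ContinuousAt (fun q : ℝ × ℝ => y ^ (q.1 - 1)) (α, s) :=
      ContinuousAt.rpow (by fun_prop) (by fun_prop) (.inl (ne_of_gt hy))
    fun_prop

lemma hasDerivAt_gaussMellin {α : ℝ} (hα : 0 < α) (s : ℝ) :
    HasDerivAt (gaussMellin α) (-2 * gaussMellin (α + 1) s) s := by
  have key := hasDerivAt_integral_of_dominated_loc_of_deriv_le
    (μ := volume.restrict (Ioi (0 : ℝ))) (s := Metric.ball s 1) (x₀ := s)
    (F := fun s y : ℝ => y ^ (α - 1) * Real.exp (-2 * s * y - y ^ 2))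
    (F' := fun s y : ℝ => -2 * (y ^ (α + 1 - 1) * Real.exp (-2 * s * y - y ^ 2)))
    (bound := fun y => 2 *
      (Real.exp ((2 * (|s| + 1) + 1) ^ 2 / 4) * (Real.exp (-y) * y ^ (α + 1 - 1)) +
      Real.exp ((2 * (|s| + 1) + 1) ^ 2 / 4) * (Real.exp (-y) * y ^ (α + 1 - 1))))
    (Metric.ball_mem_nhds s one_pos)
    (.of_forall fun s => (measurable_gaussMellin_integrand α s).aestronglyMeasurable)
    (integrableOn_gaussMellin hα s)
    ((measurable_gaussMellin_integrand (α + 1) s).const_mul (-2)).aestronglyMeasurable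
    ?_ ?_ ?_
  · have := key.2
    rw [integral_const_mul] at this
    exact this
  · filter_upwards [ae_restrict_mem measurableSet_Ioi] with y hy x hx
    rw [norm_mul]
    have hx' : |x| ≤ |s| + 1 := by
      rw [Metric.mem_ball, Real.dist_eq] at hx
      have := abs_sub_abs_le_abs_sub x s
      linarith
    have := norm_gaussMellin_integrand_le (le_refl (α + 1)) le_rfl hx' hy
    simpa using this
  · exact ((integrableOn_rpow_mul_exp_neg (by linarith) _).add
      (integrableOn_rpow_mul_exp_neg (by linarith) _)).const_mul 2
  · filter_upwards [ae_restrict_mem measurableSet_Ioi] with y hy x _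
    have h1 : HasDerivAt (fun x : ℝ => -2 * x * y - y ^ 2) (-2 * y) x := by
      have := (((hasDerivAt_id x).const_mul (-2)).mul_const y).sub_const (y ^ 2)
      simpa using this
    have h2 := h1.exp.const_mul (y ^ (α - 1))
    refine h2.congr_deriv ?_
    have : y ^ (α + 1 - 1) = y ^ (α - 1) * y := by
      rw [← Real.rpow_add_one (ne_of_gt hy)]; ring_nf
    rw [this]; ring

/-- Integrate the derivative of y^α e^{-2sy-y²} over (0,∞). The boundary term `0 ^ α` is 1 at α = 0
and 0 otherwise; this is what later normalises the Hermite function of degree 0. -/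
lemma gaussMellin_recurrence {α : ℝ} (hα : 0 ≤ α) (s : ℝ) :
    2 * gaussMellin (α + 2) s + 2 * s * gaussMellin (α + 1) s
      = α * gaussMellin α s + (0 : ℝ) ^ α := by
  -- At α = 0 the integrand y^{-1}e^{…} is not integrable, but its coefficient α makes the term
  -- vanish identically.
  have i0 : IntegrableOn
      (fun y : ℝ => α * (y ^ (α - 1) * Real.exp (-2 * s * y - y ^ 2))) (Ioi 0) := by
    rcases hα.eq_or_lt with rfl | h
    · simp
    · exact (integrableOn_gaussMellin h s).const_mul α
  have i1 := (integrableOn_gaussMellin (by linarith : 0 < α + 1) s).const_mul (2 * s)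
  have i2 := (integrableOn_gaussMellin (by linarith : 0 < α + 2) s).const_mul 2
  have key := integral_Ioi_of_hasDerivAt_of_tendsto (a := 0) (m := 0)
    (f := fun y : ℝ => y ^ α * Real.exp (-2 * s * y - y ^ 2))
    (f' := fun y : ℝ => α * (y ^ (α - 1) * Real.exp (-2 * s * y - y ^ 2))
      - 2 * s * (y ^ (α + 1 - 1) * Real.exp (-2 * s * y - y ^ 2))
      - 2 * (y ^ (α + 2 - 1) * Real.exp (-2 * s * y - y ^ 2))) ?_ ?_ ((i0.sub' i1).sub' i2) ?_
  · rw [integral_sub (i0.sub' i1) i2, integral_sub i0 i1, integral_const_mul,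
      integral_const_mul, integral_const_mul] at key
    simp only [mul_zero, ne_eq, OfNat.ofNat_ne_zero, not_false_eq_true, zero_pow, sub_zero,
      Real.exp_zero, mul_one, zero_sub] at key
    unfold gaussMellin
    linarith
  · have : ContinuousAt (fun y : ℝ => y ^ α * Real.exp (-2 * s * y - y ^ 2)) 0 :=
      (Real.continuous_rpow_const hα).continuousAt.mul (by fun_prop)
    exact this.continuousWithinAt
  · intro y hy
    have h1 : HasDerivAt (fun y : ℝ => -2 * s * y - y ^ 2) (-2 * s - 2 * y) y := by
      have := ((hasDerivAt_id y).const_mul (-2 * s)).fun_sub (hasDerivAt_pow 2 y)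
      simpa using this
    refine ((Real.hasDerivAt_rpow_const (.inl (ne_of_gt hy))).mul h1.exp).congr_deriv ?_
    have e1 : y ^ (α + 1 - 1) = y ^ α := by ring_nf
    have e2 : y ^ (α + 2 - 1) = y ^ α * y := by
      rw [← Real.rpow_add_one (ne_of_gt hy)]; ring_nf
    rw [e1, e2]; ring
  · have h0 := (Real.tendsto_pow_mul_exp_neg_atTop_nhds_zero (⌈α⌉₊)).const_mul
      (Real.exp ((2 * |s| + 1) ^ 2 / 4))
    rw [mul_zero] at h0
    refine squeeze_zero' ?_ ?_ h0
    · filter_upwards [eventually_gt_atTop 0] with y hy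
      positivity
    · filter_upwards [eventually_ge_atTop 1] with y hy
      have hy0 : 0 < y := by linarith
      have e1 := exp_quadratic_le (le_refl |s|) hy0.le
      have e2 : y ^ α ≤ y ^ ⌈α⌉₊ := by
        rw [← Real.rpow_natCast]
        exact Real.rpow_le_rpow_of_exponent_le hy (Nat.le_ceil α)
      calc _ ≤ y ^ ⌈α⌉₊ * (Real.exp ((2 * |s| + 1) ^ 2 / 4) * Real.exp (-y)) := by gcongr
        _ = _ := by ring

/-- The mean of `y` under the weight `y^{α-1} e^{-2sy-y²}` is strictly increasing in `α`. -/
lemma gaussMellin_ratio_lt {α β : ℝ} (hα : 0 < α) (hαβ : α < β) (s : ℝ) :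
    gaussMellin (α + 1) s / gaussMellin α s < gaussMellin (β + 1) s / gaussMellin β s := by
  set c := gaussMellin (α + 1) s / gaussMellin α s with hc
  have hβ : 0 < β := hα.trans hαβ
  have pα := gaussMellin_pos hα s
  have pα1 := gaussMellin_pos (by linarith : 0 < α + 1) s
  have pβ := gaussMellin_pos hβ s
  have hcpos : 0 < c := div_pos pα1 pα
  rw [lt_div_iff₀ pβ]
  have iα := integrableOn_gaussMellin hα s
  have iα1 := integrableOn_gaussMellin (by linarith : 0 < α + 1) s
  have iβ := integrableOn_gaussMellin hβ s
  have iβ1 := integrableOn_gaussMellin (by linarith : 0 < β + 1) s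
  -- Chebyshev's correlation argument: both factors change sign at y = c, so the product is
  -- nonnegative. Since c is the mean for the weight of index α, the terms carrying c^(β-α) cancel
  -- after integration.
  have hpt : ∀ y ∈ Ioi (0 : ℝ), (y - c) * (y ^ (β - α) - c ^ (β - α)) *
      (y ^ (α - 1) * Real.exp (-2 * s * y - y ^ 2)) =
      ((y ^ (β + 1 - 1) * Real.exp (-2 * s * y - y ^ 2))
        - c * (y ^ (β - 1) * Real.exp (-2 * s * y - y ^ 2)))
      - (c ^ (β - α) * (y ^ (α + 1 - 1) * Real.exp (-2 * s * y - y ^ 2))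
        - c ^ (β - α) * c * (y ^ (α - 1) * Real.exp (-2 * s * y - y ^ 2))) := by
    intro y hy
    have hy0 : y ≠ 0 := ne_of_gt hy
    have e1 : y ^ (β + 1 - 1) = y * y ^ (β - α) * y ^ (α - 1) := by
      rw [mul_assoc, ← Real.rpow_add hy, mul_comm, ← Real.rpow_add_one hy0]; ring_nf
    have e2 : y ^ (β - 1) = y ^ (β - α) * y ^ (α - 1) := by
      rw [← Real.rpow_add hy]; ring_nf
    have e3 : y ^ (α + 1 - 1) = y * y ^ (α - 1) := by
      rw [mul_comm, ← Real.rpow_add_one hy0]; ring_nf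
    rw [e1, e2, e3]; ring
  have hint := (iβ1.sub' (iβ.const_mul c)).sub
    ((iα1.const_mul (c ^ (β - α))).sub' (iα.const_mul (c ^ (β - α) * c)))
  have hmono : ∀ y, 0 < y → y ≠ c → 0 < (y - c) * (y ^ (β - α) - c ^ (β - α)) := by
    intro y hy hyc
    rcases lt_or_gt_of_ne hyc with h | h
    · have := Real.rpow_lt_rpow hy.le h (by linarith : 0 < β - α)
      exact mul_pos_of_neg_of_neg (by linarith) (by linarith)
    · have := Real.rpow_lt_rpow hcpos.le h (by linarith : 0 < β - α)
      exact mul_pos (by linarith) (by linarith)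
  have hpos : 0 < ∫ y in Ioi (0 : ℝ), (y - c) * (y ^ (β - α) - c ^ (β - α)) *
      (y ^ (α - 1) * Real.exp (-2 * s * y - y ^ 2)) := by
    rw [setIntegral_pos_iff_support_of_nonneg_ae]
    · have hsub : Ioo 0 c ⊆ (Function.support fun y : ℝ => (y - c) *
          (y ^ (β - α) - c ^ (β - α)) * (y ^ (α - 1) * Real.exp (-2 * s * y - y ^ 2)))
          ∩ Ioi 0 := by
        intro y hy
        have h1 := hmono y hy.1 (ne_of_lt hy.2)
        have h2 := Real.rpow_pos_of_pos hy.1 (α - 1)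
        exact ⟨(mul_pos h1 (mul_pos h2 (Real.exp_pos _))).ne', hy.1⟩
      refine lt_of_lt_of_le ?_ (measure_mono hsub)
      simp [hcpos]
    · filter_upwards [ae_restrict_mem measurableSet_Ioi] with y hy
      have h2 := Real.rpow_pos_of_pos hy (α - 1)
      by_cases hyc : y = c
      · simp [hyc]
      · exact (mul_pos (hmono y hy hyc) (mul_pos h2 (Real.exp_pos _))).le
    · exact IntegrableOn.congr_fun hint (fun y hy => (hpt y hy).symm) measurableSet_Ioi
  rw [setIntegral_congr_fun measurableSet_Ioi hpt,
    integral_sub (iβ1.sub' (iβ.const_mul c))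
      ((iα1.const_mul (c ^ (β - α))).sub' (iα.const_mul (c ^ (β - α) * c))),
    integral_sub iβ1 (iβ.const_mul c),
    integral_sub (iα1.const_mul (c ^ (β - α))) (iα.const_mul (c ^ (β - α) * c)),
    integral_const_mul, integral_const_mul, integral_const_mul] at hpos
  change 0 < gaussMellin (β + 1) s - c * gaussMellin β s
    - (c ^ (β - α) * gaussMellin (α + 1) s - c ^ (β - α) * c * gaussMellin α s) at hpos
  have : c * gaussMellin α s = gaussMellin (α + 1) s := by rw [hc]; field_simp
  rw [mul_assoc, this] at hpos
  linarith

/-! ### Hermite functions of real degree -/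

/-- Analytic continuation of `gaussMellin α s / Γ(α)` to `α > -n`. -/
noncomputable def hermiteAux : ℕ → ℝ → ℝ → ℝ
  | 0, α, s => gaussMellin α s / Real.Gamma α
  | n + 1, α, s => 2 * (α + 1) * hermiteAux n (α + 2) s + 2 * s * hermiteAux n (α + 1) s

/-- The Hermite function of degree `-α`: the solution of `K'' - 2sK' = 2αK` that grows at most
polynomially at `+∞`. -/
noncomputable def hermiteFun (α s : ℝ) : ℝ := hermiteAux (⌊-α⌋₊ + 1) α s

/-- At level 0 this is `gaussMellin_recurrence` divided by Γ(α+1). At level n+1 it is the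
definition, once both terms on the right are known not to change between levels n and n+1. -/
lemma hermiteAux_recurrence (n : ℕ) : ∀ {α : ℝ}, -(n : ℝ) < α → ∀ s,
    hermiteAux n α s = 2 * (α + 1) * hermiteAux n (α + 2) s + 2 * s * hermiteAux n (α + 1) s := by
  induction n with
  | zero =>
    intro α hα s
    have hα : 0 < α := by simpa using hα
    have h := gaussMellin_recurrence hα.le s
    rw [Real.zero_rpow hα.ne', add_zero] at h
    have g0 := Real.Gamma_pos_of_pos hα
    have g1 := Real.Gamma_add_one hα.ne'
    have g2 := Real.Gamma_add_one (by linarith : α + 1 ≠ 0)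
    rw [show α + 1 + 1 = α + 2 by ring, g1] at g2
    simp only [hermiteAux]
    rw [g1, g2]
    have : α + 1 ≠ 0 := by linarith
    field_simp
    linarith
  | succ n ih =>
    intro α hα s
    push_cast at hα
    have h1 : hermiteAux (n + 1) (α + 1) s = hermiteAux n (α + 1) s :=
      (ih (by linarith) s).symm
    have h2 : hermiteAux (n + 1) (α + 2) s = hermiteAux n (α + 2) s :=
      (ih (by linarith) s).symm
    rw [h1, h2]
    rfl

lemma hermiteAux_add {n : ℕ} {α : ℝ} (h : -(n : ℝ) < α) (s : ℝ) (k : ℕ) :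
    hermiteAux (n + k) α s = hermiteAux n α s := by
  induction k with
  | zero => rfl
  | succ k ih =>
    rw [← ih]
    refine (hermiteAux_recurrence (n + k) ?_ s).symm
    push_cast
    have : (0 : ℝ) ≤ k := by positivity
    linarith

/-- Every level n > -α gives the same value, so a single level can serve α, α+1 and α+2 at once. -/
lemma hermiteFun_eq_aux {n : ℕ} {α : ℝ} (h : -(n : ℝ) < α) (s : ℝ) :
    hermiteFun α s = hermiteAux n α s := by
  have h' : -((⌊-α⌋₊ + 1 : ℕ) : ℝ) < α := by
    have := Nat.lt_floor_add_one (-α)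
    push_cast
    linarith
  unfold hermiteFun
  rw [← hermiteAux_add h s (⌊-α⌋₊ + 1), ← hermiteAux_add h' s n, add_comm]

lemma hermiteFun_of_pos {α : ℝ} (h : 0 < α) (s : ℝ) :
    hermiteFun α s = gaussMellin α s / Real.Gamma α :=
  hermiteFun_eq_aux (n := 0) (by simpa using h) s

lemma hermiteFun_recurrence (α s : ℝ) :
    hermiteFun α s = 2 * (α + 1) * hermiteFun (α + 2) s + 2 * s * hermiteFun (α + 1) s := by
  have h' : -((⌊-α⌋₊ + 1 : ℕ) : ℝ) < α := by
    have := Nat.lt_floor_add_one (-α)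
    push_cast
    linarith
  rw [hermiteFun_eq_aux h', hermiteFun_eq_aux (α := α + 1) (h'.trans (by linarith)),
    hermiteFun_eq_aux (α := α + 2) (h'.trans (by linarith))]
  exact hermiteAux_recurrence _ h' s

/-- The substitute for analytic continuation: properties are proved from the integral for α > 0 and
carried to the left by the three-term recurrence. -/
lemma shift_induction {P : ℝ → Prop} (h0 : ∀ α, 0 < α → P α)
    (hs : ∀ α, P (α + 1) → P (α + 2) → P α) (α : ℝ) : P α := by
  have key : ∀ n : ℕ, ∀ α : ℝ, -(n : ℝ) < α → P α := by
    intro n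
    induction n with
    | zero => intro α h; exact h0 α (by simpa using h)
    | succ n ih =>
      intro α h
      push_cast at h
      exact hs α (ih _ (by linarith)) (ih _ (by linarith))
  refine key (⌊-α⌋₊ + 1) α ?_
  have := Nat.lt_floor_add_one (-α)
  push_cast
  linarith

lemma hasDerivAt_hermiteFun (α : ℝ) : ∀ s,
    HasDerivAt (hermiteFun α) (-2 * α * hermiteFun (α + 1) s) s := by
  refine shift_induction (P := fun α => ∀ s,
    HasDerivAt (hermiteFun α) (-2 * α * hermiteFun (α + 1) s) s) ?_ ?_ α
  · intro α hα s
    have h1 : hermiteFun α = fun s => gaussMellin α s / Real.Gamma α :=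
      funext (hermiteFun_of_pos hα)
    rw [h1, hermiteFun_of_pos (by linarith), Real.Gamma_add_one hα.ne']
    refine ((hasDerivAt_gaussMellin hα s).div_const _).congr_deriv ?_
    have := Real.Gamma_pos_of_pos hα
    field_simp
  · intro α h1 h2 s
    have e : hermiteFun α =
        fun s => 2 * (α + 1) * hermiteFun (α + 2) s + 2 * s * hermiteFun (α + 1) s :=
      funext (hermiteFun_recurrence α)
    have d := ((h2 s).const_mul (2 * (α + 1))).fun_add
      (((hasDerivAt_id s).const_mul 2).fun_mul (h1 s))
    rw [e]
    refine d.congr_deriv ?_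
    have r := hermiteFun_recurrence (α + 1) s
    rw [show α + 1 + 2 = α + 2 + 1 by ring, show α + 1 + 1 = α + 2 by ring] at r
    simp only [id]
    rw [show α + 1 + 1 = α + 2 by ring, r]
    ring

/-- Joint continuity is needed because the critical level is found by varying α and the evaluation
point together. -/
lemma continuous_hermiteFun : Continuous fun q : ℝ × ℝ => hermiteFun q.1 q.2 := by
  rw [continuous_iff_continuousAt]
  rintro ⟨α, s⟩
  revert s
  refine shift_induction (P := fun α => ∀ s,
    ContinuousAt (fun q : ℝ × ℝ => hermiteFun q.1 q.2) (α, s)) ?_ ?_ α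
  · intro α hα s
    have hG : ContinuousAt Real.Gamma α := by
      refine (Real.differentiableAt_Gamma fun m => ?_).continuousAt
      have : (0 : ℝ) ≤ m := by positivity
      linarith
    have h1 : ContinuousAt (fun q : ℝ × ℝ => gaussMellin q.1 q.2 / Real.Gamma q.1) (α, s) :=
      (continuousAt_gaussMellin hα s).div (ContinuousAt.comp (g := Real.Gamma) (f := fun q : ℝ × ℝ => q.1) hG continuousAt_fst)
        (Real.Gamma_pos_of_pos hα).ne'
    refine h1.congr ?_
    have : ∀ᶠ q : ℝ × ℝ in 𝓝 (α, s), 0 < q.1 :=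
      continuousAt_fst.eventually_mem (Ioi_mem_nhds hα)
    filter_upwards [this] with q hq
    exact (hermiteFun_of_pos hq _).symm
  · intro α h1 h2 s
    have e : (fun q : ℝ × ℝ => hermiteFun q.1 q.2) = fun q : ℝ × ℝ =>
        2 * (q.1 + 1) * hermiteFun (q.1 + 2) q.2 + 2 * q.2 * hermiteFun (q.1 + 1) q.2 :=
      funext fun q => hermiteFun_recurrence q.1 q.2
    rw [e]
    have c1 : ContinuousAt (fun q : ℝ × ℝ => hermiteFun (q.1 + 1) q.2) (α, s) :=
      ContinuousAt.comp (g := fun q : ℝ × ℝ => hermiteFun q.1 q.2)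
        (f := fun q : ℝ × ℝ => (q.1 + 1, q.2)) (h1 s) (by fun_prop)
    have c2 : ContinuousAt (fun q : ℝ × ℝ => hermiteFun (q.1 + 2) q.2) (α, s) :=
      ContinuousAt.comp (g := fun q : ℝ × ℝ => hermiteFun q.1 q.2)
        (f := fun q : ℝ × ℝ => (q.1 + 2, q.2)) (h2 s) (by fun_prop)
    fun_prop

lemma hermiteFun_pos {α : ℝ} (hα : 0 < α) (s : ℝ) : 0 < hermiteFun α s := by
  rw [hermiteFun_of_pos hα]
  exact div_pos (gaussMellin_pos hα s) (Real.Gamma_pos_of_pos hα)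

lemma hermiteFun_zero (s : ℝ) : hermiteFun 0 s = 1 := by
  rw [hermiteFun_recurrence, hermiteFun_of_pos (by norm_num), hermiteFun_of_pos (by norm_num)]
  have := gaussMellin_recurrence le_rfl s
  simp only [zero_add, zero_mul, Real.rpow_zero] at this
  simp only [zero_add, mul_one, Real.Gamma_one, Real.Gamma_two, div_one]
  exact this

/-- If K_α vanished on a ray, so would its derivative -2αK_{α+1}, hence K_{α+1}; α = 0 is the
constant 1. -/
lemma exists_hermiteFun_ne_zero (α : ℝ) : ∀ s₀, ∃ s, s₀ < s ∧ hermiteFun α s ≠ 0 := by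
  refine shift_induction (P := fun α => ∀ s₀, ∃ s, s₀ < s ∧ hermiteFun α s ≠ 0) ?_ ?_ α
  · exact fun α hα s₀ => ⟨s₀ + 1, by linarith, (hermiteFun_pos hα _).ne'⟩
  · intro α h1 _ s₀
    by_cases hα : α = 0
    · exact ⟨s₀ + 1, by linarith, by simp [hα, hermiteFun_zero]⟩
    by_contra! hcon
    obtain ⟨s, hs, hne⟩ := h1 s₀
    have hd := hasDerivAt_hermiteFun α s
    have hz : hermiteFun α =ᶠ[𝓝 s] fun _ => 0 := by
      filter_upwards [Ioi_mem_nhds hs] with x hx using hcon x hx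
    have := (hd.congr_of_eventuallyEq hz.symm).unique (hasDerivAt_const s 0)
    simp [hα, hne] at this

/-- For α > 0 the function is decreasing, hence bounded on a ray; each use of the recurrence costs a
polynomial factor. -/
lemma exists_hermiteFun_bound (α : ℝ) : ∀ s₀, ∃ C, 0 ≤ C ∧ ∃ n : ℕ, ∀ s, s₀ ≤ s →
    |hermiteFun α s| ≤ C * (1 + |s|) ^ n := by
  refine shift_induction (P := fun α => ∀ s₀, ∃ C, 0 ≤ C ∧ ∃ n : ℕ, ∀ s, s₀ ≤ s →
    |hermiteFun α s| ≤ C * (1 + |s|) ^ n) ?_ ?_ α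
  · intro α hα s₀
    refine ⟨hermiteFun α s₀, (hermiteFun_pos hα _).le, 0, fun s hs => ?_⟩
    rw [abs_of_pos (hermiteFun_pos hα _), pow_zero, mul_one]
    have : AntitoneOn (hermiteFun α) univ := by
      refine antitoneOn_of_hasDerivWithinAt_nonpos convex_univ
        (fun s _ => (hasDerivAt_hermiteFun α s).continuousAt.continuousWithinAt)
        (fun s _ => (hasDerivAt_hermiteFun α s).hasDerivWithinAt) fun s _ => ?_
      have := hermiteFun_pos (by linarith : 0 < α + 1) s
      nlinarith [mul_pos hα this]
    exact this trivial trivial hs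
  · intro α h1 h2 s₀
    obtain ⟨C1, hC1, n1, b1⟩ := h1 s₀
    obtain ⟨C2, hC2, n2, b2⟩ := h2 s₀
    refine ⟨2 * |α + 1| * C2 + 2 * C1, by positivity, n1 + n2 + 1, fun s hs => ?_⟩
    have p : 1 ≤ 1 + |s| := by linarith [abs_nonneg s]
    have q1 : (1 + |s|) ^ (n1 + 1) ≤ (1 + |s|) ^ (n1 + n2 + 1) :=
      pow_le_pow_right₀ p (by omega)
    have q2 : (1 + |s|) ^ n2 ≤ (1 + |s|) ^ (n1 + n2 + 1) := pow_le_pow_right₀ p (by omega)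
    rw [hermiteFun_recurrence]
    calc _ ≤ |2 * (α + 1) * hermiteFun (α + 2) s| + |2 * s * hermiteFun (α + 1) s| :=
          abs_add_le _ _
      _ = 2 * |α + 1| * |hermiteFun (α + 2) s| + 2 * (|s| * |hermiteFun (α + 1) s|) := by
          simp only [abs_mul, abs_two]; ring
      _ ≤ 2 * |α + 1| * (C2 * (1 + |s|) ^ n2) + 2 * ((1 + |s|) * (C1 * (1 + |s|) ^ n1)) := by
          gcongr
          · exact b2 s hs
          · linarith
          · exact b1 s hs
      _ = 2 * |α + 1| * C2 * (1 + |s|) ^ n2 + 2 * C1 * (1 + |s|) ^ (n1 + 1) := by ring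
      _ ≤ 2 * |α + 1| * C2 * (1 + |s|) ^ (n1 + n2 + 1)
          + 2 * C1 * (1 + |s|) ^ (n1 + n2 + 1) := by gcongr
      _ = _ := by ring

/-! ### Decaying solutions: equation, decay, dependence on α -/

/-- The solution of `-f'' + s² f = (1 - 2α) f` that decays at `+∞`. -/
noncomputable def cyl (α s : ℝ) : ℝ := Real.exp (-s ^ 2 / 2) * hermiteFun α s

/-- The derivative of `cyl α`. -/
noncomputable def cylDeriv (α s : ℝ) : ℝ :=
  Real.exp (-s ^ 2 / 2) * (-2 * α * hermiteFun (α + 1) s - s * hermiteFun α s)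

lemma hasDerivAt_exp_neg_sq_div_two (s : ℝ) :
    HasDerivAt (fun s : ℝ => Real.exp (-s ^ 2 / 2)) (Real.exp (-s ^ 2 / 2) * (-s)) s := by
  have := (((hasDerivAt_pow 2 s).fun_neg).div_const 2).exp
  refine this.congr_deriv ?_
  norm_num
  ring

lemma hasDerivAt_cyl (α s : ℝ) : HasDerivAt (cyl α) (cylDeriv α s) s := by
  refine ((hasDerivAt_exp_neg_sq_div_two s).mul (hasDerivAt_hermiteFun α s)).congr_deriv ?_
  unfold cylDeriv; ring

lemma hasDerivAt_cylDeriv (α s : ℝ) :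
    HasDerivAt (cylDeriv α) ((s ^ 2 - (1 - 2 * α)) * cyl α s) s := by
  have d := (hasDerivAt_exp_neg_sq_div_two s).mul
    (((hasDerivAt_hermiteFun (α + 1) s).const_mul (-2 * α)).fun_sub
      ((hasDerivAt_id s).fun_mul (hasDerivAt_hermiteFun α s)))
  refine d.congr_deriv ?_
  -- Multiplied by 2α, the recurrence is Hermite's equation K'' = 2sK' + 2αK, as K' = -2αK_{α+1} and
  -- K'' = 4α(α+1)K_{α+2}.
  have r := hermiteFun_recurrence α s
  simp only [id, cyl]
  rw [show α + 1 + 1 = α + 2 by ring]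
  linear_combination (-2 * α * Real.exp (-s ^ 2 / 2)) * r

lemma continuous_cyl₂ : Continuous fun q : ℝ × ℝ => cyl q.1 q.2 := by
  unfold cyl
  have := continuous_hermiteFun
  fun_prop

lemma continuous_cylDeriv₂ : Continuous fun q : ℝ × ℝ => cylDeriv q.1 q.2 := by
  unfold cylDeriv
  have h := continuous_hermiteFun
  have h1 : Continuous fun q : ℝ × ℝ => hermiteFun (q.1 + 1) q.2 :=
    h.comp (f := fun q : ℝ × ℝ => (q.1 + 1, q.2)) (by fun_prop)
  fun_prop

lemma cyl_pos {α : ℝ} (hα : 0 < α) (s : ℝ) : 0 < cyl α s :=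
  mul_pos (Real.exp_pos _) (hermiteFun_pos hα s)

lemma exists_cyl_ne_zero (α s₀ : ℝ) : ∃ s, s₀ < s ∧ cyl α s ≠ 0 := by
  obtain ⟨s, h1, h2⟩ := exists_hermiteFun_ne_zero α s₀
  exact ⟨s, h1, mul_ne_zero (Real.exp_pos _).ne' h2⟩

/-- With x = t - ξ, use y^n ≤ n! e^y and -x²/2 + 1 + |x| ≤ 6 - 2x. The rate 2 leaves a factor e^{-t}
after a quadratic weight has been absorbed. -/
lemma exp_mul_one_add_abs_pow_le (ξ t : ℝ) (n : ℕ) :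
    Real.exp (-(t - ξ) ^ 2 / 2) * (1 + |t - ξ|) ^ n ≤
      (n.factorial * Real.exp (2 * ξ + 6)) * Real.exp (-2 * t) := by
  have h1 : (1 + |t - ξ|) ^ n ≤ n.factorial * Real.exp (1 + |t - ξ|) := by
    have := Real.pow_div_factorial_le_exp (1 + |t - ξ|) (by positivity) n
    rwa [div_le_iff₀ (by positivity), mul_comm] at this
  calc _ ≤ Real.exp (-(t - ξ) ^ 2 / 2) * (n.factorial * Real.exp (1 + |t - ξ|)) := by gcongr
    _ = n.factorial * Real.exp (-(t - ξ) ^ 2 / 2 + (1 + |t - ξ|)) := by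
        rw [Real.exp_add (-(t - ξ) ^ 2 / 2)]; ring
    _ ≤ n.factorial * Real.exp (2 * ξ + 6 + -2 * t) := by
        refine mul_le_mul_of_nonneg_left (Real.exp_le_exp.2 ?_) (by positivity)
        have := sq_abs (t - ξ)
        nlinarith [sq_nonneg (|t - ξ| - 2), sq_nonneg (t - ξ - 4)]
    _ = _ := by rw [Real.exp_add]; ring

lemma exists_cyl_bound (α ξ : ℝ) : ∃ C, ∀ t, 0 ≤ t →
    |cyl α (t - ξ)| ≤ C * Real.exp (-2 * t) ∧ |cylDeriv α (t - ξ)| ≤ C * Real.exp (-2 * t) := by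
  obtain ⟨C0, hC0, n, b0⟩ := exists_hermiteFun_bound α (-ξ)
  obtain ⟨C1, hC1, m, b1⟩ := exists_hermiteFun_bound (α + 1) (-ξ)
  refine ⟨(C0 + 2 * |α| * C1) *
    ((n + m + 1).factorial * Real.exp (2 * ξ + 6)), fun t ht => ?_⟩
  set s := t - ξ with hs
  have p : 1 ≤ 1 + |s| := by linarith [abs_nonneg s]
  have q0 : (1 + |s|) ^ n ≤ (1 + |s|) ^ (n + m + 1) := pow_le_pow_right₀ p (by omega)
  have q1 : (1 + |s|) ^ (n + 1) ≤ (1 + |s|) ^ (n + m + 1) := pow_le_pow_right₀ p (by omega)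
  have q2 : (1 + |s|) ^ m ≤ (1 + |s|) ^ (n + m + 1) := pow_le_pow_right₀ p (by omega)
  have b0 := b0 s (by linarith)
  have b1 := b1 s (by linarith)
  have key := exp_mul_one_add_abs_pow_le ξ t (n + m + 1)
  rw [← hs] at key
  have hE := Real.exp_pos (-s ^ 2 / 2)
  have fin : Real.exp (-s ^ 2 / 2) * ((C0 + 2 * |α| * C1) * (1 + |s|) ^ (n + m + 1)) ≤
      (C0 + 2 * |α| * C1) * ((n + m + 1).factorial * Real.exp (2 * ξ + 6)) *
        Real.exp (-2 * t) := by
    calc _ = (C0 + 2 * |α| * C1) * (Real.exp (-s ^ 2 / 2) * (1 + |s|) ^ (n + m + 1)) := by ring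
      _ ≤ (C0 + 2 * |α| * C1) *
          (((n + m + 1).factorial * Real.exp (2 * ξ + 6)) * Real.exp (-2 * t)) := by gcongr
      _ = _ := by ring
  constructor
  · refine le_trans ?_ fin
    unfold cyl
    rw [abs_mul, abs_of_pos hE]
    gcongr
    calc _ ≤ C0 * (1 + |s|) ^ n := b0
      _ ≤ C0 * (1 + |s|) ^ (n + m + 1) := by gcongr
      _ ≤ _ := by gcongr; nlinarith [mul_nonneg (abs_nonneg α) hC1]
  · refine le_trans ?_ fin
    unfold cylDeriv
    rw [abs_mul, abs_of_pos hE]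
    gcongr
    calc _ ≤ |-2 * α * hermiteFun (α + 1) s| + |s * hermiteFun α s| := abs_sub _ _
      _ = 2 * |α| * |hermiteFun (α + 1) s| + |s| * |hermiteFun α s| := by
          simp only [abs_mul, abs_neg, abs_two]
      _ ≤ 2 * |α| * (C1 * (1 + |s|) ^ m) + (1 + |s|) * (C0 * (1 + |s|) ^ n) := by
          gcongr
          linarith
      _ = 2 * |α| * C1 * (1 + |s|) ^ m + C0 * (1 + |s|) ^ (n + 1) := by ring
      _ ≤ 2 * |α| * C1 * (1 + |s|) ^ (n + m + 1) + C0 * (1 + |s|) ^ (n + m + 1) := by gcongr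
      _ = _ := by ring

lemma cylDeriv_lt_neg_mul {α : ℝ} (hα : 0 < α) (s : ℝ) : cylDeriv α s < -s * cyl α s := by
  have h1 := hermiteFun_pos (by linarith : 0 < α + 1) s
  have h2 := mul_pos (Real.exp_pos (-s ^ 2 / 2)) (mul_pos hα h1)
  unfold cylDeriv cyl
  linarith

/-- Since Γ(α+1) = αΓ(α), f'/f equals -s minus twice the ratio of consecutive `gaussMellin` values,
and that ratio increases with α. -/
lemma cylDeriv_mul_cyl_lt {α β : ℝ} (hα : 0 < α) (hαβ : α < β) (s : ℝ) :
    cylDeriv β s * cyl α s < cylDeriv α s * cyl β s := by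
  have hβ := hα.trans hαβ
  have key := gaussMellin_ratio_lt hα hαβ s
  have gα := Real.Gamma_pos_of_pos hα
  have gβ := Real.Gamma_pos_of_pos hβ
  have pα := gaussMellin_pos hα s
  have pβ := gaussMellin_pos hβ s
  rw [div_lt_div_iff₀ pα pβ] at key
  unfold cylDeriv cyl
  have hE := Real.exp_pos (-s ^ 2 / 2)
  rw [hermiteFun_of_pos hα, hermiteFun_of_pos hβ, hermiteFun_of_pos (by linarith : 0 < α + 1),
    hermiteFun_of_pos (by linarith : 0 < β + 1), Real.Gamma_add_one hα.ne',
    Real.Gamma_add_one hβ.ne']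
  have e : Real.exp (-s ^ 2 / 2) *
        (-2 * α * (gaussMellin (α + 1) s / (α * Real.Gamma α))
          - s * (gaussMellin α s / Real.Gamma α)) *
        (Real.exp (-s ^ 2 / 2) * (gaussMellin β s / Real.Gamma β)) -
      Real.exp (-s ^ 2 / 2) *
        (-2 * β * (gaussMellin (β + 1) s / (β * Real.Gamma β))
          - s * (gaussMellin β s / Real.Gamma β)) *
        (Real.exp (-s ^ 2 / 2) * (gaussMellin α s / Real.Gamma α)) =
      Real.exp (-s ^ 2 / 2) ^ 2 * (2 / (Real.Gamma α * Real.Gamma β)) *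
        (gaussMellin (β + 1) s * gaussMellin α s - gaussMellin (α + 1) s * gaussMellin β s) := by
    field_simp
    ring
  have : 0 < Real.exp (-s ^ 2 / 2) ^ 2 * (2 / (Real.Gamma α * Real.Gamma β)) *
        (gaussMellin (β + 1) s * gaussMellin α s - gaussMellin (α + 1) s * gaussMellin β s) :=
    mul_pos (by positivity) (by linarith)
  linarith

/-! ### The critical level -/

/-- `e^{γs}(f' - γf)` for `f = cyl α`. -/
noncomputable def robinDefect (γ α s : ℝ) : ℝ :=
  Real.exp (γ * s) * (cylDeriv α s - γ * cyl α s)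

/-- The weight e^{γs} cancels the terms in f'. The turning points s² = λ + γ² that remain are the
source of the identity for ξ(γ)². -/
lemma hasDerivAt_robinDefect (γ α s : ℝ) :
    HasDerivAt (robinDefect γ α)
      ((s ^ 2 - (1 - 2 * α + γ ^ 2)) * (cyl α s * Real.exp (γ * s))) s := by
  have d := (((hasDerivAt_id s).const_mul γ).exp).fun_mul
    ((hasDerivAt_cylDeriv α s).fun_sub ((hasDerivAt_cyl α s).const_mul γ))
  refine d.congr_deriv ?_
  simp only [id]
  ring

lemma continuous_robinDefect (γ α : ℝ) : Continuous (robinDefect γ α) :=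
  continuous_iff_continuousAt.2 fun s => (hasDerivAt_robinDefect γ α s).continuousAt

lemma strictMonoOn_robinDefect {γ α : ℝ} (hα : 0 < α) {D : Set ℝ} (hD : Convex ℝ D)
    (h : ∀ s ∈ interior D, 1 - 2 * α + γ ^ 2 < s ^ 2) : StrictMonoOn (robinDefect γ α) D := by
  refine strictMonoOn_of_deriv_pos hD (continuous_robinDefect γ α).continuousOn fun s hs => ?_
  rw [(hasDerivAt_robinDefect γ α s).deriv]
  exact mul_pos (by linarith [h s hs]) (mul_pos (cyl_pos hα s) (Real.exp_pos _))

lemma strictAntiOn_robinDefect {γ α : ℝ} (hα : 0 < α) {D : Set ℝ} (hD : Convex ℝ D)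
    (h : ∀ s ∈ interior D, s ^ 2 < 1 - 2 * α + γ ^ 2) : StrictAntiOn (robinDefect γ α) D := by
  refine strictAntiOn_of_deriv_neg hD (continuous_robinDefect γ α).continuousOn fun s hs => ?_
  rw [(hasDerivAt_robinDefect γ α s).deriv]
  exact mul_neg_of_neg_of_pos (by linarith [h s hs]) (mul_pos (cyl_pos hα s) (Real.exp_pos _))

/-- The defect increases on [R,∞) but takes negative values arbitrarily far out. -/
lemma robinDefect_neg_of_ge {γ α R : ℝ} (hα : 0 < α) (hR : 0 ≤ R)
    (hR2 : R ^ 2 = 1 - 2 * α + γ ^ 2) {s : ℝ} (hs : R ≤ s) : robinDefect γ α s < 0 := by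
  have hmono : StrictMonoOn (robinDefect γ α) (Ici R) := by
    refine strictMonoOn_robinDefect hα (convex_Ici R) fun x hx => ?_
    rw [interior_Ici] at hx
    have hx : R < x := hx
    nlinarith
  by_contra! hcon
  -- Being at least -γ, x satisfies f'(x) < -x f(x) ≤ γ f(x).
  set x := max (s + 1) (-γ) with hx
  have h1 : s + 1 ≤ x := le_max_left _ _
  have h2 : -γ ≤ x := le_max_right _ _
  have h3 := hmono hs (by change R ≤ x; linarith) (by linarith : s < x)
  have h4 := cylDeriv_lt_neg_mul hα x
  have h5 := cyl_pos hα x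
  have h6 : robinDefect γ α x < 0 :=
    mul_neg_of_pos_of_neg (Real.exp_pos _) (by nlinarith)
  linarith

/-- The critical level: `cyl α` has logarithmic derivative at most `γ`, with equality at exactly
one point, which is negative. -/
theorem exists_critical_level (γ : ℝ) : ∃ α R : ℝ, 0 < α ∧ 0 < R ∧
    R ^ 2 = 1 - 2 * α + γ ^ 2 ∧ cylDeriv α (-R) = γ * cyl α (-R) ∧
    ∀ s, s ≠ -R → cylDeriv α s < γ * cyl α s := by
  -- A is the value of α at which 1 - 2α + γ² reaches 0, so ρ is the nonnegative turning point for α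
  -- in [0,A].
  set A := (1 + γ ^ 2) / 2 with hA
  have hA0 : 0 < A := by positivity
  set ρ : ℝ → ℝ := fun α => √(1 - 2 * α + γ ^ 2) with hρ
  have hρ2 : ∀ α ≤ A, ρ α ^ 2 = 1 - 2 * α + γ ^ 2 := fun α h => Real.sq_sqrt (by linarith)
  have hcont : Continuous fun α => cylDeriv α (-ρ α) - γ * cyl α (-ρ α) := by
    have c1 : Continuous fun α => cylDeriv α (-ρ α) :=
      continuous_cylDeriv₂.comp (f := fun α => (α, -ρ α)) (by fun_prop)
    have c2 : Continuous fun α => cyl α (-ρ α) :=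
      continuous_cyl₂.comp (f := fun α => (α, -ρ α)) (by fun_prop)
    fun_prop
  -- At α = 0 the solution is the Gaussian e^{-s²/2}, and f' - γf at -ρ equals (ρ - γ)f, with ρ =
  -- √(1+γ²) > γ.
  have h0 : 0 < cylDeriv 0 (-ρ 0) - γ * cyl 0 (-ρ 0) := by
    have : γ < ρ 0 := by
      refine Real.lt_sqrt_of_sq_lt ?_
      linarith
    simp only [cylDeriv, cyl, hermiteFun_zero]
    have hE := Real.exp_pos (-(-ρ 0) ^ 2 / 2)
    nlinarith
  have h1 : cylDeriv A (-ρ A) - γ * cyl A (-ρ A) < 0 := by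
    have hz : ρ A = 0 := by
      have := hρ2 A le_rfl
      rw [hA] at this
      exact pow_eq_zero_iff two_ne_zero |>.1 (by rw [← hA] at this; linarith)
    have := robinDefect_neg_of_ge hA0 le_rfl (γ := γ) (by rw [hA]; ring) (le_refl (0 : ℝ))
    simpa [robinDefect, hz] using this
  obtain ⟨α, ⟨hα0, hαA⟩, hα⟩ := intermediate_value_Icc' hA0.le hcont.continuousOn
    (show (0 : ℝ) ∈ Icc _ _ from ⟨h1.le, h0.le⟩)
  simp only at hα
  have hα0 : 0 < α := lt_of_le_of_ne hα0 (by rintro rfl; linarith)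
  have hαA : α < A := lt_of_le_of_ne hαA (by rintro rfl; linarith)
  have hR : 0 < ρ α := Real.sqrt_pos.2 (by linarith)
  have hR2 := hρ2 α hαA.le
  refine ⟨α, ρ α, hα0, hR, hR2, by linarith, fun s hs => ?_⟩
  set R := ρ α
  have hz : robinDefect γ α (-R) = 0 := by simp [robinDefect, hα]
  -- The defect rises to its zero at -R, falls until R, and is negative from R on.
  have hneg : robinDefect γ α s < 0 := by
    rcases lt_or_gt_of_ne hs with h | h
    · rw [← hz]
      refine strictMonoOn_robinDefect hα0 (convex_Iic (-R)) (fun x hx => ?_) h.le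
        (by simp) h
      rw [interior_Iic] at hx
      have hx : x < -R := hx
      nlinarith
    · rcases le_total s R with h' | h'
      · rw [← hz]
        refine strictAntiOn_robinDefect hα0 (convex_Icc (-R) R) (fun x hx => ?_)
          ⟨le_rfl, by linarith⟩ ⟨h.le, h'⟩ h
        rw [interior_Icc] at hx
        nlinarith [hx.1, hx.2]
      · exact robinDefect_neg_of_ge hα0 hR.le hR2 h'
  have := (mul_neg_iff.1 hneg).resolve_right (fun h => absurd h.1 (not_lt.2 (Real.exp_pos _).le))
  linarith [this.2]

/-! ### Test functions and weak derivatives in dimension one -/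

lemma exists_primitive_of_integral_eq_zero {g : ℝ → ℝ} (hg : ContDiff ℝ ∞ g) {a b : ℝ}
    (hsupp : ∀ t, t ∉ Ioo a b → g t = 0) (hint : ∫ t, g t = 0) :
    ∃ φ : ℝ → ℝ, ContDiff ℝ ∞ φ ∧ HasCompactSupport φ ∧ tsupport φ ⊆ Icc a b ∧ deriv φ = g := by
  have hd : ∀ t, HasDerivAt (fun t => ∫ x in a..t, g x) (g t) t := fun t =>
    intervalIntegral.integral_hasDerivAt_right (hg.continuous.intervalIntegrable _ _)
      (hg.continuous.stronglyMeasurableAtFilter _ _) hg.continuous.continuousAt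
  have hder : deriv (fun t => ∫ x in a..t, g x) = g := funext fun t => (hd t).deriv
  have hs : Function.support (fun t => ∫ x in a..t, g x) ⊆ Icc a b := by
    intro t ht
    by_contra hcon
    apply ht
    simp only [mem_Icc, not_and_or, not_le] at hcon
    rcases hcon with h | h
    · have : ∫ x in a..t, g x = ∫ x in a..t, (0 : ℝ) := by
        refine intervalIntegral.integral_congr fun x hx => hsupp x fun hx' => ?_
        rw [uIcc_of_ge h.le] at hx
        exact absurd hx'.1 (not_lt.2 hx.2)
      simpa using this
    · have : Function.support g ⊆ Ioc a t := fun x hx => by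
        have : x ∈ Ioo a b := by
          by_contra h'
          exact hx (hsupp x h')
        exact ⟨this.1, this.2.le.trans h.le⟩
      exact (intervalIntegral.integral_eq_integral_of_support_subset this).trans hint
  have hts := closure_minimal hs isClosed_Icc
  refine ⟨_, ?_, isCompact_Icc.of_isClosed_subset (isClosed_tsupport _) hts, hts, hder⟩
  rw [contDiff_infty_iff_deriv, hder]
  exact ⟨fun t => (hd t).differentiableAt, hg⟩

/-- Subtracting the right multiple of η makes the mean zero, so that the primitive has compact
support: the du Bois-Reymond device. -/
lemma exists_primitive_of_integral_eq_one {g η : ℝ → ℝ} (hg : ContDiff ℝ ∞ g)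
    (hη : ContDiff ℝ ∞ η) {a b : ℝ} (hgs : ∀ t, t ∉ Ioo a b → g t = 0)
    (hηs : ∀ t, t ∉ Ioo a b → η t = 0) (hint : ∫ t, η t = 1) :
    ∃ φ : ℝ → ℝ, ContDiff ℝ ∞ φ ∧ HasCompactSupport φ ∧ tsupport φ ⊆ Icc a b ∧
      deriv φ = fun t => g t - (∫ x, g x) * η t := by
  have hc : ∀ {f : ℝ → ℝ}, ContDiff ℝ ∞ f → (∀ t, t ∉ Ioo a b → f t = 0) → Integrable f := by
    intro f hf hs
    refine hf.continuous.integrable_of_hasCompactSupport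
      (HasCompactSupport.of_support_subset_isCompact (isCompact_Icc (a := a) (b := b)) ?_)
    intro t ht
    by_contra h
    exact ht (hs t fun h' => h (Ioo_subset_Icc_self h'))
  refine exists_primitive_of_integral_eq_zero (hg.sub (contDiff_const.mul hη)) ?_ ?_
  · intro t ht
    simp [hgs t ht, hηs t ht]
  · rw [integral_sub (hc hg hgs) ((hc hη hηs).const_mul _), integral_const_mul, hint]
    simp

lemma exists_Ioo_of_tsupport_subset_Ioi {g : ℝ → ℝ} (hg : HasCompactSupport g)
    (hs : tsupport g ⊆ Ioi 0) : ∃ a b : ℝ, 0 < a ∧ ∀ t, t ∉ Ioo a b → g t = 0 := by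
  have hK : IsCompact (tsupport g ∪ {1}) := IsCompact.union hg isCompact_singleton
  have hne : (tsupport g ∪ {1}).Nonempty := ⟨1, by simp⟩
  obtain ⟨m, hm, hm'⟩ := hK.exists_isLeast hne
  obtain ⟨M, hM, hM'⟩ := hK.exists_isGreatest hne
  have hm0 : 0 < m := by
    rcases hm with h | h
    · exact hs h
    · rw [mem_singleton_iff.1 h]; exact one_pos
  refine ⟨m / 2, M + 1, by positivity, fun t ht => ?_⟩
  by_contra hne
  have h1 : t ∈ tsupport g ∪ {1} := .inl (subset_tsupport g hne)
  have h2 := hm' h1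
  have h3 := hM' h1
  exact ht ⟨by linarith, by linarith⟩

lemma exists_bump_integral_eq_one (x : ℝ) : ∃ η : ℝ → ℝ, ContDiff ℝ ∞ η ∧
    (∀ t, t ∉ Ioo (x - 1) (x + 1) → η t = 0) ∧ ∫ t, η t = 1 := by
  let f : ContDiffBump x := ⟨1 / 2, 1, by norm_num, by norm_num⟩
  refine ⟨f.normed volume, f.contDiff_normed, fun t ht => ?_, f.integral_normed⟩
  rw [← Function.notMem_support, f.support_normed_eq, Real.ball_eq_Ioo]
  exact ht

section

variable {E : Type*} [NormedAddCommGroup E] [NormedSpace ℝ E] [CompleteSpace E]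

/-- A function on `(0, ∞)` with zero weak derivative is constant. -/
lemma ae_eq_const_of_weakDeriv_eq_zero {h : ℝ → E} (hloc : LocallyIntegrable h)
    (H : ∀ φ : ℝ → ℝ, ContDiff ℝ ∞ φ → HasCompactSupport φ → tsupport φ ⊆ Ioi 0 →
      ∫ t, deriv φ t • h t = 0) :
    ∃ κ : E, ∀ᵐ t, t ∈ Ioi (0 : ℝ) → h t = κ := by
  -- Centred at 2, the bump lives in (1,3), inside the half-line; the constant is the η-average of
  -- h.
  obtain ⟨η, hη, hηs, hηi⟩ := exists_bump_integral_eq_one 2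
  have hηc : HasCompactSupport η := by
    refine HasCompactSupport.of_support_subset_isCompact
      (isCompact_Icc (a := (1 : ℝ)) (b := 3)) fun t ht => ?_
    by_contra h
    refine ht (hηs t fun h' => h ⟨?_, ?_⟩) <;> linarith [h'.1, h'.2]
  refine ⟨∫ t, η t • h t, ?_⟩
  have key := isOpen_Ioi.ae_eq_zero_of_integral_contDiff_smul_eq_zero (μ := volume)
    (f := fun t => h t - ∫ t, η t • h t) (U := Ioi (0 : ℝ))
    ((hloc.sub (locallyIntegrable_const _)).locallyIntegrableOn _) ?_
  · filter_upwards [key] with t ht ht0 using sub_eq_zero.1 (ht ht0)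
  intro g hg hgc hgs
  obtain ⟨a, b, ha, hab⟩ := exists_Ioo_of_tsupport_subset_Ioi hgc hgs
  obtain ⟨φ, hφ, hφc, hφs, hφd⟩ := exists_primitive_of_integral_eq_one hg hη
    (a := min a 1) (b := max b 3)
    (fun t ht => hab t fun h => ht ⟨(min_le_left _ _).trans_lt h.1,
      h.2.trans_le (le_max_left _ _)⟩)
    (fun t ht => hηs t fun h => ht ⟨(min_le_right _ _).trans_lt (by linarith [h.1]),
      (by linarith [h.2] : t < 3).trans_le (le_max_right _ _)⟩) hηi
  have h0 := H φ hφ hφc (hφs.trans fun t ht => lt_of_lt_of_le (lt_min ha one_pos) ht.1)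
  have ig := hloc.integrable_smul_left_of_hasCompactSupport hg.continuous hgc
  have iη := hloc.integrable_smul_left_of_hasCompactSupport hη.continuous hηc
  have ig' : Integrable g := hg.continuous.integrable_of_hasCompactSupport hgc
  simp only [hφd, sub_smul, mul_smul] at h0
  have iη' : Integrable fun t => (∫ x, g x) • η t • h t := iη.smul _
  rw [integral_sub ig iη', integral_smul] at h0
  simp only [smul_sub]
  rw [integral_sub ig (ig'.smul_const _), integral_smul_const]
  exact h0

/-- A function on `(0, ∞)` that is orthogonal to the derivatives of all test functions on `ℝ`
vanishes. -/
lemma ae_eq_zero_of_integral_deriv_smul_eq_zero {h : ℝ → E} (hloc : LocallyIntegrable h)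
    (hneg : ∀ t ≤ 0, h t = 0)
    (H : ∀ φ : ℝ → ℝ, ContDiff ℝ ∞ φ → HasCompactSupport φ → ∫ t, deriv φ t • h t = 0) :
    ∀ᵐ t, t ∈ Ioi (0 : ℝ) → h t = 0 := by
  -- Here the bump lives in (-2,0), where h vanishes, so the correction of the mean contributes
  -- nothing and no constant survives.
  obtain ⟨η, hη, hηs, hηi⟩ := exists_bump_integral_eq_one (-1)
  refine isOpen_Ioi.ae_eq_zero_of_integral_contDiff_smul_eq_zero (μ := volume)
    (hloc.locallyIntegrableOn _) ?_
  intro g hg hgc hgs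
  obtain ⟨a, b, ha, hab⟩ := exists_Ioo_of_tsupport_subset_Ioi hgc hgs
  obtain ⟨φ, hφ, hφc, -, hφd⟩ := exists_primitive_of_integral_eq_one hg hη
    (a := -2) (b := max b 0)
    (fun t ht => hab t fun h => ht ⟨by linarith [h.1], h.2.trans_le (le_max_left _ _)⟩)
    (fun t ht => hηs t fun h => ht ⟨by linarith [h.1],
      (by linarith [h.2] : t < 0).trans_le (le_max_right _ _)⟩) hηi
  rw [← H φ hφ hφc, hφd]
  refine integral_congr_ae (.of_forall fun t => ?_)
  rcases le_or_gt t 0 with ht | ht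
  · simp [hneg t ht]
  · have : η t = 0 := hηs t fun h => by linarith [h.2]
    simp [this]

end

lemma integral_eq_setIntegral_Ioi {E : Type*} [NormedAddCommGroup E] [NormedSpace ℝ E]
    {f : ℝ → E} (h : ∀ t ≤ 0, f t = 0) : ∫ t in Ioi (0 : ℝ), f t = ∫ t, f t :=
  setIntegral_eq_integral_of_forall_compl_eq_zero fun t ht => h t (not_lt.1 ht)

lemma eq_zero_of_tsupport_subset_Ioi {F : Type*} [Zero F] {φ : ℝ → F}
    (h : tsupport φ ⊆ Ioi 0) {t : ℝ} (ht : t ≤ 0) : φ t = 0 := by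
  by_contra hne
  exact absurd (h (subset_tsupport φ hne)) (not_lt.2 ht)

lemma deriv_eq_zero_of_tsupport_subset_Ioi {F : Type*} [NormedAddCommGroup F]
    [NormedSpace ℝ F] {φ : ℝ → F} (h : tsupport φ ⊆ Ioi 0) {t : ℝ} (ht : t ≤ 0) :
    deriv φ t = 0 := by
  refine eq_zero_of_tsupport_subset_Ioi (φ := deriv φ) ?_ ht
  exact (closure_minimal (support_deriv_subset) (isClosed_tsupport _)).trans h

lemma integral_mul_deriv_eq_neg {u w φ : ℝ → ℂ} (hu : ∀ t, HasDerivAt u (w t) t)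
    (hw : Continuous w) (hφ : ContDiff ℝ ∞ φ) (hφc : HasCompactSupport φ) :
    ∫ t, u t * deriv φ t = -∫ t, w t * φ t := by
  have cu : Continuous u := continuous_iff_continuousAt.2 fun t => (hu t).continuousAt
  have cφ := hφ.continuous
  have cφ' : Continuous (deriv φ) := hφ.continuous_deriv (by simp)
  refine integral_mul_deriv_eq_deriv_mul_of_integrable (fun t _ => hu t)
    (fun t _ => (hφ.differentiable (by simp) t).hasDerivAt) ?_ ?_ ?_
  · exact (cu.mul cφ').integrable_of_hasCompactSupport (hφc.deriv.mul_left)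
  · exact (hw.mul cφ).integrable_of_hasCompactSupport (hφc.mul_left)
  · exact (cu.mul cφ).integrable_of_hasCompactSupport (hφc.mul_left)

lemma hasWeakDirDeriv_of_hasDerivAt {u w : ℝ → ℂ} (hu : ∀ t, HasDerivAt u (w t) t)
    (hw : Continuous w) : HasWeakDirDeriv (Ioi (0 : ℝ)) 1 u w := by
  intro φ hφ hφc hφs
  simp only [fderiv_apply_one_eq_deriv]
  rw [integral_eq_setIntegral_Ioi, integral_eq_setIntegral_Ioi]
  · exact integral_mul_deriv_eq_neg hu hw hφ hφc
  · intro t ht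
    rw [eq_zero_of_tsupport_subset_Ioi hφs ht, mul_zero]
  · intro t ht
    rw [deriv_eq_zero_of_tsupport_subset_Ioi hφs ht, mul_zero]

/-- A continuous function with continuous weak derivative is continuously differentiable. -/
lemma HasWeakDirDeriv.hasDerivWithinAt {u w : ℝ → ℂ}
    (h : HasWeakDirDeriv (Ioi (0 : ℝ)) 1 u w) (hu : ContinuousOn u (Ici 0))
    (hw : ContinuousOn w (Ici 0)) {t : ℝ} (ht : 0 ≤ t) :
    HasDerivWithinAt u (w t) (Ici 0) t := by
  -- Extending by the boundary value gives continuous functions on the line without changing them on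
  -- [0,∞).
  set u' : ℝ → ℂ := fun t => u (max t 0) with hu'
  set w' : ℝ → ℂ := fun t => w (max t 0) with hw'
  have cu' : Continuous u' := hu.comp_continuous (by fun_prop) fun t => le_max_right t 0
  have cw' : Continuous w' := hw.comp_continuous (by fun_prop) fun t => le_max_right t 0
  set U : ℝ → ℂ := fun t => ∫ x in (0 : ℝ)..t, w' x
  have hU : ∀ t, HasDerivAt U (w' t) t := fun t =>
    intervalIntegral.integral_hasDerivAt_right (cw'.intervalIntegrable _ _)
      (cw'.stronglyMeasurableAtFilter _ _) cw'.continuousAt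
  have cU : Continuous U := continuous_iff_continuousAt.2 fun t => (hU t).continuousAt
  obtain ⟨κ, hκ⟩ := ae_eq_const_of_weakDeriv_eq_zero (h := fun t => u' t - U t)
    (cu'.sub cU).locallyIntegrable (fun φ hφ hφc hφs => by
      set ψ : ℝ → ℂ := fun t => (φ t : ℂ) with hψ
      have hψd : ∀ t, HasDerivAt ψ ((deriv φ t : ℝ) : ℂ) t := fun t =>
        ((hφ.differentiable (by simp) t).hasDerivAt).ofReal_comp
      have hψ' : deriv ψ = fun t => ((deriv φ t : ℝ) : ℂ) := funext fun t => (hψd t).deriv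
      have hψc : ContDiff ℝ ∞ ψ := Complex.ofRealCLM.contDiff.comp hφ
      have hψcs : HasCompactSupport ψ := hφc.comp_left (g := fun x : ℝ => (x : ℂ)) (by simp)
      have hψs : tsupport ψ ⊆ Ioi 0 := by
        refine (closure_mono ?_).trans hφs
        intro t ht hz
        exact ht (by simp [hψ, hz])
      have e1 := h ψ hψc hψcs hψs
      have e2 := integral_mul_deriv_eq_neg hU cw' hψc hψcs
      simp only [fderiv_apply_one_eq_deriv] at e1
      have e3 : ∫ t in Ioi (0 : ℝ), u t * deriv ψ t = ∫ t, u' t * deriv ψ t := by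
        rw [← integral_eq_setIntegral_Ioi (f := fun t => u' t * deriv ψ t) fun t ht => by
          rw [deriv_eq_zero_of_tsupport_subset_Ioi hψs ht, mul_zero]]
        refine setIntegral_congr_fun measurableSet_Ioi fun t ht => ?_
        simp only [hu', max_eq_left (le_of_lt (mem_Ioi.1 ht))]
      have e4 : ∫ t in Ioi (0 : ℝ), w t * ψ t = ∫ t, w' t * ψ t := by
        rw [← integral_eq_setIntegral_Ioi (f := fun t => w' t * ψ t) fun t ht => by
          rw [eq_zero_of_tsupport_subset_Ioi hψs ht, mul_zero]]
        refine setIntegral_congr_fun measurableSet_Ioi fun t ht => ?_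
        simp only [hw', max_eq_left (le_of_lt (mem_Ioi.1 ht))]
      rw [e3, e4, ← e2] at e1
      have cψ' : Continuous (deriv ψ) := hψc.continuous_deriv (by simp)
      have i1 : Integrable fun t => u' t * deriv ψ t :=
        (cu'.mul cψ').integrable_of_hasCompactSupport hψcs.deriv.mul_left
      have i2 : Integrable fun t => U t * deriv ψ t :=
        (cU.mul cψ').integrable_of_hasCompactSupport hψcs.deriv.mul_left
      rw [← sub_eq_zero, ← integral_sub i1 i2] at e1
      rw [← e1]
      refine integral_congr_ae (.of_forall fun t => ?_)
      simp only [hψ', Complex.real_smul]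
      ring)
  have hae : (fun t => u' t - U t) =ᵐ[volume.restrict (Ici (0 : ℝ))] fun _ => κ := by
    rw [← restrict_Ioi_eq_restrict_Ici]
    exact (ae_restrict_iff' measurableSet_Ioi).2 hκ
  have heq : ∀ t, 0 ≤ t → u' t - U t = κ := fun t ht =>
    Measure.eqOn_of_ae_eq hae (cu'.sub cU).continuousOn continuousOn_const
      (by rw [interior_Ici, closure_Ioi]) ht
  have hfin : HasDerivWithinAt (fun t => U t + κ) (w' t) (Ici 0) t :=
    ((hU t).add_const κ).hasDerivWithinAt
  have hval : ∀ x, 0 ≤ x → u x = U x + κ := by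
    intro x hx
    rw [← heq x hx]
    simp [hu', max_eq_left hx]
  have hwt : w' t = w t := by simp [hw', max_eq_left ht]
  rw [hwt] at hfin
  exact hfin.congr (fun x hx => hval x hx) (hval t ht)

/-! ### Eigenvalues of the half-line operators -/

lemma memLp_Ioi_of_exp_bound {F : ℝ → ℂ} (hF : Continuous F) {C : ℝ}
    (h : ∀ t, 0 ≤ t → ‖F t‖ ≤ C * Real.exp (-t)) : MemLp F 2 (volume.restrict (Ioi 0)) := by
  rw [memLp_two_iff_integrable_sq_norm hF.aestronglyMeasurable]
  have hi : IntegrableOn (fun t : ℝ => C ^ 2 * Real.exp (-2 * t)) (Ioi 0) :=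
    (integrableOn_exp_mul_Ioi (by norm_num) 0).const_mul _
  refine Integrable.mono' hi (by fun_prop) ?_
  filter_upwards [ae_restrict_mem measurableSet_Ioi] with t ht
  rw [Real.norm_of_nonneg (by positivity)]
  calc ‖F t‖ ^ 2 ≤ (C * Real.exp (-t)) ^ 2 := by
        gcongr
        exact h t (le_of_lt ht)
    _ = C ^ 2 * Real.exp (-2 * t) := by
        rw [mul_pow, ← Real.exp_nat_mul]; ring_nf

lemma sq_le_two_mul_exp {t : ℝ} (ht : 0 ≤ t) : t ^ 2 ≤ 2 * Real.exp t := by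
  have := Real.pow_div_factorial_le_exp t ht 2
  rw [div_le_iff₀ (by positivity)] at this
  norm_num [Nat.factorial] at this
  linarith

lemma exp_neg_two_mul_le {t : ℝ} (ht : 0 ≤ t) : Real.exp (-2 * t) ≤ Real.exp (-t) :=
  Real.exp_le_exp.2 (by linarith)

lemma abs_sq_sub_mul_exp_le (ξ lam : ℝ) {t : ℝ} (ht : 0 ≤ t) :
    |(t - ξ) ^ 2 - lam| * Real.exp (-2 * t) ≤ (4 + 2 * ξ ^ 2 + |lam|) * Real.exp (-t) := by
  have h1 : |(t - ξ) ^ 2 - lam| ≤ (4 + 2 * ξ ^ 2 + |lam|) * Real.exp t := by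
    have h2 := sq_le_two_mul_exp ht
    have h3 := Real.one_le_exp ht
    have h4 : |(t - ξ) ^ 2 - lam| ≤ (t - ξ) ^ 2 + |lam| := by
      refine (abs_sub _ _).trans ?_
      rw [abs_of_nonneg (sq_nonneg _)]
    have h5 : 2 * ξ ^ 2 + |lam| ≤ (2 * ξ ^ 2 + |lam|) * Real.exp t :=
      le_mul_of_one_le_right (by positivity) h3
    nlinarith [sq_nonneg (t + ξ)]
  calc _ ≤ (4 + 2 * ξ ^ 2 + |lam|) * Real.exp t * Real.exp (-2 * t) := by gcongr
    _ = _ := by rw [mul_assoc, ← Real.exp_add]; ring_nf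

lemma hasDerivAt_cyl_shift (α ξ t : ℝ) :
    HasDerivAt (fun t => (cyl α (t - ξ) : ℂ)) (cylDeriv α (t - ξ) : ℂ) t :=
  (HasDerivAt.comp_sub_const t ξ (hasDerivAt_cyl α (t - ξ))).ofReal_comp

lemma hasDerivAt_cylDeriv_shift (α ξ t : ℝ) :
    HasDerivAt (fun t => (cylDeriv α (t - ξ) : ℂ))
      ((((t - ξ) ^ 2 - (1 - 2 * α)) * cyl α (t - ξ) : ℝ) : ℂ) t :=
  (HasDerivAt.comp_sub_const t ξ (hasDerivAt_cylDeriv α (t - ξ))).ofReal_comp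

lemma continuous_cyl (α : ℝ) : Continuous (cyl α) :=
  continuous_iff_continuousAt.2 fun s => (hasDerivAt_cyl α s).continuousAt

lemma continuous_cylDeriv (α : ℝ) : Continuous (cylDeriv α) :=
  continuous_iff_continuousAt.2 fun s => (hasDerivAt_cylDeriv α s).continuousAt

lemma memLp_cyl (α ξ : ℝ) :
    MemLp (fun t => (cyl α (t - ξ) : ℂ)) 2 (volume.restrict (Ioi 0)) := by
  obtain ⟨C, hC⟩ := exists_cyl_bound α ξ
  have hC0 : 0 ≤ C := by
    have := (abs_nonneg _).trans (hC 0 le_rfl).1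
    simpa using this
  have := continuous_cyl α
  refine memLp_Ioi_of_exp_bound (C := C) (by fun_prop) fun t ht => ?_
  rw [Complex.norm_real]
  exact (hC t ht).1.trans (mul_le_mul_of_nonneg_left (exp_neg_two_mul_le ht) hC0)

lemma memLp_cylDeriv (α ξ : ℝ) :
    MemLp (fun t => (cylDeriv α (t - ξ) : ℂ)) 2 (volume.restrict (Ioi 0)) := by
  obtain ⟨C, hC⟩ := exists_cyl_bound α ξ
  have hC0 : 0 ≤ C := by
    have := (abs_nonneg _).trans (hC 0 le_rfl).1
    simpa using this
  have := continuous_cylDeriv α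
  refine memLp_Ioi_of_exp_bound (C := C) (by fun_prop) fun t ht => ?_
  rw [Complex.norm_real]
  exact (hC t ht).2.trans (mul_le_mul_of_nonneg_left (exp_neg_two_mul_le ht) hC0)

lemma memLp_quadratic_mul_cyl (α ξ η lam : ℝ) :
    MemLp (fun t => ((((t - η) ^ 2 - lam) * cyl α (t - ξ) : ℝ) : ℂ)) 2
      (volume.restrict (Ioi 0)) := by
  obtain ⟨C, hC⟩ := exists_cyl_bound α ξ
  have hC0 : 0 ≤ C := by
    have := (abs_nonneg _).trans (hC 0 le_rfl).1
    simpa using this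
  have := continuous_cyl α
  refine memLp_Ioi_of_exp_bound (C := C * (4 + 2 * η ^ 2 + |lam|)) (by fun_prop) fun t ht => ?_
  rw [Complex.norm_real, Real.norm_eq_abs, abs_mul]
  calc _ ≤ |(t - η) ^ 2 - lam| * (C * Real.exp (-2 * t)) := by
        gcongr
        exact (hC t ht).1
    _ = C * (|(t - η) ^ 2 - lam| * Real.exp (-2 * t)) := by ring
    _ ≤ C * ((4 + 2 * η ^ 2 + |lam|) * Real.exp (-t)) :=
        mul_le_mul_of_nonneg_left (abs_sq_sub_mul_exp_le η lam ht) hC0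
    _ = _ := by ring

lemma mem_eigenvalues_of_cyl {α γ ξ : ℝ} (h : cylDeriv α (-ξ) = γ * cyl α (-ξ)) :
    1 - 2 * α ∈ eigenvalues γ ξ := by
  have c0 := continuous_cyl α
  have c1 := continuous_cylDeriv α
  refine ⟨fun t => (cyl α (t - ξ) : ℂ), fun t => (cylDeriv α (t - ξ) : ℂ),
    fun t => ((((t - ξ) ^ 2 - (1 - 2 * α)) * cyl α (t - ξ) : ℝ) : ℂ),
    ⟨memLp_cyl α ξ, memLp_cylDeriv α ξ, memLp_quadratic_mul_cyl α ξ ξ _,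
      hasWeakDirDeriv_of_hasDerivAt (hasDerivAt_cyl_shift α ξ) (by fun_prop),
      hasWeakDirDeriv_of_hasDerivAt (hasDerivAt_cylDeriv_shift α ξ) (by fun_prop),
      by fun_prop, by fun_prop, ?_⟩, ?_, ?_, ?_⟩
  · simpa using memLp_quadratic_mul_cyl α ξ 0 0
  · simp only [zero_sub, h, Complex.ofReal_mul]
  · intro hz
    obtain ⟨s, hs, hne⟩ := exists_cyl_ne_zero α (-ξ)
    have := Measure.eqOn_open_of_ae_eq hz isOpen_Ioi (by fun_prop) (by fun_prop)
      (show s + ξ ∈ Ioi (0 : ℝ) by simp only [mem_Ioi]; linarith)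
    simp [hne] at this
  · refine .of_forall fun t => ?_
    push_cast
    ring

/-- Uniqueness for the initial value problem on the half-line. -/
lemma eq_zero_of_initial_eq_zero {V u u₁ : ℝ → ℂ} (hV : ContinuousOn V (Ici 0))
    (hu : ∀ t, 0 ≤ t → HasDerivWithinAt u (u₁ t) (Ici 0) t)
    (hu₁ : ∀ t, 0 ≤ t → HasDerivWithinAt u₁ (V t * u t) (Ici 0) t)
    (h0 : u 0 = 0) (h1 : u₁ 0 = 0) {t : ℝ} (ht : 0 ≤ t) : u t = 0 := by
  obtain ⟨M, hM⟩ := isCompact_Icc.exists_bound_of_continuousOn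
    (hV.mono fun x (hx : x ∈ Icc 0 t) => hx.1)
  have hd : ∀ x, 0 ≤ x → HasDerivWithinAt (fun x => (u x, u₁ x)) (u₁ x, V x * u x) (Ici 0) x :=
    fun x hx => (hu x hx).prodMk (hu₁ x hx)
  have := eq_zero_of_abs_deriv_le_mul_abs_self_of_eq_zero_right (a := 0) (b := t)
    (f := fun x => (u x, u₁ x)) (f' := fun x => (u₁ x, V x * u x)) (K := max 1 M)
    (fun x hx => ((hd x hx.1).continuousWithinAt).mono Icc_subset_Ici_self)
    (fun x hx => (hd x hx.1).mono (Ici_subset_Ici.2 hx.1)) (by simp [h0, h1]) (fun x hx => by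
      have h3 := hM x ⟨hx.1, hx.2.le⟩
      have e1 : ‖u x‖ ≤ ‖(u x, u₁ x)‖ := le_max_left _ _
      have e2 : ‖u₁ x‖ ≤ ‖(u x, u₁ x)‖ := le_max_right _ _
      rw [Prod.norm_mk (u₁ x), max_le_iff]
      refine ⟨?_, ?_⟩
      · calc ‖u₁ x‖ ≤ 1 * ‖(u x, u₁ x)‖ := by rw [one_mul]; exact e2
          _ ≤ _ := by gcongr; exact le_max_left _ _
      · rw [norm_mul]
        have hM' : ‖V x‖ ≤ max 1 M := h3.trans (le_max_right _ _)
        gcongr) t ⟨ht, le_rfl⟩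
  exact congrArg Prod.fst this

/-- The Wronskian of an eigenfunction u with the decaying solution is constant, and integrable as a
combination of products of L² functions, hence zero. At t = 0 this is the Robin condition times
u(0); if u(0) = 0, then u'(0) = 0 too and u vanishes by uniqueness. -/
lemma cyl_of_mem_eigenvalues {α γ ξ : ℝ} (h : 1 - 2 * α ∈ eigenvalues γ ξ) :
    cylDeriv α (-ξ) = γ * cyl α (-ξ) := by
  obtain ⟨u, u₁, u₂, hB, hbc, hne, heq⟩ := h
  set V : ℝ → ℂ := fun t => ((t : ℂ) - ξ) ^ 2 - ((1 - 2 * α : ℝ) : ℂ) with hV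
  have cV : Continuous V := by fun_prop
  have hweak2 : HasWeakDirDeriv (Ioi (0 : ℝ)) 1 u₁ (fun t => V t * u t) := by
    intro φ hφ hφc hφs
    rw [hB.hasWeakDeriv2 φ hφ hφc hφs]
    congr 1
    refine integral_congr_ae ?_
    filter_upwards [heq] with t ht
    have : u₂ t = V t * u t := by simp only [hV]; linear_combination -ht
    rw [this]
  have hu : ∀ t, 0 ≤ t → HasDerivWithinAt u (u₁ t) (Ici 0) t := fun t ht =>
    hB.hasWeakDeriv.hasDerivWithinAt hB.continuousOn hB.continuousOn_deriv ht
  have hu₁ : ∀ t, 0 ≤ t → HasDerivWithinAt u₁ (V t * u t) (Ici 0) t := fun t ht =>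
    hweak2.hasDerivWithinAt hB.continuousOn_deriv (cV.continuousOn.mul hB.continuousOn) ht
  set W : ℝ → ℂ := fun t => u t * (cylDeriv α (t - ξ) : ℂ) - u₁ t * (cyl α (t - ξ) : ℂ) with hW
  have dW : ∀ t, 0 ≤ t → HasDerivWithinAt W 0 (Ici 0) t := by
    intro t ht
    refine (((hu t ht).fun_mul (hasDerivAt_cylDeriv_shift α ξ t).hasDerivWithinAt).fun_sub
      ((hu₁ t ht).fun_mul (hasDerivAt_cyl_shift α ξ t).hasDerivWithinAt)).congr_deriv ?_
    simp only [hV]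
    push_cast
    ring
  have hconst : ∀ t, 0 ≤ t → W t = W 0 := fun t ht =>
    constant_of_has_deriv_right_zero
      (fun x hx => (dW x hx.1).continuousWithinAt.mono Icc_subset_Ici_self)
      (fun x hx => (dW x hx.1).mono (Ici_subset_Ici.2 hx.1)) t ⟨ht, le_rfl⟩
  have iW : IntegrableOn W (Ioi 0) :=
    (hB.memLp.integrable_mul (memLp_cylDeriv α ξ)).sub
      (hB.memLp_deriv.integrable_mul (memLp_cyl α ξ))
  have iW' : IntegrableOn (fun _ => W 0) (Ioi (0 : ℝ)) :=
    IntegrableOn.congr_fun iW (fun t ht => hconst t (le_of_lt ht)) measurableSet_Ioi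
  have hW0 : W 0 = 0 := by
    rw [integrableOn_const_iff] at iW'
    simpa using iW'
  by_cases hu0 : u 0 = 0
  · exfalso
    apply hne
    filter_upwards [ae_restrict_mem measurableSet_Ioi] with t ht
    exact eq_zero_of_initial_eq_zero cV.continuousOn hu hu₁ hu0 (by rw [hbc, hu0, mul_zero])
      (le_of_lt ht)
  · have : u 0 * ((cylDeriv α (-ξ) : ℂ) - γ * cyl α (-ξ)) = 0 := by
      rw [← hW0]
      simp only [hW, hbc, zero_sub]
      ring
    have := (mul_eq_zero.1 this).resolve_left hu0
    exact_mod_cast sub_eq_zero.1 this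

lemma mem_eigenvalues_iff {lam γ ξ : ℝ} :
    lam ∈ eigenvalues γ ξ ↔
      cylDeriv ((1 - lam) / 2) (-ξ) = γ * cyl ((1 - lam) / 2) (-ξ) := by
  have e : lam = 1 - 2 * ((1 - lam) / 2) := by ring
  constructor
  · intro h
    rw [e] at h
    exact cyl_of_mem_eigenvalues h
  · intro h
    rw [e]
    exact mem_eigenvalues_of_cyl h

/-! ### Existence of a lowest eigenvalue -/

/-- Sequences with the Hermite recurrence oscillate: a fixed Robin-type combination of consecutive
terms cannot keep its sign. -/
lemma hermite_recurrence_oscillates {H : ℕ → ℝ} {s b : ℝ}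
    (hrec : ∀ m : ℕ, H (m + 2) = 2 * s * H (m + 1) - 2 * (m + 1) * H m)
    (hsign : ∀ m : ℕ, 0 ≤ 2 * (m + 1) * H m - b * H (m + 1)) :
    ∃ m, H m = 0 ∧ H (m + 1) = 0 := by
  set B := max 1 (max |s| |b|) with hB
  have hB1 : 1 ≤ B := le_max_left _ _
  have hBs : |s| ≤ B := (le_max_left _ _).trans (le_max_right _ _)
  have hBb : |b| ≤ B := (le_max_right _ _).trans (le_max_right _ _)
  have hprod : ∀ c y : ℝ, |c| ≤ B → c * y ≤ B * |y| ∧ -(B * |y|) ≤ c * y := by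
    intro c y hc
    have : |c * y| ≤ B * |y| := by rw [abs_mul]; gcongr
    exact ⟨(le_abs_self _).trans this, (abs_le.1 this).1⟩
  -- The sign condition at m bounds N·H m below. The one at m+2, rewritten by the recurrence, gives
  -- H (m+2) ≥ -2B|H (m+1)|, which bounds N·H m = 2s·H (m+1) - H (m+2) above.
  have key : ∀ m : ℕ, 24 * B ^ 2 < 2 * (m + 1) → 2 * (m + 1) * |H m| ≤ 4 * B * |H (m + 1)| := by
    intro m hm
    set N : ℝ := 2 * (m + 1) with hN
    have c1 := hsign m
    have c3 := hsign (m + 2)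
    have r1 := hrec m
    have r2 := hrec (m + 1)
    push_cast at c3 r2
    rw [show m + 2 + 1 = m + 1 + 2 by ring, r2, show m + 1 + 1 = m + 2 by ring] at c3
    set y := H (m + 1)
    set A := H (m + 2)
    have hy := abs_nonneg y
    have hsb : s * b ≤ B ^ 2 := by
      have : |s * b| ≤ B * B := by rw [abs_mul]; gcongr
      nlinarith [le_abs_self (s * b)]
    have hA : -(2 * B * |y|) ≤ A := by
      by_contra! hcon
      have hA0 : A < 0 := hcon.trans_le (by nlinarith)
      have h1 := (hprod b y hBb).1
      have h2 : (N + 4) / 2 ≤ N + 4 - 2 * (s * b) := by nlinarith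
      nlinarith
    have h1 := (hprod b y hBb).2
    have h2 := (hprod s y hBs).1
    have hN0 : 0 < N := by positivity
    rw [← abs_of_pos hN0, ← abs_mul, abs_le]
    constructor <;> nlinarith
  obtain ⟨m, hm⟩ := exists_nat_gt (24 * B ^ 2)
  have hm1 : 24 * B ^ 2 < 2 * ((m : ℝ) + 1) := by
    have : (0 : ℝ) ≤ m := by positivity
    linarith
  have k1 := key m hm1
  have k2 := key (m + 1) (by push_cast; linarith)
  have r1 := hrec m
  push_cast at k2
  rw [show m + 1 + 1 = m + 2 by ring, r1] at k2
  have hs := abs_sub (2 * s * H (m + 1)) (2 * (m + 1) * H m)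
  have hN0 : (0 : ℝ) < 2 * (m + 1) := by positivity
  rw [abs_mul, abs_mul, abs_two, abs_mul, abs_of_pos hN0] at hs
  have hy := abs_nonneg (H (m + 1))
  have hsy : |s| * |H (m + 1)| ≤ B * |H (m + 1)| := by gcongr
  -- `k1` and `k2` together give 2(m+2)|H (m+1)| ≤ 4B·6B|H (m+1)|, which is why m was taken beyond
  -- 24B².
  have hy0 : |H (m + 1)| = 0 := by
    by_contra hne
    have hpos : 0 < |H (m + 1)| := lt_of_le_of_ne hy (Ne.symm hne)
    have h3 : |2 * s * H (m + 1) - 2 * (m + 1) * H m| ≤ 6 * B * |H (m + 1)| := by linarith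
    have h4 : 4 * B * |2 * s * H (m + 1) - 2 * (m + 1) * H m| ≤
        4 * B * (6 * B * |H (m + 1)|) := by gcongr
    nlinarith
  rw [hy0, mul_zero] at k1
  have hx0 : |H m| = 0 := by nlinarith [abs_nonneg (H m)]
  exact ⟨m, abs_eq_zero.1 hx0, abs_eq_zero.1 hy0⟩

/-- At α = -m the Hermite function is the Hermite polynomial of degree m. -/
lemma hermiteFun_neg_nat_recurrence (s : ℝ) (m : ℕ) :
    hermiteFun (-((m + 2 : ℕ) : ℝ)) s =
      2 * s * hermiteFun (-((m + 1 : ℕ) : ℝ)) s - 2 * (m + 1) * hermiteFun (-(m : ℝ)) s := by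
  rw [hermiteFun_recurrence (-((m + 2 : ℕ) : ℝ))]
  push_cast
  rw [show -((m : ℝ) + 2) + 2 = -m by ring, show -((m : ℝ) + 2) + 1 = -(m + 1) by ring]
  ring

lemma hermiteFun_neg_nat_ne_zero (s : ℝ) (m : ℕ) :
    ¬(hermiteFun (-(m : ℝ)) s = 0 ∧ hermiteFun (-((m + 1 : ℕ) : ℝ)) s = 0) := by
  induction m with
  | zero => simp [hermiteFun_zero]
  | succ m ih =>
    rintro ⟨h1, h2⟩
    refine ih ⟨?_, h1⟩
    have r := hermiteFun_neg_nat_recurrence s m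
    rw [show m + 1 + 1 = m + 2 by ring] at h2
    rw [h1, h2, mul_zero, zero_sub, eq_comm, neg_eq_zero] at r
    have hm : (2 : ℝ) * (m + 1) ≠ 0 := by positivity
    exact (mul_eq_zero.1 r).resolve_left hm

/-- The Robin condition for the decaying solution, as an equation for the spectral parameter. -/
noncomputable def robinCharacteristic (γ s α : ℝ) : ℝ := cylDeriv α s - γ * cyl α s

lemma continuous_robinCharacteristic (γ s : ℝ) : Continuous (robinCharacteristic γ s) := by
  unfold robinCharacteristic
  have c1 : Continuous fun α => cylDeriv α s :=
    continuous_cylDeriv₂.comp (f := fun α => (α, s)) (by fun_prop)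
  have c2 : Continuous fun α => cyl α s :=
    continuous_cyl₂.comp (f := fun α => (α, s)) (by fun_prop)
  fun_prop

lemma robinCharacteristic_neg_nat (γ s : ℝ) (m : ℕ) :
    robinCharacteristic γ s (-((m + 1 : ℕ) : ℝ)) = Real.exp (-s ^ 2 / 2) *
      (2 * (m + 1) * hermiteFun (-(m : ℝ)) s
        - (s + γ) * hermiteFun (-((m + 1 : ℕ) : ℝ)) s) := by
  unfold robinCharacteristic cylDeriv cyl
  push_cast
  rw [show -((m : ℝ) + 1) + 1 = -m by ring]
  ring

/-- The characteristic function is continuous in α. At α = -(m+1) it is a combination of two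
consecutive Hermite polynomials; it cannot keep one strict sign for all m, as two consecutive
polynomials have no common zero. -/
lemma exists_robinCharacteristic_eq_zero (γ s : ℝ) : ∃ α, robinCharacteristic γ s α = 0 := by
  have hE := Real.exp_pos (-s ^ 2 / 2)
  have h1 : ∃ α, robinCharacteristic γ s α ≤ 0 := by
    by_contra! hcon
    obtain ⟨m, hm⟩ := hermite_recurrence_oscillates (H := fun m => hermiteFun (-(m : ℝ)) s)
      (s := s) (b := s + γ) (hermiteFun_neg_nat_recurrence s) (fun m => by
        have := hcon (-((m + 1 : ℕ) : ℝ))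
        rw [robinCharacteristic_neg_nat] at this
        exact (pos_of_mul_pos_right this hE.le).le)
    exact hermiteFun_neg_nat_ne_zero s m hm
  have h2 : ∃ α, 0 ≤ robinCharacteristic γ s α := by
    by_contra! hcon
    obtain ⟨m, hm⟩ := hermite_recurrence_oscillates (H := fun m => -hermiteFun (-(m : ℝ)) s)
      (s := s) (b := s + γ) (fun m => by rw [hermiteFun_neg_nat_recurrence]; ring) (fun m => by
        have := hcon (-((m + 1 : ℕ) : ℝ))
        rw [robinCharacteristic_neg_nat] at this
        have := (mul_neg_iff.1 this).resolve_right fun h => absurd h.1 (not_lt.2 hE.le)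
        linarith [this.2])
    exact hermiteFun_neg_nat_ne_zero s m ⟨neg_eq_zero.1 hm.1, neg_eq_zero.1 hm.2⟩
  obtain ⟨a, ha⟩ := h1
  obtain ⟨b, hb⟩ := h2
  exact mem_range_of_exists_le_of_exists_ge (continuous_robinCharacteristic γ s) ⟨a, ha⟩ ⟨b, hb⟩

lemma mem_eigenvalues_iff_robinCharacteristic {lam γ ξ : ℝ} :
    lam ∈ eigenvalues γ ξ ↔ robinCharacteristic γ (-ξ) ((1 - lam) / 2) = 0 := by
  rw [mem_eigenvalues_iff, robinCharacteristic, sub_eq_zero]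

/-- A smaller eigenvalue means a larger α, where f'/f is strictly smaller and so cannot equal γ. -/
lemma le_of_mem_eigenvalues {α γ ξ lam : ℝ} (hα : 0 < α)
    (hle : cylDeriv α (-ξ) ≤ γ * cyl α (-ξ)) (h : lam ∈ eigenvalues γ ξ) : 1 - 2 * α ≤ lam := by
  rw [mem_eigenvalues_iff] at h
  by_contra! hcon
  have hαβ : α < (1 - lam) / 2 := by linarith
  have h1 := cylDeriv_mul_cyl_lt hα hαβ (-ξ)
  have h2 := cyl_pos (hα.trans hαβ) (-ξ)
  rw [h] at h1
  have := mul_le_mul_of_nonneg_right hle h2.le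
  linarith

/-- The eigenvalues are the zero set of a continuous function, hence closed; a nonempty closed set
bounded below has a least element. -/
lemma isLeast_mu {γ ξ m : ℝ} (hm : ∀ lam ∈ eigenvalues γ ξ, m ≤ lam) :
    IsLeast (eigenvalues γ ξ) (mu γ ξ) := by
  have hcl : IsClosed (eigenvalues γ ξ) := by
    have : eigenvalues γ ξ =
        (fun lam => robinCharacteristic γ (-ξ) ((1 - lam) / 2)) ⁻¹' {0} :=
      ext fun lam => mem_eigenvalues_iff_robinCharacteristic
    rw [this]
    exact isClosed_singleton.preimage
      ((continuous_robinCharacteristic γ (-ξ)).comp (by fun_prop))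
  have hne : (eigenvalues γ ξ).Nonempty := by
    obtain ⟨α, hα⟩ := exists_robinCharacteristic_eq_zero γ (-ξ)
    refine ⟨1 - 2 * α, mem_eigenvalues_iff_robinCharacteristic.2 ?_⟩
    rw [← hα]; congr 1; ring
  exact hcl.isLeast_csInf hne ⟨m, hm⟩

/-- The minimisation problem for the first eigenvalue on the half-line. -/
theorem exists_minimal_mu (γ : ℝ) : ∃ α R : ℝ, 0 < α ∧ 0 < R ∧
    R ^ 2 = 1 - 2 * α + γ ^ 2 ∧ cylDeriv α (-R) = γ * cyl α (-R) ∧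
    (∀ s, cylDeriv α s ≤ γ * cyl α s) ∧
    (∀ ξ, IsLeast (eigenvalues γ ξ) (mu γ ξ)) ∧ (∀ ξ, ξ ≠ R → mu γ R < mu γ ξ) := by
  obtain ⟨α, R, hα, hR, hR2, heq, hlt⟩ := exists_critical_level γ
  have hle : ∀ s, cylDeriv α s ≤ γ * cyl α s := fun s => by
    by_cases h : s = -R
    · rw [h, heq]
    · exact (hlt s h).le
  have hlow : ∀ ξ, ∀ lam ∈ eigenvalues γ ξ, 1 - 2 * α ≤ lam := fun ξ lam h =>
    le_of_mem_eigenvalues hα (hle _) h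
  have hleast : ∀ ξ, IsLeast (eigenvalues γ ξ) (mu γ ξ) := fun ξ => isLeast_mu (hlow ξ)
  refine ⟨α, R, hα, hR, hR2, heq, hle, hleast, fun ξ hξ => ?_⟩
  have h1 : mu γ R ≤ 1 - 2 * α := (hleast R).2 (mem_eigenvalues_of_cyl heq)
  refine h1.trans_lt (lt_of_le_of_ne (hlow ξ _ (hleast ξ).1) fun h => ?_)
  have h2 := (hleast ξ).1
  rw [← h] at h2
  exact (hlt (-ξ) (fun h => hξ (neg_injective h))).ne (cyl_of_mem_eigenvalues h2)

/-! ### The quadratic form inequality on the half-line -/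

lemma intervalIntegrable_of_locallyIntegrable {D : ℝ → ℝ} (hD : LocallyIntegrable D) (a b : ℝ) :
    IntervalIntegrable D volume a b :=
  (hD.integrableOn_isCompact isCompact_uIcc).intervalIntegrable

/-- The derivative of a form-domain function is only L², so integration by parts is done for
absolutely continuous functions. -/
lemma absolutelyContinuousOnInterval_const_add_primitive {D : ℝ → ℝ} (hD : LocallyIntegrable D) (a : ℝ)
    (T : ℝ) :
    AbsolutelyContinuousOnInterval (fun t => a + ∫ x in (0 : ℝ)..t, D x) 0 T := by
  have h1 : AbsolutelyContinuousOnInterval (fun t => ∫ x in (0 : ℝ)..t, D x) 0 T :=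
    (intervalIntegrable_of_locallyIntegrable hD 0 T).absolutelyContinuousOnInterval_intervalIntegral
      (by simp)
  have h2 : AbsolutelyContinuousOnInterval (fun _ : ℝ => a) 0 T :=
    contDiffOn_const.absolutelyContinuousOnInterval
  exact h2.fun_add h1

lemma ae_hasDerivAt_const_add_primitive {D : ℝ → ℝ} (hD : LocallyIntegrable D) (a : ℝ) :
    ∀ᵐ t, HasDerivAt (fun t => a + ∫ x in (0 : ℝ)..t, D x) (D t) t := by
  filter_upwards [LocallyIntegrable.ae_hasDerivAt_integral hD] with t ht
  exact (ht 0).const_add a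

lemma integral_primitive_mul {D : ℝ → ℝ} (hD : LocallyIntegrable D) (a : ℝ)
    {g g' : ℝ → ℝ} (hg : ∀ t, HasDerivAt g (g' t) t)
    (hg' : Continuous g') (T : ℝ) :
    ∫ t in (0 : ℝ)..T, (D t * g t + (a + ∫ x in (0 : ℝ)..t, D x) * g' t) =
      (a + ∫ x in (0 : ℝ)..T, D x) * g T - a * g 0 := by
  have hgd : deriv g = g' := funext fun t => (hg t).deriv
  have hg1 : ContDiff ℝ 1 g := contDiff_one_iff_deriv.2
    ⟨fun t => (hg t).differentiableAt, hgd ▸ hg'⟩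
  have ac := (absolutelyContinuousOnInterval_const_add_primitive hD a T).fun_mul
    hg1.contDiffOn.absolutelyContinuousOnInterval
  have h := ac.integral_deriv_eq_sub
  simp only [intervalIntegral.integral_same, add_zero] at h
  rw [← h]
  refine intervalIntegral.integral_congr_ae ?_
  filter_upwards [ae_hasDerivAt_const_add_primitive hD a] with t ht _
  exact (ht.fun_mul (hg t)).deriv.symm

lemma integral_primitive_sq_mul {D : ℝ → ℝ} (hD : LocallyIntegrable D) (a : ℝ)
    {g g' : ℝ → ℝ} (hg : ∀ t, HasDerivAt g (g' t) t)
    (hg' : Continuous g') (T : ℝ) :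
    ∫ t in (0 : ℝ)..T, (2 * g t * (a + ∫ x in (0 : ℝ)..t, D x) * D t
        + (a + ∫ x in (0 : ℝ)..t, D x) ^ 2 * g' t) =
      g T * (a + ∫ x in (0 : ℝ)..T, D x) ^ 2 - g 0 * a ^ 2 := by
  have hgd : deriv g = g' := funext fun t => (hg t).deriv
  have hg1 : ContDiff ℝ 1 g := contDiff_one_iff_deriv.2
    ⟨fun t => (hg t).differentiableAt, hgd ▸ hg'⟩
  have ac0 := absolutelyContinuousOnInterval_const_add_primitive hD a T
  have ac := ac0.fun_mul (ac0.fun_mul hg1.contDiffOn.absolutelyContinuousOnInterval)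
  have h := ac.integral_deriv_eq_sub
  simp only [intervalIntegral.integral_same, add_zero] at h
  trans (a + ∫ x in (0 : ℝ)..T, D x) * ((a + ∫ x in (0 : ℝ)..T, D x) * g T) - a * (a * g 0)
  · rw [← h]
    refine intervalIntegral.integral_congr_ae ?_
    filter_upwards [ae_hasDerivAt_const_add_primitive hD a] with t ht _
    rw [(ht.fun_mul (ht.fun_mul (hg t))).deriv]
    ring
  · ring

lemma continuous_const_add_primitive {D : ℝ → ℝ} (hD : LocallyIntegrable D) (a : ℝ) :
    Continuous fun t => a + ∫ x in (0 : ℝ)..t, D x :=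
  continuous_const.add (intervalIntegral.continuous_primitive
    (intervalIntegrable_of_locallyIntegrable hD) 0)

/-- Green's formula characterises the absolutely continuous representative. -/
lemma ae_eq_primitive_of_green {c d : ℝ → ℝ} {a : ℝ}
    (hc : MemLp c 2 (volume.restrict (Ioi 0))) (hd : LocallyIntegrable ((Ioi 0).indicator d))
    (H : ∀ φ : ℝ → ℝ, ContDiff ℝ ∞ φ → HasCompactSupport φ →
      ∫ t in Ioi (0 : ℝ), c t * deriv φ t = -(∫ t in Ioi (0 : ℝ), d t * φ t) - a * φ 0) :
    ∀ᵐ t ∂(volume.restrict (Ioi 0)),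
      c t = a + ∫ x in (0 : ℝ)..t, (Ioi (0 : ℝ)).indicator d x := by
  set D := (Ioi (0 : ℝ)).indicator d with hDdef
  set C : ℝ → ℝ := fun t => a + ∫ x in (0 : ℝ)..t, D x with hC
  have cC : Continuous C := continuous_const_add_primitive hd a
  have lc : LocallyIntegrable ((Ioi 0).indicator c) := by
    have : MemLp ((Ioi 0).indicator c) 2 volume := (memLp_indicator_iff_restrict
      measurableSet_Ioi).2 hc
    exact this.locallyIntegrable (by norm_num)
  have lC : LocallyIntegrable ((Ioi (0 : ℝ)).indicator C) :=
    cC.locallyIntegrable.indicator measurableSet_Ioi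
  -- The test functions need not vanish at 0, so Green's formula fixes the additive constant as
  -- well: it is the trace a.
  have key := ae_eq_zero_of_integral_deriv_smul_eq_zero
    (h := fun t => (Ioi (0 : ℝ)).indicator c t - (Ioi (0 : ℝ)).indicator C t)
    (lc.sub lC) (fun t ht => by simp [not_lt.2 ht]) (fun φ hφ hφc => by
      have cφ' : Continuous (deriv φ) := hφ.continuous_deriv (by simp)
      obtain ⟨T0, hT0⟩ := hφc.isCompact.bddAbove
      set T := max T0 0 + 1 with hT
      have hTpos : 0 < T := by positivity
      have hvan : ∀ t, T ≤ t → φ t = 0 := fun t ht => by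
        by_contra hne
        have := hT0 (subset_tsupport φ hne)
        linarith [le_max_left T0 0]
      have hvan' : ∀ t, T ≤ t → deriv φ t = 0 := fun t ht => by
        by_contra hne
        have := hT0 (support_deriv_subset hne)
        linarith [le_max_left T0 0]
      have e := integral_primitive_mul hd a
        (fun t => (hφ.differentiable (by simp) t).hasDerivAt) cφ' T
      rw [hvan T le_rfl, mul_zero, zero_sub, intervalIntegral.integral_of_le hTpos.le] at e
      have iD : IntegrableOn (fun t => D t * φ t) (Ioc 0 T) := by
        have := hd.integrable_smul_left_of_hasCompactSupport hφ.continuous hφc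
        refine (this.congr (.of_forall fun t => ?_)).integrableOn
        simp only [smul_eq_mul, mul_comm, hDdef]
      have iC : Integrable (fun t => C t * deriv φ t) :=
        (cC.mul cφ').integrable_of_hasCompactSupport hφc.deriv.mul_left
      rw [integral_add iD iC.integrableOn] at e
      have e1 : ∫ t in Ioc 0 T, D t * φ t = ∫ t in Ioi (0 : ℝ), d t * φ t := by
        rw [setIntegral_eq_of_subset_of_forall_sdiff_eq_zero measurableSet_Ioi
          (fun t ht => ht.1 : Ioc 0 T ⊆ Ioi 0) (f := fun t => d t * φ t)]
        · refine setIntegral_congr_fun measurableSet_Ioc fun t ht => ?_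
          simp [hDdef, ht.1]
        · intro t ht
          have : T ≤ t := by
            by_contra hcon
            exact ht.2 ⟨ht.1, (not_le.1 hcon).le⟩
          rw [hvan t this, mul_zero]
      have e2 : ∫ t in Ioc 0 T, C t * deriv φ t = ∫ t in Ioi (0 : ℝ), C t * deriv φ t := by
        rw [← setIntegral_eq_of_subset_of_forall_sdiff_eq_zero measurableSet_Ioi
          (fun t ht => ht.1 : Ioc 0 T ⊆ Ioi 0) (f := fun t => C t * deriv φ t)]
        intro t ht
        have : T ≤ t := by
          by_contra hcon
          exact ht.2 ⟨ht.1, (not_le.1 hcon).le⟩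
        rw [hvan' t this, mul_zero]
      rw [e1, e2] at e
      have h0 := H φ hφ hφc
      have i1 : Integrable fun t => deriv φ t • (Ioi (0 : ℝ)).indicator c t :=
        lc.integrable_smul_left_of_hasCompactSupport cφ' hφc.deriv
      have i2 : Integrable fun t => deriv φ t • (Ioi (0 : ℝ)).indicator C t :=
        lC.integrable_smul_left_of_hasCompactSupport cφ' hφc.deriv
      simp only [smul_sub]
      rw [integral_sub i1 i2]
      have f1 : ∀ f : ℝ → ℝ, ∫ t, deriv φ t • (Ioi (0 : ℝ)).indicator f t =
          ∫ t in Ioi (0 : ℝ), f t * deriv φ t := by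
        intro f
        rw [← integral_indicator measurableSet_Ioi]
        refine integral_congr_ae (.of_forall fun t => ?_)
        by_cases ht : t ∈ Ioi (0 : ℝ) <;> simp [ht, mul_comm]
      rw [f1, f1, h0]
      linarith)
  rw [ae_restrict_iff' measurableSet_Ioi]
  filter_upwards [key] with t ht ht0
  have := ht ht0
  simp only [indicator_of_mem ht0] at this
  linarith

/-! ### The Riccati equation and completion of the square -/

/-- The logarithmic derivative of the decaying solution. -/
noncomputable def cylLogDeriv (α s : ℝ) : ℝ := cylDeriv α s / cyl α s

lemma hasDerivAt_cylLogDeriv {α : ℝ} (hα : 0 < α) (s : ℝ) :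
    HasDerivAt (cylLogDeriv α) (s ^ 2 - (1 - 2 * α) - cylLogDeriv α s ^ 2) s := by
  have hp := (cyl_pos hα s).ne'
  refine ((hasDerivAt_cylDeriv α s).div (hasDerivAt_cyl α s) hp).congr_deriv ?_
  unfold cylLogDeriv
  field_simp

/-- For s ≥ 1 the recurrence gives 2K_{α+1} ≤ K_α, while f'/f = -s - 2αK_{α+1}/K_α. This at most
linear decrease controls the boundary term at infinity. -/
lemma neg_sub_le_cylLogDeriv {α s : ℝ} (hα : 0 < α) (hs : 1 ≤ s) :
    -s - α ≤ cylLogDeriv α s := by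
  have h0 := cyl_pos hα s
  rw [cylLogDeriv, le_div_iff₀ h0]
  have h1 := hermiteFun_pos (by linarith : 0 < α + 1) s
  have h2 := hermiteFun_pos (by linarith : 0 < α + 2) s
  have r := hermiteFun_recurrence α s
  have h3 : 2 * hermiteFun (α + 1) s ≤ hermiteFun α s := by
    have : 0 < 2 * (α + 1) * hermiteFun (α + 2) s := by positivity
    nlinarith
  have hE := Real.exp_pos (-s ^ 2 / 2)
  unfold cyl cylDeriv
  have : 0 ≤ Real.exp (-s ^ 2 / 2) * (α * (hermiteFun α s - 2 * hermiteFun (α + 1) s)) := by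
    apply mul_nonneg hE.le (mul_nonneg hα.le _)
    linarith
  linarith

lemma exists_cylLogDeriv_lower_bound {α : ℝ} (hα : 0 < α) (ξ : ℝ) :
    ∃ K, 0 < K ∧ ∀ t, 0 ≤ t → -(K * (1 + t)) ≤ cylLogDeriv α (t - ξ) := by
  have hc : Continuous (cylLogDeriv α) :=
    continuous_iff_continuousAt.2 fun s => (hasDerivAt_cylLogDeriv hα s).continuousAt
  obtain ⟨M, hM⟩ := isCompact_Icc.exists_bound_of_continuousOn
    (hc.continuousOn (s := Icc (-ξ) 1))
  refine ⟨|M| + (1 + |ξ| + α), by positivity, fun t ht => ?_⟩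
  have hξ := neg_abs_le ξ
  have hM0 := abs_nonneg M
  have hξ0 := abs_nonneg ξ
  rcases le_total 1 (t - ξ) with h | h
  · have := neg_sub_le_cylLogDeriv hα h
    nlinarith
  · have h1 := hM (t - ξ) ⟨by linarith, h⟩
    rw [Real.norm_eq_abs] at h1
    have h2 := neg_abs_le (cylLogDeriv α (t - ξ))
    have h3 := le_abs_self M
    nlinarith

/-- By the Riccati equation for h = f'/f, the inequality (D - hC)² ≥ 0 reads D² + ((t-ξ)² - λ)C² ≥
(hC²)'. Integration gives -h(0)a² ≥ -γa² at 0, plus a term at T that is at least -K(1+T)C(T)². If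
the claim failed, (1+T)C(T)² would stay above a positive constant, contradicting its integrability.
-/
lemma halfLine_form_ge_real {α γ ξ : ℝ} (hα : 0 < α)
    (hle : cylDeriv α (-ξ) ≤ γ * cyl α (-ξ)) {c d : ℝ → ℝ} {a : ℝ}
    (hc : MemLp c 2 (volume.restrict (Ioi 0))) (hd : MemLp d 2 (volume.restrict (Ioi 0)))
    (hw : MemLp (fun t => (t - ξ) * c t) 2 (volume.restrict (Ioi 0)))
    (H : ∀ φ : ℝ → ℝ, ContDiff ℝ ∞ φ → HasCompactSupport φ →
      ∫ t in Ioi (0 : ℝ), c t * deriv φ t = -(∫ t in Ioi (0 : ℝ), d t * φ t) - a * φ 0) :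
    (1 - 2 * α) * ∫ t in Ioi (0 : ℝ), c t ^ 2 ≤
      (∫ t in Ioi (0 : ℝ), d t ^ 2) + (∫ t in Ioi (0 : ℝ), ((t - ξ) * c t) ^ 2) + γ * a ^ 2 := by
  set m := 1 - 2 * α with hm
  set D := (Ioi (0 : ℝ)).indicator d with hDdef
  have hD2 : MemLp D 2 volume := (memLp_indicator_iff_restrict measurableSet_Ioi).2 hd
  have lD : LocallyIntegrable D := hD2.locallyIntegrable (by norm_num)
  set C : ℝ → ℝ := fun t => a + ∫ x in (0 : ℝ)..t, D x with hC
  have cC : Continuous C := continuous_const_add_primitive lD a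
  have hcC := ae_eq_primitive_of_green hc lD H
  have ic : IntegrableOn (fun t => c t ^ 2) (Ioi 0) := hc.integrable_sq
  have iw : IntegrableOn (fun t => ((t - ξ) * c t) ^ 2) (Ioi 0) := hw.integrable_sq
  have id : IntegrableOn (fun t => d t ^ 2) (Ioi 0) := hd.integrable_sq
  have iE : IntegrableOn (fun t => D t ^ 2 + ((t - ξ) ^ 2 - m) * C t ^ 2) (Ioi 0) := by
    refine ((id.add iw).sub (ic.const_mul m)).congr ?_
    filter_upwards [hcC, ae_restrict_mem measurableSet_Ioi] with t ht ht0
    change d t ^ 2 + ((t - ξ) * c t) ^ 2 - m * c t ^ 2 = _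
    have : D t = d t := by simp [hDdef, mem_Ioi.1 ht0]
    rw [this, ht]; ring
  have hE : ∫ t in Ioi (0 : ℝ), (D t ^ 2 + ((t - ξ) ^ 2 - m) * C t ^ 2) =
      (∫ t in Ioi (0 : ℝ), d t ^ 2) + (∫ t in Ioi (0 : ℝ), ((t - ξ) * c t) ^ 2)
        - m * ∫ t in Ioi (0 : ℝ), c t ^ 2 := by
    rw [← integral_add id iw, ← integral_const_mul, ← integral_sub (id.fun_add iw) (ic.const_mul m)]
    refine integral_congr_ae ?_
    filter_upwards [hcC, ae_restrict_mem measurableSet_Ioi] with t ht ht0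
    have : D t = d t := by simp [hDdef, mem_Ioi.1 ht0]
    rw [this, ht]; ring
  suffices hsuff : 0 ≤ (∫ t in Ioi (0 : ℝ), (D t ^ 2 + ((t - ξ) ^ 2 - m) * C t ^ 2))
      + γ * a ^ 2 by linarith
  obtain ⟨K, hK, hKb⟩ := exists_cylLogDeriv_lower_bound hα ξ
  set h : ℝ → ℝ := fun t => cylLogDeriv α (t - ξ) with hh
  have hder : ∀ t, HasDerivAt h ((t - ξ) ^ 2 - m - h t ^ 2) t := fun t =>
    HasDerivAt.comp_sub_const t ξ (hasDerivAt_cylLogDeriv hα (t - ξ))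
  have ch : Continuous h := continuous_iff_continuousAt.2 fun t => (hder t).continuousAt
  have h0 : h 0 ≤ γ := by
    simp only [hh, zero_sub, cylLogDeriv]
    rwa [div_le_iff₀ (cyl_pos hα _)]
  have hT : ∀ T, 0 ≤ T → -(K * ((1 + T) * C T ^ 2)) - γ * a ^ 2 ≤
      ∫ t in (0 : ℝ)..T, (D t ^ 2 + ((t - ξ) ^ 2 - m) * C t ^ 2) := by
    intro T hT0
    have e := integral_primitive_sq_mul lD a hder (by fun_prop) T
    have i1 : IntervalIntegrable (fun t => D t ^ 2 + ((t - ξ) ^ 2 - m) * C t ^ 2) volume 0 T :=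
      (intervalIntegrable_iff_integrableOn_Ioc_of_le hT0).2 (iE.mono_set Ioc_subset_Ioi_self)
    have iD : IntervalIntegrable D volume 0 T :=
      intervalIntegrable_of_locallyIntegrable lD 0 T
    have i2 : IntervalIntegrable (fun t => 2 * h t * C t * D t
        + C t ^ 2 * ((t - ξ) ^ 2 - m - h t ^ 2)) volume 0 T := by
      refine (iD.continuousOn_mul
        (by fun_prop : Continuous fun t => 2 * h t * C t).continuousOn).add ?_
      exact Continuous.intervalIntegrable (by fun_prop) _ _
    have hmono := intervalIntegral.integral_mono_on hT0 i2 i1 (fun t _ => by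
      nlinarith [sq_nonneg (D t - h t * C t)])
    refine le_trans ?_ hmono
    rw [e]
    have h2 := mul_le_mul_of_nonneg_right (hKb T hT0) (sq_nonneg (C T))
    have h3 := mul_le_mul_of_nonneg_right h0 (sq_nonneg a)
    simp only [hC, hh] at h2 h3 ⊢
    linarith
  by_contra! hneg
  set E := ∫ t in Ioi (0 : ℝ), (D t ^ 2 + ((t - ξ) ^ 2 - m) * C t ^ 2) with hEdef
  set δ := -(E + γ * a ^ 2) / 2 with hδ
  have hδ0 : 0 < δ := by rw [hδ]; linarith
  have hlim := intervalIntegral_tendsto_integral_Ioi (0 : ℝ) iE tendsto_id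
  have hev : ∀ᶠ T in atTop, (∫ t in (0 : ℝ)..T, (D t ^ 2 + ((t - ξ) ^ 2 - m) * C t ^ 2))
      < E + δ := hlim.eventually_lt_const (by linarith)
  obtain ⟨T0, hT0⟩ := eventually_atTop.1 (hev.and (eventually_ge_atTop 0))
  have hlow : ∀ t, T0 ≤ t → δ / K ≤ (1 + t) * C t ^ 2 := by
    intro t ht
    obtain ⟨h1, h2⟩ := hT0 t ht
    have h3 := hT t h2
    rw [div_le_iff₀ hK]
    have : E + γ * a ^ 2 = -(2 * δ) := by rw [hδ]; ring
    linarith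
  have hT00 : 0 ≤ T0 := (hT0 T0 le_rfl).2
  have iC : IntegrableOn (fun t => (2 + |ξ|) * c t ^ 2 + ((t - ξ) * c t) ^ 2) (Ioi 0) :=
    (ic.const_mul _).add iw
  have iconst : IntegrableOn (fun _ : ℝ => δ / K) (Ioi T0) := by
    refine Integrable.mono' (iC.mono_set (Ioi_subset_Ioi hT00)) (by fun_prop) ?_
    have hcC' : ∀ᵐ t ∂(volume.restrict (Ioi T0)), c t = C t :=
      ae_restrict_of_ae_restrict_of_subset (Ioi_subset_Ioi hT00) hcC
    filter_upwards [hcC', ae_restrict_mem measurableSet_Ioi] with t ht ht0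
    rw [Real.norm_of_nonneg (by positivity)]
    refine (hlow t (le_of_lt ht0)).trans ?_
    rw [ht]
    -- This is where the weighted norm of c enters: it makes (1+t)C² integrable.
    have h1 : 1 + t ≤ 2 + |ξ| + (t - ξ) ^ 2 := by
      nlinarith [le_abs_self ξ, sq_nonneg (t - ξ - 1 / 2)]
    nlinarith [mul_le_mul_of_nonneg_right h1 (sq_nonneg (C t))]
  rw [integrableOn_const_iff] at iconst
  have : δ / K ≠ 0 := by positivity
  simp [this] at iconst

/-- The lowest eigenvalue bounds the quadratic form on the half-line from below. -/
theorem halfLine_form_ge {α γ ξ : ℝ} (hα : 0 < α)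
    (hle : cylDeriv α (-ξ) ≤ γ * cyl α (-ξ)) {c d : ℝ → ℂ} {a : ℂ}
    (hc : MemLp c 2 (volume.restrict (Ioi 0))) (hd : MemLp d 2 (volume.restrict (Ioi 0)))
    (hw : MemLp (fun t => ((t - ξ : ℝ) : ℂ) * c t) 2 (volume.restrict (Ioi 0)))
    (H : ∀ φ : ℝ → ℝ, ContDiff ℝ ∞ φ → HasCompactSupport φ →
      ∫ t in Ioi (0 : ℝ), c t * (deriv φ t : ℝ) =
        -(∫ t in Ioi (0 : ℝ), d t * (φ t : ℝ)) - a * (φ 0 : ℝ)) :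
    (1 - 2 * α) * ∫ t in Ioi (0 : ℝ), ‖c t‖ ^ 2 ≤
      (∫ t in Ioi (0 : ℝ), ‖d t‖ ^ 2) + (∫ t in Ioi (0 : ℝ), ‖((t - ξ : ℝ) : ℂ) * c t‖ ^ 2)
        + γ * ‖a‖ ^ 2 := by
  have htest : ∀ (f : ℝ → ℂ) (ψ : ℝ → ℝ), MemLp f 2 (volume.restrict (Ioi 0)) →
      Continuous ψ → HasCompactSupport ψ →
      Integrable (fun t => f t * (ψ t : ℝ)) (volume.restrict (Ioi 0)) := by
    intro f ψ hf hψ hψc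
    refine hf.integrable_mul (q := 2) (g := fun t => ((ψ t : ℝ) : ℂ)) ?_
    have : MemLp (fun t => ((ψ t : ℝ) : ℂ)) 2 volume :=
      (by fun_prop : Continuous fun t => ((ψ t : ℝ) : ℂ)).memLp_of_hasCompactSupport
        (hψc.comp_left (g := fun x : ℝ => (x : ℂ)) (by simp))
    exact this.restrict _
  have hre := halfLine_form_ge_real hα hle (a := a.re) hc.re hd.re
    (hw.re.ae_eq (.of_forall fun t => by simp)) (fun φ hφ hφc => by
      have i1 := htest c (deriv φ) hc (hφ.continuous_deriv (by simp)) hφc.deriv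
      have i2 := htest d φ hd hφ.continuous hφc
      have h1 := congrArg Complex.re (H φ hφ hφc)
      simp only [Complex.sub_re, Complex.neg_re, Complex.re_mul_ofReal] at h1
      have e1 := integral_re i1
      have e2 := integral_re i2
      simp only [RCLike.re_to_complex, Complex.re_mul_ofReal] at e1 e2 ⊢
      rw [e1, e2, h1])
  have him := halfLine_form_ge_real hα hle (a := a.im) hc.im hd.im
    (hw.im.ae_eq (.of_forall fun t => by simp)) (fun φ hφ hφc => by
      have i1 := htest c (deriv φ) hc (hφ.continuous_deriv (by simp)) hφc.deriv
      have i2 := htest d φ hd hφ.continuous hφc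
      have h1 := congrArg Complex.im (H φ hφ hφc)
      simp only [Complex.sub_im, Complex.neg_im, Complex.im_mul_ofReal] at h1
      have e1 := integral_im i1
      have e2 := integral_im i2
      simp only [RCLike.im_to_complex, Complex.im_mul_ofReal] at e1 e2 ⊢
      rw [e1, e2, h1])
  have hsplit : ∀ f : ℝ → ℂ, MemLp f 2 (volume.restrict (Ioi 0)) →
      ∫ t in Ioi (0 : ℝ), ‖f t‖ ^ 2 =
        (∫ t in Ioi (0 : ℝ), (f t).re ^ 2) + ∫ t in Ioi (0 : ℝ), (f t).im ^ 2 := by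
    intro f hf
    have i1 : Integrable (fun t => (f t).re ^ 2) (volume.restrict (Ioi 0)) := hf.re.integrable_sq
    have i2 : Integrable (fun t => (f t).im ^ 2) (volume.restrict (Ioi 0)) := hf.im.integrable_sq
    rw [← integral_add i1 i2]
    refine integral_congr_ae (.of_forall fun t => ?_)
    simp only [Complex.sq_norm, Complex.normSq_apply]
    ring
  rw [hsplit c hc, hsplit d hd, hsplit _ hw, Complex.sq_norm, Complex.normSq_apply]
  simp only [RCLike.re_to_complex, RCLike.im_to_complex] at hre him
  simp only [Complex.re_ofReal_mul, Complex.im_ofReal_mul]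
  linarith

/-! ### Fourier series in the tangential variable -/

lemma volume_restrict_halfPlane :
    (volume : Measure (ℝ × ℝ)).restrict halfPlane =
      (volume : Measure ℝ).prod (volume.restrict (Ioi 0)) := by
  have : halfPlane = (univ : Set ℝ) ×ˢ Ioi (0 : ℝ) := by
    ext p
    simp [halfPlane]
  rw [this, Measure.volume_eq_prod, ← Measure.prod_restrict, Measure.restrict_univ]

/-- Parseval on (-L,L]: since f vanishes outside, each integral over the line is 2L times a Fourier
coefficient. -/
lemma hasSum_sq_fourierIntegral {L : ℝ} (hL : 0 < L) {f : ℝ → ℂ} (hf : MemLp f 2 volume)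
    (hs : ∀ x, L ≤ |x| → f x = 0) :
    HasSum (fun n : ℤ => ‖∫ x, f x * Complex.exp (-(Complex.I * ((Real.pi * n / L : ℝ) * x)))‖ ^ 2)
      (2 * L * ∫ x, ‖f x‖ ^ 2) := by
  have hab : -L < L := by linarith
  have h := (hasSum_sq_fourierCoeffOn hab (hf.restrict _)).mul_left ((2 * L) ^ 2)
  have hout : ∀ x, x ∉ Ioc (-L) L → f x = 0 := by
    intro x hx
    apply hs
    by_contra hcon
    rw [not_le, abs_lt] at hcon
    exact hx ⟨hcon.1, hcon.2.le⟩
  have hint : ∀ {E : Type} [NormedAddCommGroup E] [NormedSpace ℝ E] (g : ℝ → E),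
      (∀ x, x ∉ Ioc (-L) L → g x = 0) → ∫ x in -L..L, g x = ∫ x, g x := by
    intro E _ _ g hg
    rw [intervalIntegral.integral_of_le hab.le]
    exact setIntegral_eq_integral_of_forall_compl_eq_zero hg
  have e2 : (2 * L) ^ 2 * ((L - -L)⁻¹ • ∫ x in -L..L, ‖f x‖ ^ 2) = 2 * L * ∫ x, ‖f x‖ ^ 2 := by
    rw [hint _ fun x hx => by simp [hout x hx], smul_eq_mul,
      show L - -L = 2 * L by ring]
    field_simp
  rw [e2] at h
  refine h.congr_fun fun n => ?_
  rw [fourierCoeffOn_eq_integral, hint _ fun x hx => by simp [hout x hx], norm_smul,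
    show L - -L = 2 * L by ring, Real.norm_of_nonneg (by positivity),
    show ∀ z : ℝ, (2 * L) ^ 2 * (1 / (2 * L) * z) ^ 2 = z ^ 2 from fun z => by field_simp]
  congr 2
  refine integral_congr_ae (.of_forall fun x => ?_)
  simp only [fourier_coe_apply, smul_eq_mul]
  rw [mul_comm]
  congr 2
  push_cast
  field_simp

/-- `e^{-ikx₁} e^{-ix₁x₂/2}`: a plane wave in the tangential variable, combined with the change of
gauge from `A₀` to `(-x₂, 0)`. -/
noncomputable def gaugedWave (k : ℝ) (p : ℝ × ℝ) : ℂ :=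
  Complex.exp (-(Complex.I * (k * p.1 + p.1 * p.2 / 2)))

lemma norm_gaugedWave (k : ℝ) (p : ℝ × ℝ) : ‖gaugedWave k p‖ = 1 := by
  have : gaugedWave k p =
      Complex.exp (((-(k * p.1 + p.1 * p.2 / 2) : ℝ) : ℂ) * Complex.I) := by
    unfold gaugedWave
    congr 1
    push_cast
    ring
  rw [this, Complex.norm_exp_ofReal_mul_I]

lemma contDiff_gaugedWave (k : ℝ) : ContDiff ℝ ∞ (gaugedWave k) := by
  unfold gaugedWave
  have h1 : ContDiff ℝ ∞ fun p : ℝ × ℝ => (p.1 : ℂ) := Complex.ofRealCLM.contDiff.comp contDiff_fst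
  have h2 : ContDiff ℝ ∞ fun p : ℝ × ℝ => (p.2 : ℂ) := Complex.ofRealCLM.contDiff.comp contDiff_snd
  exact (contDiff_const.mul ((contDiff_const.mul h1).add ((h1.mul h2).div_const _))).neg.cexp

lemma continuous_gaugedWave (k : ℝ) : Continuous (gaugedWave k) := (contDiff_gaugedWave k).continuous

/-- The coefficients of `F` along `gaugedWave k`. -/
noncomputable def waveCoeff (k : ℝ) (F : ℝ × ℝ → ℂ) (t : ℝ) : ℂ :=
  ∫ x, F (x, t) * gaugedWave k (x, t)

lemma aestronglyMeasurable_waveCoeff (k : ℝ) {F : ℝ × ℝ → ℂ}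
    (hF : MemLp F 2 (volume.restrict halfPlane)) :
    AEStronglyMeasurable (waveCoeff k F) (volume.restrict (Ioi 0)) := by
  have h1 := hF.aestronglyMeasurable
  rw [volume_restrict_halfPlane] at h1
  have h2 : AEStronglyMeasurable (fun p : ℝ × ℝ => F p * gaugedWave k p)
      ((volume : Measure ℝ).prod (volume.restrict (Ioi 0))) :=
    h1.mul (continuous_gaugedWave k).aestronglyMeasurable
  exact h2.prod_swap.integral_prod_right'

lemma ae_hasSum_sq_waveCoeff {L : ℝ} (hL : 0 < L) {F : ℝ × ℝ → ℂ}
    (hF : MemLp F 2 (volume.restrict halfPlane)) (hs : ∀ p : ℝ × ℝ, L ≤ |p.1| → F p = 0) :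
    ∀ᵐ t ∂(volume.restrict (Ioi (0 : ℝ))),
      HasSum (fun n : ℤ => ‖waveCoeff (Real.pi * n / L) F t‖ ^ 2)
        (2 * L * ∫ x, ‖F (x, t)‖ ^ 2) := by
  have h1 := hF.aestronglyMeasurable
  have h2 := hF.integrable_norm_pow (by norm_num)
  rw [volume_restrict_halfPlane] at h1 h2
  filter_upwards [h1.prodMk_right, h2.prod_left_ae] with t ht1 ht2
  have hmem : MemLp (fun x => F (x, t) * Complex.exp (-(Complex.I * (x * t / 2)))) 2 volume := by
    have hm : AEStronglyMeasurable
        (fun x => F (x, t) * Complex.exp (-(Complex.I * (x * t / 2)))) volume :=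
      ht1.mul (by fun_prop : Continuous fun x : ℝ =>
        Complex.exp (-(Complex.I * (x * t / 2)))).aestronglyMeasurable
    rw [memLp_two_iff_integrable_sq_norm hm]
    refine ht2.congr (.of_forall fun x => ?_)
    have := norm_gaugedWave 0 (x, t)
    simp only [gaugedWave, Complex.ofReal_zero, zero_mul, zero_add] at this
    simp [this]
  have key := hasSum_sq_fourierIntegral hL hmem (fun x hx => by simp [hs (x, t) hx])
  have e1 : ∫ x : ℝ, ‖F (x, t) * Complex.exp (-(Complex.I * (x * t / 2)))‖ ^ 2 =
      ∫ x, ‖F (x, t)‖ ^ 2 := by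
    refine integral_congr_ae (.of_forall fun x => ?_)
    have := norm_gaugedWave 0 (x, t)
    simp only [gaugedWave, Complex.ofReal_zero, zero_mul, zero_add] at this
    simp [this]
  rw [e1] at key
  refine key.congr_fun fun n => ?_
  unfold waveCoeff gaugedWave
  congr 2
  refine integral_congr_ae (.of_forall fun x => ?_)
  simp only
  rw [mul_assoc, ← Complex.exp_add]
  congr 2
  ring

lemma integrable_integral_sq {F : ℝ × ℝ → ℂ} (hF : MemLp F 2 (volume.restrict halfPlane)) :
    Integrable (fun t => ∫ x, ‖F (x, t)‖ ^ 2) (volume.restrict (Ioi 0)) := by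
  have h2 := hF.integrable_norm_pow (by norm_num)
  rw [volume_restrict_halfPlane] at h2
  exact h2.integral_prod_right

lemma memLp_waveCoeff {L : ℝ} (hL : 0 < L) {F : ℝ × ℝ → ℂ}
    (hF : MemLp F 2 (volume.restrict halfPlane)) (hs : ∀ p : ℝ × ℝ, L ≤ |p.1| → F p = 0)
    (n : ℤ) : MemLp (waveCoeff (Real.pi * n / L) F) 2 (volume.restrict (Ioi 0)) := by
  have hm := aestronglyMeasurable_waveCoeff (Real.pi * n / L) hF
  rw [memLp_two_iff_integrable_sq_norm hm]
  refine Integrable.mono' ((integrable_integral_sq hF).const_mul (2 * L)) (hm.norm.pow 2) ?_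
  filter_upwards [ae_hasSum_sq_waveCoeff hL hF hs] with t ht
  rw [Real.norm_of_nonneg (by positivity)]
  exact le_hasSum ht n fun _ _ => by positivity

/-- Parseval's identity in the tangential variable. -/
lemma hasSum_integral_sq_waveCoeff {L : ℝ} (hL : 0 < L) {F : ℝ × ℝ → ℂ}
    (hF : MemLp F 2 (volume.restrict halfPlane)) (hs : ∀ p : ℝ × ℝ, L ≤ |p.1| → F p = 0) :
    HasSum (fun n : ℤ => ∫ t in Ioi (0 : ℝ), ‖waveCoeff (Real.pi * n / L) F t‖ ^ 2)
      (2 * L * ∫ p in halfPlane, ‖F p‖ ^ 2) := by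
  have hae := ae_hasSum_sq_waveCoeff hL hF hs
  have h := hasSum_integral_of_dominated_convergence (μ := volume.restrict (Ioi (0 : ℝ)))
    (fun (n : ℤ) t => ‖waveCoeff (Real.pi * n / L) F t‖ ^ 2)
    (fun n => (aestronglyMeasurable_waveCoeff (Real.pi * n / L) hF).norm.pow 2)
    (fun n => .of_forall fun t => (Real.norm_of_nonneg (sq_nonneg _)).le)
    (hae.mono fun t ht => ht.summable)
    (((integrable_integral_sq hF).const_mul (2 * L)).congr
      (hae.mono fun t ht => ht.tsum_eq.symm)) hae
  rw [integral_const_mul] at h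
  have h2 := hF.integrable_norm_pow (by norm_num)
  rw [volume_restrict_halfPlane] at h2 ⊢
  rw [integral_prod_symm _ h2]
  exact h

lemma memLp_mul_compact {μ : Measure (ℝ × ℝ)} {W : ℝ × ℝ → ℂ} (hW : MemLp W 2 μ)
    {a : ℝ → ℂ} (ha : Continuous a) (hac : HasCompactSupport a) :
    MemLp (fun p => a p.1 * W p) 2 μ := by
  obtain ⟨C, hC⟩ := ha.bounded_above_of_compact_support hac
  refine hW.of_le_mul (c := C)
    ((ha.comp continuous_fst).aestronglyMeasurable.mul hW.aestronglyMeasurable)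
    (.of_forall fun p => ?_)
  rw [norm_mul]
  gcongr
  exact hC p.1

lemma integrable_mul_test {W Ψ : ℝ × ℝ → ℂ} (hW : MemLp W 2 (volume.restrict halfPlane))
    (hΨ : Continuous Ψ) (hΨc : HasCompactSupport Ψ) :
    Integrable (fun p => W p * Ψ p) (volume.restrict halfPlane) := by
  have : MemLp Ψ 2 volume := hΨ.memLp_of_hasCompactSupport hΨc
  exact hW.integrable_mul (this.restrict _)

lemma hasCompactSupport_mul_prod {a b : ℝ → ℂ} (ha : HasCompactSupport a)
    (hb : HasCompactSupport b) (E : ℝ × ℝ → ℂ) :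
    HasCompactSupport fun p : ℝ × ℝ => E p * (a p.1 * b p.2) := by
  refine HasCompactSupport.of_support_subset_isCompact (IsCompact.prod ha hb) fun p hp => ?_
  refine ⟨subset_tsupport _ fun h => hp ?_, subset_tsupport _ fun h => hp ?_⟩ <;> simp [h]

/-- A plane wave times a function of x₂ is not compactly supported. For integrands supported in |x₁|
< L, multiplying by a plateau changes nothing and restores compact support. -/
lemma exists_plateau (L : ℝ) : ∃ θ : ℝ → ℂ, Continuous θ ∧ HasCompactSupport θ ∧
    ∀ x, |x| < L → θ x = 1 := by
  refine ⟨fun x => ((max 0 (min 1 (L + 1 - |x|)) : ℝ) : ℂ), by fun_prop, ?_, fun x hx => ?_⟩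
  · refine HasCompactSupport.of_support_subset_isCompact
      (isCompact_Icc (a := -(L + 1)) (b := L + 1)) fun x hx => ?_
    by_contra hcon
    apply hx
    have : L + 1 - |x| ≤ 0 := by
      by_contra h
      exact hcon (abs_le.1 (by linarith))
    simp [this, min_eq_right (this.trans zero_le_one)]
  · have : 1 ≤ L + 1 - |x| := by linarith
    simp [this]

lemma integrable_mul_wave_test {L : ℝ} {W : ℝ × ℝ → ℂ}
    (hW : MemLp W 2 (volume.restrict halfPlane)) (hs : ∀ p : ℝ × ℝ, L ≤ |p.1| → W p = 0)
    (k : ℝ) {φ : ℝ → ℝ} (hφ : Continuous φ) (hφc : HasCompactSupport φ) :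
    Integrable (fun p => W p * gaugedWave k p * (φ p.2 : ℝ)) (volume.restrict halfPlane) := by
  obtain ⟨θ, hθ, hθc, hθ1⟩ := exists_plateau L
  have hE := continuous_gaugedWave k
  have := integrable_mul_test hW
    (Ψ := fun p => gaugedWave k p * (θ p.1 * ((φ p.2 : ℝ) : ℂ))) (by fun_prop)
    (hasCompactSupport_mul_prod hθc
      (hφc.comp_left (g := fun x : ℝ => (x : ℂ)) (by simp)) _)
  refine this.congr (.of_forall fun p => ?_)
  simp only
  rcases lt_or_ge |p.1| L with h | h
  · rw [hθ1 _ h]; ring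
  · simp [hs p h]

lemma integral_mul_wave_test {L : ℝ} {W : ℝ × ℝ → ℂ}
    (hW : MemLp W 2 (volume.restrict halfPlane)) (hs : ∀ p : ℝ × ℝ, L ≤ |p.1| → W p = 0)
    (k : ℝ) {φ : ℝ → ℝ} (hφ : Continuous φ) (hφc : HasCompactSupport φ) :
    ∫ p in halfPlane, W p * gaugedWave k p * (φ p.2 : ℝ) =
      ∫ t in Ioi (0 : ℝ), waveCoeff k W t * (φ t : ℝ) := by
  have h := integrable_mul_wave_test hW hs k hφ hφc
  rw [volume_restrict_halfPlane] at h ⊢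
  rw [integral_prod_symm _ h]
  refine integral_congr_ae (.of_forall fun t => ?_)
  simp only [waveCoeff]
  rw [← integral_mul_const]

/-! ### The magnetic form of a function with a tangential cutoff -/

/-- A test function on the plane: a gauged plane wave times a product of cutoffs. -/
noncomputable def waveTest (k : ℝ) (a : ℝ → ℂ) (φ : ℝ → ℝ) (p : ℝ × ℝ) : ℂ :=
  gaugedWave k p * (a p.1 * ((φ p.2 : ℝ) : ℂ))

lemma contDiff_waveTest (k : ℝ) {a : ℝ → ℂ} {φ : ℝ → ℝ} (ha : ContDiff ℝ ∞ a)
    (hφ : ContDiff ℝ ∞ φ) : ContDiff ℝ ∞ (waveTest k a φ) :=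
  (contDiff_gaugedWave k).mul ((ha.comp contDiff_fst).mul
    (Complex.ofRealCLM.contDiff.comp (hφ.comp contDiff_snd)))

lemma hasCompactSupport_waveTest (k : ℝ) {a : ℝ → ℂ} {φ : ℝ → ℝ} (ha : HasCompactSupport a)
    (hφ : HasCompactSupport φ) : HasCompactSupport (waveTest k a φ) :=
  hasCompactSupport_mul_prod ha (hφ.comp_left (g := fun x : ℝ => (x : ℂ)) (by simp)) _

lemma tsupport_waveTest_subset (k : ℝ) (a : ℝ → ℂ) {φ : ℝ → ℝ} (hφ : tsupport φ ⊆ Ioi 0) :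
    tsupport (waveTest k a φ) ⊆ halfPlane := by
  have hc : IsClosed ((fun p : ℝ × ℝ => p.2) ⁻¹' tsupport φ) :=
    (isClosed_tsupport φ).preimage continuous_snd
  refine (closure_minimal (fun p hp => ?_) hc).trans fun p hp => hφ hp
  refine subset_tsupport φ fun h => hp ?_
  simp [waveTest, h]

lemma fderiv_apply_fst {Φ : ℝ × ℝ → ℂ} (hΦ : Differentiable ℝ Φ) {p : ℝ × ℝ} {w : ℂ}
    (h : HasDerivAt (fun x => Φ (x, p.2)) w p.1) : fderiv ℝ Φ p (1, 0) = w :=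
  HasDerivAt.unique (HasFDerivAt.comp_hasDerivAt (l := Φ) (f := fun x => (x, p.2)) p.1
    (hΦ p).hasFDerivAt ((hasDerivAt_id p.1).prodMk (hasDerivAt_const p.1 p.2))) h

lemma fderiv_apply_snd {Φ : ℝ × ℝ → ℂ} (hΦ : Differentiable ℝ Φ) {p : ℝ × ℝ} {w : ℂ}
    (h : HasDerivAt (fun t => Φ (p.1, t)) w p.2) : fderiv ℝ Φ p (0, 1) = w :=
  HasDerivAt.unique (HasFDerivAt.comp_hasDerivAt (l := Φ) (f := fun t => (p.1, t)) p.2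
    (hΦ p).hasFDerivAt ((hasDerivAt_const p.2 p.1).prodMk (hasDerivAt_id p.2))) h

lemma fderiv_waveTest_fst (k : ℝ) {a : ℝ → ℂ} {φ : ℝ → ℝ} (ha : ContDiff ℝ ∞ a)
    (hφ : ContDiff ℝ ∞ φ) (p : ℝ × ℝ) : fderiv ℝ (waveTest k a φ) p (1, 0) =
      gaugedWave k p * (-(Complex.I * (k + p.2 / 2)) * a p.1 + deriv a p.1) * (φ p.2 : ℝ) := by
  refine fderiv_apply_fst ((contDiff_waveTest k ha hφ).differentiable (by simp)) ?_
  have h1 : HasDerivAt (fun x : ℝ => (x : ℂ)) 1 p.1 := Complex.ofRealCLM.hasDerivAt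
  have h2 := ((h1.const_mul (k : ℂ)).fun_add ((h1.mul_const (p.2 : ℂ)).div_const 2)).const_mul
    Complex.I |>.fun_neg.cexp
  have h3 := (ha.differentiable (by simp) p.1).hasDerivAt
  refine (h2.fun_mul (h3.mul_const ((φ p.2 : ℝ) : ℂ))).congr_deriv ?_
  simp only [gaugedWave]
  ring

lemma fderiv_waveTest_snd (k : ℝ) {a : ℝ → ℂ} {φ : ℝ → ℝ} (ha : ContDiff ℝ ∞ a)
    (hφ : ContDiff ℝ ∞ φ) (p : ℝ × ℝ) : fderiv ℝ (waveTest k a φ) p (0, 1) =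
      gaugedWave k p * a p.1 * (-(Complex.I * (p.1 / 2)) * (φ p.2 : ℝ) + (deriv φ p.2 : ℝ)) := by
  refine fderiv_apply_snd ((contDiff_waveTest k ha hφ).differentiable (by simp)) ?_
  have h1 : HasDerivAt (fun x : ℝ => (x : ℂ)) 1 p.2 := Complex.ofRealCLM.hasDerivAt
  have h2 := (((h1.const_mul (p.1 : ℂ)).div_const 2).const_add ((k : ℂ) * p.1)).const_mul
    Complex.I |>.fun_neg.cexp
  have h3 := (hφ.differentiable (by simp) p.2).hasDerivAt.ofReal_comp
  refine (h2.fun_mul (h3.const_mul (a p.1))).congr_deriv ?_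
  simp only [gaugedWave]
  ring

section

variable {u v₁ v₂ : ℝ × ℝ → ℂ} {g : ℝ → ℂ} {a : ℝ → ℂ} {L : ℝ}

/-- The terms ix₁/2 produced by the gauge factor and by the second component of A₀ cancel. Thus the
coefficient of a·v₂ is the weak derivative of that of a·u, with the Fourier coefficient of a·g as
trace. -/
lemma green_waveCoeff (hM : MemMagneticH1 u v₁ v₂)
    (hT : IsTrace u (fun x => v₂ x + Complex.I * ((A₀ x).2 : ℂ) * u x) g)
    (ha : ContDiff ℝ ∞ a) (hac : HasCompactSupport a) (hL : ∀ x, L ≤ |x| → a x = 0) (k : ℝ)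
    {φ : ℝ → ℝ} (hφ : ContDiff ℝ ∞ φ) (hφc : HasCompactSupport φ) :
    ∫ t in Ioi (0 : ℝ), waveCoeff k (fun p => a p.1 * u p) t * (deriv φ t : ℝ) =
      -(∫ t in Ioi (0 : ℝ), waveCoeff k (fun p => a p.1 * v₂ p) t * (φ t : ℝ)) -
        (∫ s, a s * g s * Complex.exp (-(Complex.I * (k * s)))) * (φ 0 : ℝ) := by
  have cφ' : Continuous (deriv φ) := hφ.continuous_deriv (by simp)
  have m0 := memLp_mul_compact hM.memLp ha.continuous hac
  have m2 := memLp_mul_compact hM.memLp_snd ha.continuous hac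
  have m3 := memLp_mul_compact hM.memLp (a := fun x : ℝ => Complex.I * (x / 2) * a x)
    (by have := ha.continuous; fun_prop) hac.mul_left
  have s0 : ∀ p : ℝ × ℝ, L ≤ |p.1| → a p.1 * u p = 0 := fun p hp => by simp [hL _ hp]
  have s2 : ∀ p : ℝ × ℝ, L ≤ |p.1| → a p.1 * v₂ p = 0 := fun p hp => by simp [hL _ hp]
  have s3 : ∀ p : ℝ × ℝ, L ≤ |p.1| → Complex.I * (p.1 / 2) * a p.1 * u p = 0 :=
    fun p hp => by simp [hL _ hp]
  have i0 := integrable_mul_wave_test m0 s0 k cφ' hφc.deriv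
  have i2 := integrable_mul_wave_test m2 s2 k hφ.continuous hφc
  have i3 := integrable_mul_wave_test m3 s3 k hφ.continuous hφc
  rw [← integral_mul_wave_test m0 s0 k cφ' hφc.deriv,
    ← integral_mul_wave_test m2 s2 k hφ.continuous hφc]
  have h := hT.green (waveTest k a φ) (contDiff_waveTest k ha hφ)
    (hasCompactSupport_waveTest k hac hφc)
  have e1 : ∫ p in halfPlane, u p * fderiv ℝ (waveTest k a φ) p (0, 1) =
      (∫ p in halfPlane, a p.1 * u p * gaugedWave k p * (deriv φ p.2 : ℝ)) -
        ∫ p in halfPlane, Complex.I * (p.1 / 2) * a p.1 * u p * gaugedWave k p * (φ p.2 : ℝ) := by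
    rw [← integral_sub i0 i3]
    refine integral_congr_ae (.of_forall fun p => ?_)
    simp only [fderiv_waveTest_snd k ha hφ]
    ring
  have e2 : ∫ p in halfPlane, (v₂ p + Complex.I * ((A₀ p).2 : ℂ) * u p) * waveTest k a φ p =
      (∫ p in halfPlane, a p.1 * v₂ p * gaugedWave k p * (φ p.2 : ℝ)) +
        ∫ p in halfPlane, Complex.I * (p.1 / 2) * a p.1 * u p * gaugedWave k p * (φ p.2 : ℝ) := by
    rw [← integral_add i2 i3]
    refine integral_congr_ae (.of_forall fun p => ?_)
    simp only [waveTest, A₀]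
    push_cast
    ring
  have e3 : ∫ s : ℝ, g s * waveTest k a φ (s, 0) =
      (∫ s, a s * g s * Complex.exp (-(Complex.I * (k * s)))) * (φ 0 : ℝ) := by
    rw [← integral_mul_const]
    refine integral_congr_ae (.of_forall fun s => ?_)
    simp only [waveTest, gaugedWave, Complex.ofReal_zero, mul_zero, zero_div, add_zero]
    ring
  rw [e1, e2, e3] at h
  linear_combination h

/-- Half of x₂ comes from the gauge factor and half from A₀. On the mode k the tangential magnetic
derivative becomes multiplication by i(k + t), so the fibre operator is H[γ,-k]. -/
lemma integral_waveCoeff_fst (hM : MemMagneticH1 u v₁ v₂)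
    (ha : ContDiff ℝ ∞ a) (hac : HasCompactSupport a) (hL : ∀ x, L ≤ |x| → a x = 0)
    (hL' : ∀ x, L ≤ |x| → deriv a x = 0) (k : ℝ)
    {φ : ℝ → ℝ} (hφ : ContDiff ℝ ∞ φ) (hφc : HasCompactSupport φ) (hφs : tsupport φ ⊆ Ioi 0) :
    ∫ t in Ioi (0 : ℝ), waveCoeff k (fun p => a p.1 * v₁ p + deriv a p.1 * u p) t * (φ t : ℝ) =
      Complex.I * ∫ t in Ioi (0 : ℝ),
        waveCoeff k (fun p => a p.1 * u p) t * (((k + t) * φ t : ℝ) : ℂ) := by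
  have ca' : Continuous (deriv a) := ha.continuous_deriv (by simp)
  have m0 := memLp_mul_compact hM.memLp ha.continuous hac
  have m4 := memLp_mul_compact hM.memLp_fst ha.continuous hac
  have m5 := memLp_mul_compact hM.memLp ca' hac.deriv
  have m1 : MemLp (fun p : ℝ × ℝ => a p.1 * v₁ p + deriv a p.1 * u p) 2
      (volume.restrict halfPlane) := m4.add m5
  have s0 : ∀ p : ℝ × ℝ, L ≤ |p.1| → a p.1 * u p = 0 := fun p hp => by simp [hL _ hp]
  have s1 : ∀ p : ℝ × ℝ, L ≤ |p.1| → a p.1 * v₁ p + deriv a p.1 * u p = 0 :=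
    fun p hp => by simp [hL _ hp, hL' _ hp]
  have s4 : ∀ p : ℝ × ℝ, L ≤ |p.1| → a p.1 * v₁ p = 0 := fun p hp => by simp [hL _ hp]
  have s5 : ∀ p : ℝ × ℝ, L ≤ |p.1| → deriv a p.1 * u p = 0 := fun p hp => by simp [hL' _ hp]
  have cφ := hφ.continuous
  have i0 : ∀ q : ℝ → ℝ, Continuous q → Integrable (fun p : ℝ × ℝ =>
      a p.1 * u p * gaugedWave k p * ((q p.2 * φ p.2 : ℝ) : ℂ)) (volume.restrict halfPlane) :=
    fun q hq => integrable_mul_wave_test m0 s0 k (φ := fun t => q t * φ t)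
      (by fun_prop) hφc.mul_left
  have i4 := integrable_mul_wave_test m4 s4 k cφ hφc
  have i5 := integrable_mul_wave_test m5 s5 k cφ hφc
  have i1 := integrable_mul_wave_test m1 s1 k cφ hφc
  rw [← integral_mul_wave_test m1 s1 k cφ hφc,
    ← integral_mul_wave_test m0 s0 k (φ := fun t => (k + t) * φ t) (by fun_prop) hφc.mul_left]
  have h := hM.hasWeakDeriv_fst (waveTest k a φ) (contDiff_waveTest k ha hφ)
    (hasCompactSupport_waveTest k hac hφc) (tsupport_waveTest_subset k a hφs)
  have j1 : Integrable (fun p => u p * fderiv ℝ (waveTest k a φ) p (1, 0))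
      (volume.restrict halfPlane) := by
    refine (i5.sub' ((i0 (fun t => k + t / 2) (by fun_prop)).const_mul Complex.I)).congr
      (.of_forall fun p => ?_)
    simp only [fderiv_waveTest_fst k ha hφ]
    push_cast
    ring
  have j2 : Integrable (fun p => (v₁ p + Complex.I * ((A₀ p).1 : ℂ) * u p) * waveTest k a φ p)
      (volume.restrict halfPlane) := by
    refine (i4.sub' ((i0 (fun t => t / 2) (by fun_prop)).const_mul Complex.I)).congr
      (.of_forall fun p => ?_)
    simp only [waveTest, A₀]
    push_cast
    ring
  rw [eq_neg_iff_add_eq_zero, ← integral_add j1 j2] at h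
  rw [← integral_const_mul, ← sub_eq_zero,
    ← integral_sub i1 ((i0 (fun t => k + t) (by fun_prop)).const_mul Complex.I), ← h]
  refine integral_congr_ae (.of_forall fun p => ?_)
  simp only [fderiv_waveTest_fst k ha hφ, waveTest, A₀]
  push_cast
  ring

lemma waveCoeff_fst_ae_eq (hM : MemMagneticH1 u v₁ v₂)
    (ha : ContDiff ℝ ∞ a) (hac : HasCompactSupport a) (hL0 : 0 < L)
    (hL : ∀ x, L ≤ |x| → a x = 0) (hL' : ∀ x, L ≤ |x| → deriv a x = 0) (n : ℤ) :
    ∀ᵐ t ∂(volume.restrict (Ioi (0 : ℝ))),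
      waveCoeff (Real.pi * n / L) (fun p => a p.1 * v₁ p + deriv a p.1 * u p) t =
        Complex.I * (((Real.pi * n / L + t : ℝ) : ℂ) *
          waveCoeff (Real.pi * n / L) (fun p => a p.1 * u p) t) := by
  have ca' : Continuous (deriv a) := ha.continuous_deriv (by simp)
  set k := Real.pi * n / L with hk
  have c0 : MemLp (waveCoeff k fun p => a p.1 * u p) 2 (volume.restrict (Ioi 0)) :=
    memLp_waveCoeff hL0 (memLp_mul_compact hM.memLp ha.continuous hac)
      (fun p hp => by simp [hL _ hp]) n
  have c1 : MemLp (waveCoeff k fun p => a p.1 * v₁ p + deriv a p.1 * u p) 2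
      (volume.restrict (Ioi 0)) :=
    memLp_waveCoeff hL0 ((memLp_mul_compact hM.memLp_fst ha.continuous hac).add
      (memLp_mul_compact hM.memLp ca' hac.deriv)) (fun p hp => by simp [hL _ hp, hL' _ hp]) n
  set c := waveCoeff k fun p => a p.1 * u p
  set e := waveCoeff k fun p => a p.1 * v₁ p + deriv a p.1 * u p
  have l0 : LocallyIntegrableOn c (Ioi 0) volume :=
    locallyIntegrableOn_of_locallyIntegrable_restrict (c0.locallyIntegrable (by norm_num))
  have l1 : LocallyIntegrableOn e (Ioi 0) volume :=
    locallyIntegrableOn_of_locallyIntegrable_restrict (c1.locallyIntegrable (by norm_num))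
  have cq : Continuous fun t : ℝ => Complex.I * ((k + t : ℝ) : ℂ) := by fun_prop
  have l2 : LocallyIntegrableOn (fun t => Complex.I * ((k + t : ℝ) : ℂ) * c t) (Ioi 0) volume :=
    l0.continuousOn_mul cq.continuousOn isOpen_Ioi.isLocallyClosed
  have key := isOpen_Ioi.ae_eq_zero_of_integral_contDiff_smul_eq_zero (l1.sub l2) ?_
  · rw [ae_restrict_iff' measurableSet_Ioi]
    filter_upwards [key] with t ht ht0
    have := ht ht0
    simp only [Pi.sub_apply] at this
    rw [sub_eq_zero.1 this, mul_assoc]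
  intro φ hφ hφc hφs
  have h := integral_waveCoeff_fst hM ha hac hL hL' k hφ hφc hφs
  have tφ : ∀ q : ℝ → ℝ, Continuous q →
      MemLp (fun t => ((q t * φ t : ℝ) : ℂ)) 2 (volume.restrict (Ioi (0 : ℝ))) := fun q hq =>
    (Continuous.memLp_of_hasCompactSupport (μ := volume) (by have := hφ.continuous; fun_prop)
      ((hφc.mul_left (f := q)).comp_left (g := fun x : ℝ => (x : ℂ)) (by simp))).restrict _
  have i1 : Integrable (fun t => e t * ((φ t : ℝ) : ℂ)) (volume.restrict (Ioi (0 : ℝ))) := by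
    refine (c1.integrable_mul (tφ (fun _ => 1) continuous_const)).congr (.of_forall fun t => ?_)
    simp
  have i2 : Integrable (fun t => c t * (((k + t) * φ t : ℝ) : ℂ)) (volume.restrict (Ioi (0 : ℝ))) :=
    c0.integrable_mul (tφ (fun t => k + t) (by fun_prop))
  rw [← integral_const_mul, ← sub_eq_zero, ← integral_sub i1 (i2.const_mul _),
    integral_eq_setIntegral_Ioi] at h
  · rw [← h]
    refine integral_congr_ae (.of_forall fun t => ?_)
    simp only [Pi.sub_apply, Complex.real_smul]
    push_cast
    ring
  · intro t ht
    simp [eq_zero_of_tsupport_subset_Ioi hφs ht]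

/-- Apply the half-line inequality mode by mode and sum with Parseval. All frequencies πn/L occur,
so the Robin inequality for f is needed at every point. -/
lemma cutoff_form_ge {α γ : ℝ} (hα : 0 < α) (hle : ∀ s, cylDeriv α s ≤ γ * cyl α s)
    (hM : MemMagneticH1 u v₁ v₂)
    (hT : IsTrace u (fun x => v₂ x + Complex.I * ((A₀ x).2 : ℂ) * u x) g)
    (ha : ContDiff ℝ ∞ a) (hac : HasCompactSupport a) :
    (1 - 2 * α) * ∫ p in halfPlane, ‖a p.1 * u p‖ ^ 2 ≤
      (∫ p in halfPlane, ‖a p.1 * v₂ p‖ ^ 2) +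
        (∫ p in halfPlane, ‖a p.1 * v₁ p + deriv a p.1 * u p‖ ^ 2) +
        γ * ∫ s, ‖a s * g s‖ ^ 2 := by
  have ca' : Continuous (deriv a) := ha.continuous_deriv (by simp)
  obtain ⟨L₁, hL₁, hL₁'⟩ := hac.exists_pos_le_norm
  obtain ⟨L₂, hL₂, hL₂'⟩ := hac.deriv.exists_pos_le_norm
  set L := max L₁ L₂
  have hL0 : 0 < L := lt_max_of_lt_left hL₁
  have hL : ∀ x, L ≤ |x| → a x = 0 := fun x hx => hL₁' x ((le_max_left _ _).trans hx)
  have hL' : ∀ x, L ≤ |x| → deriv a x = 0 := fun x hx => hL₂' x ((le_max_right _ _).trans hx)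
  have m0 := memLp_mul_compact hM.memLp ha.continuous hac
  have m2 := memLp_mul_compact hM.memLp_snd ha.continuous hac
  have m1 : MemLp (fun p : ℝ × ℝ => a p.1 * v₁ p + deriv a p.1 * u p) 2
      (volume.restrict halfPlane) := (memLp_mul_compact hM.memLp_fst ha.continuous hac).add
    (memLp_mul_compact hM.memLp ca' hac.deriv)
  have mg : MemLp (fun s => a s * g s) 2 volume := by
    obtain ⟨C, hC⟩ := ha.continuous.bounded_above_of_compact_support hac
    refine hT.memLp.of_le_mul (c := C)
      (ha.continuous.aestronglyMeasurable.mul hT.memLp.aestronglyMeasurable)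
      (.of_forall fun p => ?_)
    rw [norm_mul]
    gcongr
    exact hC p
  have s0 : ∀ p : ℝ × ℝ, L ≤ |p.1| → a p.1 * u p = 0 := fun p hp => by simp [hL _ hp]
  have s1 : ∀ p : ℝ × ℝ, L ≤ |p.1| → a p.1 * v₁ p + deriv a p.1 * u p = 0 :=
    fun p hp => by simp [hL _ hp, hL' _ hp]
  have s2 : ∀ p : ℝ × ℝ, L ≤ |p.1| → a p.1 * v₂ p = 0 := fun p hp => by simp [hL _ hp]
  have key := hasSum_le ?_ ((hasSum_integral_sq_waveCoeff hL0 m0 s0).mul_left (1 - 2 * α))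
    (((hasSum_integral_sq_waveCoeff hL0 m2 s2).add
      (hasSum_integral_sq_waveCoeff hL0 m1 s1)).add
        ((hasSum_sq_fourierIntegral hL0 mg fun x hx => by simp [hL _ hx]).mul_left γ))
  · refine le_of_mul_le_mul_left ?_ (by positivity : 0 < 2 * L)
    linear_combination key
  intro n
  set k := Real.pi * n / L with hk
  have hae := waveCoeff_fst_ae_eq hM ha hac hL0 hL hL' n
  have hae' : ∀ᵐ t ∂(volume.restrict (Ioi (0 : ℝ))),
      -Complex.I * waveCoeff k (fun p => a p.1 * v₁ p + deriv a p.1 * u p) t =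
        ((t - -k : ℝ) : ℂ) * waveCoeff k (fun p => a p.1 * u p) t := by
    filter_upwards [hae] with t ht
    rw [ht, ← mul_assoc, neg_mul, Complex.I_mul_I, neg_neg, one_mul, sub_neg_eq_add, add_comm t]
  have h := halfLine_form_ge (ξ := -k) hα (by rw [neg_neg]; exact hle k)
    (memLp_waveCoeff hL0 m0 s0 n) (memLp_waveCoeff hL0 m2 s2 n)
    (((memLp_waveCoeff hL0 m1 s1 n).const_mul (-Complex.I)).ae_eq hae')
    (fun φ hφ hφc => green_waveCoeff hM hT ha hac hL k hφ hφc)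
  have e1 : ∫ t in Ioi (0 : ℝ), ‖((t - -k : ℝ) : ℂ) * waveCoeff k (fun p => a p.1 * u p) t‖ ^ 2 =
      ∫ t in Ioi (0 : ℝ), ‖waveCoeff k (fun p => a p.1 * v₁ p + deriv a p.1 * u p) t‖ ^ 2 := by
    refine integral_congr_ae (hae'.mono fun t ht => ?_)
    simp only
    rw [← ht, norm_mul, norm_neg, Complex.norm_I, one_mul]
  rw [e1] at h
  exact h

end

/-! ### Lower bound for the Rayleigh quotients -/

lemma exists_cutoff_sequence : ∃ (C : ℝ) (a : ℕ → ℝ → ℂ), (∀ n, ContDiff ℝ ∞ (a n)) ∧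
    (∀ n, HasCompactSupport (a n)) ∧ (∀ n x, ‖a n x‖ ≤ 1) ∧
    (∀ n x, ‖deriv (a n) x‖ ≤ C / (n + 1)) ∧ ∀ x, Tendsto (fun n => a n x) atTop (𝓝 1) := by
  let b : ContDiffBump (0 : ℝ) := ⟨1, 2, one_pos, one_lt_two⟩
  have hb : ContDiff ℝ ∞ b := b.contDiff
  obtain ⟨C, hC⟩ := (hb.continuous_deriv (by simp)).bounded_above_of_compact_support
    b.hasCompactSupport.deriv
  have hd : ∀ (n : ℕ) x, HasDerivAt (fun x : ℝ => ((b (x / (n + 1)) : ℝ) : ℂ))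
      ((deriv b (x / (n + 1)) * (1 / (n + 1)) : ℝ) : ℂ) x := fun n x =>
    ((hb.differentiable (by simp) _).hasDerivAt.comp x
      ((hasDerivAt_id x).div_const ((n : ℝ) + 1))).ofReal_comp
  refine ⟨C, fun n x => ((b (x / (n + 1)) : ℝ) : ℂ), fun n => ?_, fun n => ?_, fun n x => ?_,
    fun n x => ?_, fun x => ?_⟩
  · exact Complex.ofRealCLM.contDiff.comp (hb.comp (contDiff_id.div_const _))
  · refine HasCompactSupport.of_support_subset_isCompact
      (isCompact_Icc (a := -(2 * ((n : ℝ) + 1))) (b := 2 * ((n : ℝ) + 1))) fun x hx => ?_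
    by_contra hcon
    refine hx ?_
    have h2 : 2 ≤ dist (x / ((n : ℝ) + 1)) 0 := by
      rw [dist_zero_right, Real.norm_eq_abs, abs_div, abs_of_pos (by positivity : (0 : ℝ) < n + 1),
        le_div_iff₀ (by positivity)]
      by_contra h
      exact hcon (abs_le.1 (not_le.1 h).le)
    simpa using b.zero_of_le_dist h2
  · rw [Complex.norm_real, Real.norm_of_nonneg b.nonneg]
    exact b.le_one
  · rw [(hd n x).deriv, Complex.norm_real, norm_mul, Real.norm_of_nonneg
      (by positivity : (0 : ℝ) ≤ 1 / ((n : ℝ) + 1)), mul_one_div]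
    gcongr
    exact hC _
  · have h0 : Tendsto (fun n : ℕ => x / ((n : ℝ) + 1)) atTop (𝓝 0) := by
      simpa [div_eq_mul_inv] using (tendsto_one_div_add_atTop_nhds_zero_nat (𝕜 := ℝ)).const_mul x
    have h1 := (Complex.continuous_ofReal.comp hb.continuous).continuousAt.tendsto.comp h0
    have hb0 : b 0 = 1 := b.one_of_mem_closedBall (Metric.mem_closedBall_self b.rIn_pos.le)
    simpa [Function.comp_def, hb0] using h1

lemma tendsto_integral_norm_sq {X : Type*} [MeasurableSpace X] {μ : Measure X}
    {F : ℕ → X → ℂ} {f : X → ℂ} {B : X → ℝ} (hF : ∀ n, AEStronglyMeasurable (F n) μ)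
    (hB : Integrable B μ) (h : ∀ n x, ‖F n x‖ ^ 2 ≤ B x)
    (hlim : ∀ x, Tendsto (fun n => F n x) atTop (𝓝 (f x))) :
    Tendsto (fun n => ∫ x, ‖F n x‖ ^ 2 ∂μ) atTop (𝓝 (∫ x, ‖f x‖ ^ 2 ∂μ)) := by
  refine tendsto_integral_of_dominated_convergence B (fun n => (hF n).norm.pow 2) hB
    (fun n => .of_forall fun x => ?_) (.of_forall fun x => (hlim x).norm.pow 2)
  rw [Real.norm_of_nonneg (by positivity)]
  exact h n x

/-- Let the cutoffs spread out: the error a_n'·u tends to 0 pointwise, as a_n' = O(1/n), and all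
integrals converge by domination. -/
theorem form_ge {α γ : ℝ} (hα : 0 < α) (hle : ∀ s, cylDeriv α s ≤ γ * cyl α s)
    {u v₁ v₂ : ℝ × ℝ → ℂ} {g : ℝ → ℂ} (hM : MemMagneticH1 u v₁ v₂)
    (hT : IsTrace u (fun x => v₂ x + Complex.I * ((A₀ x).2 : ℂ) * u x) g) :
    (1 - 2 * α) * ∫ p in halfPlane, ‖u p‖ ^ 2 ≤
      (∫ p in halfPlane, (‖v₁ p‖ ^ 2 + ‖v₂ p‖ ^ 2)) + γ * ∫ s, ‖g s‖ ^ 2 := by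
  obtain ⟨C, a, ha, hac, ha1, had, halim⟩ := exists_cutoff_sequence
  have hC : 0 ≤ C := by simpa using (norm_nonneg _).trans (had 0 0)
  have hn : ∀ n x (z : ℂ), ‖a n x * z‖ ≤ ‖z‖ := fun n x z => by
    rw [norm_mul]
    exact mul_le_of_le_one_left (norm_nonneg _) (ha1 n x)
  have had0 : ∀ x, Tendsto (fun n => deriv (a n) x) atTop (𝓝 0) := fun x => by
    refine squeeze_zero_norm (fun n => had n x) ?_
    simpa [div_eq_mul_inv] using (tendsto_one_div_add_atTop_nhds_zero_nat (𝕜 := ℝ)).const_mul C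
  have hadC : ∀ n x, ‖deriv (a n) x‖ ≤ C := fun n x => (had n x).trans
    (div_le_self hC (by simp))
  have iu := hM.memLp.integrable_norm_pow (p := 2) (by norm_num)
  have i1 := hM.memLp_fst.integrable_norm_pow (p := 2) (by norm_num)
  have i2 := hM.memLp_snd.integrable_norm_pow (p := 2) (by norm_num)
  have ig := hT.memLp.integrable_norm_pow (p := 2) (by norm_num)
  have mul_lim : ∀ x (z : ℂ), Tendsto (fun n => a n x * z) atTop (𝓝 z) := fun x z => by
    simpa using (halim x).mul_const z
  have lu := tendsto_integral_norm_sq (F := fun n (p : ℝ × ℝ) => a n p.1 * u p)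
    (fun n => (memLp_mul_compact hM.memLp (ha n).continuous (hac n)).aestronglyMeasurable) iu
    (fun n p => pow_le_pow_left₀ (norm_nonneg _) (hn n p.1 (u p)) 2) (fun p => mul_lim p.1 (u p))
  have l2 := tendsto_integral_norm_sq (F := fun n (p : ℝ × ℝ) => a n p.1 * v₂ p)
    (fun n => (memLp_mul_compact hM.memLp_snd (ha n).continuous (hac n)).aestronglyMeasurable) i2
    (fun n p => pow_le_pow_left₀ (norm_nonneg _) (hn n p.1 (v₂ p)) 2)
    (fun p => mul_lim p.1 (v₂ p))
  have lg := tendsto_integral_norm_sq (F := fun n s => a n s * g s)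
    (fun n => (ha n).continuous.aestronglyMeasurable.mul hT.memLp.aestronglyMeasurable) ig
    (fun n s => pow_le_pow_left₀ (norm_nonneg _) (hn n s (g s)) 2) (fun s => mul_lim s (g s))
  have l1 := tendsto_integral_norm_sq
    (F := fun n (p : ℝ × ℝ) => a n p.1 * v₁ p + deriv (a n) p.1 * u p) (f := v₁)
    (B := fun p => 2 * ‖v₁ p‖ ^ 2 + 2 * C ^ 2 * ‖u p‖ ^ 2) (μ := volume.restrict halfPlane)
    (fun n => (memLp_mul_compact hM.memLp_fst (ha n).continuous (hac n)).aestronglyMeasurable.add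
      (memLp_mul_compact hM.memLp ((ha n).continuous_deriv (by simp))
        (hac n).deriv).aestronglyMeasurable)
    ((i1.const_mul 2).add (iu.const_mul (2 * C ^ 2)))
    (fun n p => by
      have h1 := hn n p.1 (v₁ p)
      have h2 : ‖deriv (a n) p.1 * u p‖ ≤ C * ‖u p‖ := by
        rw [norm_mul]
        gcongr
        exact hadC n p.1
      have h3 := (norm_add_le (a n p.1 * v₁ p) (deriv (a n) p.1 * u p)).trans (add_le_add h1 h2)
      have h4 := pow_le_pow_left₀ (norm_nonneg _) h3 2
      nlinarith [sq_nonneg (‖v₁ p‖ - C * ‖u p‖)])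
    (fun p => by simpa using (mul_lim p.1 (v₁ p)).add ((had0 p.1).mul_const (u p)))
  have := le_of_tendsto_of_tendsto' (lu.const_mul (1 - 2 * α)) ((l2.add l1).add (lg.const_mul γ))
    fun n => cutoff_form_ge hα hle hM hT (ha n) (hac n)
  rw [integral_add i1 i2]
  linarith

lemma integral_norm_sq_pos {X : Type*} [MeasurableSpace X] {μ : Measure X} {u : X → ℂ}
    (hu : MemLp u 2 μ) (hne : ¬ u =ᵐ[μ] 0) : 0 < ∫ x, ‖u x‖ ^ 2 ∂μ := by
  have i := hu.integrable_norm_pow (p := 2) (by norm_num)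
  refine lt_of_le_of_ne (integral_nonneg fun x => by positivity) fun h => hne ?_
  filter_upwards [(integral_eq_zero_iff_of_nonneg (fun x => by positivity) i).1 h.symm] with x hx
  simpa using hx

theorem le_of_mem_rayleighQuotients {α γ r : ℝ} (hα : 0 < α)
    (hle : ∀ s, cylDeriv α s ≤ γ * cyl α s) (hr : r ∈ rayleighQuotients γ) : 1 - 2 * α ≤ r := by
  obtain ⟨u, v₁, v₂, g, hM, hT, hne, rfl⟩ := hr
  rw [le_div_iff₀ (integral_norm_sq_pos hM.memLp hne)]
  exact form_ge hα hle hM hT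

/-! ### Integration by parts on the half-plane -/

lemma hasCompactSupport_slice_fst {Φ : ℝ × ℝ → ℂ} (h : HasCompactSupport Φ) (t : ℝ) :
    HasCompactSupport fun x => Φ (x, t) :=
  HasCompactSupport.of_support_subset_isCompact (IsCompact.image h continuous_fst)
    fun x hx => ⟨(x, t), subset_tsupport Φ hx, rfl⟩

lemma hasCompactSupport_slice_snd {Φ : ℝ × ℝ → ℂ} (h : HasCompactSupport Φ) (x : ℝ) :
    HasCompactSupport fun t => Φ (x, t) :=
  HasCompactSupport.of_support_subset_isCompact (IsCompact.image h continuous_snd)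
    fun t ht => ⟨(x, t), subset_tsupport Φ ht, rfl⟩

lemma hasDerivAt_slice_fst {Φ : ℝ × ℝ → ℂ} (h : Differentiable ℝ Φ) (x t : ℝ) :
    HasDerivAt (fun x => Φ (x, t)) (fderiv ℝ Φ (x, t) (1, 0)) x :=
  HasFDerivAt.comp_hasDerivAt (l := Φ) (f := fun x => (x, t)) x
    (h (x, t)).hasFDerivAt ((hasDerivAt_id x).prodMk (hasDerivAt_const x t))

lemma hasDerivAt_slice_snd {Φ : ℝ × ℝ → ℂ} (h : Differentiable ℝ Φ) (x t : ℝ) :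
    HasDerivAt (fun t => Φ (x, t)) (fderiv ℝ Φ (x, t) (0, 1)) t :=
  HasFDerivAt.comp_hasDerivAt (l := Φ) (f := fun t => (x, t)) t
    (h (x, t)).hasFDerivAt ((hasDerivAt_const t x).prodMk (hasDerivAt_id t))

lemma hasWeakDirDeriv_fst_of_hasDerivAt {u w : ℝ × ℝ → ℂ} (hu : Continuous u) (hw : Continuous w)
    (h : ∀ x t, HasDerivAt (fun x => u (x, t)) (w (x, t)) x) :
    HasWeakDirDeriv halfPlane (1, 0) u w := by
  intro φ hφ hφc _
  have cφ' : Continuous fun p => fderiv ℝ φ p (1, 0) :=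
    (hφ.continuous_fderiv (by simp)).clm_apply continuous_const
  have i1 : Integrable (fun p => u p * fderiv ℝ φ p (1, 0)) (volume.restrict halfPlane) :=
    ((hu.mul cφ').integrable_of_hasCompactSupport (hφc.fderiv_apply ℝ _).mul_left).restrict
  have i2 : Integrable (fun p => w p * φ p) (volume.restrict halfPlane) :=
    ((hw.mul hφ.continuous).integrable_of_hasCompactSupport hφc.mul_left).restrict
  rw [volume_restrict_halfPlane] at i1 i2 ⊢
  rw [integral_prod_symm _ i1, integral_prod_symm _ i2, ← integral_neg]
  refine integral_congr_ae (.of_forall fun t => ?_)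
  have hd := hasDerivAt_slice_fst (hφ.differentiable (by simp))
  have hsl : Continuous fun x : ℝ => (x, t) := by fun_prop
  have := hφ.continuous
  exact integral_mul_deriv_eq_deriv_mul_of_integrable (fun x _ => h x t) (fun x _ => hd x t)
    (((hu.mul cφ').comp hsl).integrable_of_hasCompactSupport
      (hasCompactSupport_slice_fst (hφc.fderiv_apply ℝ (1, 0)).mul_left t))
    (((hw.mul this).comp hsl).integrable_of_hasCompactSupport
      (hasCompactSupport_slice_fst hφc.mul_left t))
    (((hu.mul this).comp hsl).integrable_of_hasCompactSupport
      (hasCompactSupport_slice_fst hφc.mul_left t))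

lemma green_of_hasDerivAt {u w : ℝ × ℝ → ℂ} (hu : Continuous u) (hw : Continuous w)
    (h : ∀ x t, HasDerivAt (fun t => u (x, t)) (w (x, t)) t)
    {φ : ℝ × ℝ → ℂ} (hφ : ContDiff ℝ ∞ φ) (hφc : HasCompactSupport φ) :
    ∫ p in halfPlane, u p * fderiv ℝ φ p (0, 1) =
      -(∫ p in halfPlane, w p * φ p) - ∫ s : ℝ, u (s, 0) * φ (s, 0) := by
  have cφ' : Continuous fun p => fderiv ℝ φ p (0, 1) :=
    (hφ.continuous_fderiv (by simp)).clm_apply continuous_const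
  have cφ := hφ.continuous
  have s1 : HasCompactSupport fun p => u p * fderiv ℝ φ p (0, 1) :=
    (hφc.fderiv_apply ℝ _).mul_left
  have s2 : HasCompactSupport fun p => w p * φ p := hφc.mul_left
  have i1 : Integrable (fun p => u p * fderiv ℝ φ p (0, 1)) (volume.restrict halfPlane) :=
    ((hu.mul cφ').integrable_of_hasCompactSupport s1).restrict
  have i2 : Integrable (fun p => w p * φ p) (volume.restrict halfPlane) :=
    ((hw.mul cφ).integrable_of_hasCompactSupport s2).restrict
  suffices hsum : ∫ p in halfPlane, (w p * φ p + u p * fderiv ℝ φ p (0, 1)) =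
      -∫ s : ℝ, u (s, 0) * φ (s, 0) by
    rw [integral_add i2 i1] at hsum
    linear_combination hsum
  have i3 := i2.fun_add i1
  rw [volume_restrict_halfPlane] at i3 ⊢
  rw [integral_prod _ i3, ← integral_neg]
  refine integral_congr_ae (.of_forall fun x => ?_)
  have hd : ∀ t, HasDerivAt (fun t => u (x, t) * φ (x, t))
      (w (x, t) * φ (x, t) + u (x, t) * fderiv ℝ φ (x, t) (0, 1)) t := fun t =>
    (h x t).fun_mul (hasDerivAt_slice_snd (hφ.differentiable (by simp)) x t)
  have hsl : Continuous fun t : ℝ => (x, t) := by fun_prop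
  have hcs : HasCompactSupport fun t => u (x, t) * φ (x, t) :=
    hasCompactSupport_slice_snd hφc.mul_left x
  have hint := integral_Ioi_of_hasDerivAt_of_tendsto (a := 0) (m := 0)
    (hd 0).continuousAt.continuousWithinAt (fun t _ => hd t)
    (((((hw.mul cφ).comp hsl).integrable_of_hasCompactSupport
      (hasCompactSupport_slice_snd s2 x)).add
      (((hu.mul cφ').comp hsl).integrable_of_hasCompactSupport
        (hasCompactSupport_slice_snd s1 x))).integrableOn)
    (hcs.is_zero_at_infty.mono_left atTop_le_cocompact)
  rw [zero_sub] at hint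
  exact hint

lemma hasWeakDirDeriv_snd_of_green {u w : ℝ × ℝ → ℂ} {g : ℝ → ℂ} (h : IsTrace u w g) :
    HasWeakDirDeriv halfPlane (0, 1) u w := by
  intro φ hφ hφc hφs
  rw [h.green φ hφ hφc]
  have : ∀ s : ℝ, φ (s, 0) = 0 := fun s => by
    by_contra hne
    exact lt_irrefl (0 : ℝ) (hφs (subset_tsupport φ hne))
  simp [this]

/-! ### Norms of functions with separated modulus -/

lemma memLp_of_norm_eq_mul {F : ℝ × ℝ → ℂ} (hF : Continuous F) {P Q : ℝ → ℂ}
    (hP : MemLp P 2 volume) (hQ : MemLp Q 2 (volume.restrict (Ioi 0)))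
    (h : ∀ p, ‖F p‖ = ‖P p.1‖ * ‖Q p.2‖) : MemLp F 2 (volume.restrict halfPlane) := by
  rw [memLp_two_iff_integrable_sq_norm hF.aestronglyMeasurable, volume_restrict_halfPlane]
  refine ((hP.integrable_norm_pow (p := 2) (by norm_num)).mul_prod
    (hQ.integrable_norm_pow (p := 2) (by norm_num))).congr (.of_forall fun p => ?_)
  simp only [h, mul_pow]

lemma integral_sq_of_norm_eq_mul {F : ℝ × ℝ → ℂ} {P Q : ℝ → ℂ}
    (h : ∀ p, ‖F p‖ = ‖P p.1‖ * ‖Q p.2‖) : ∫ p in halfPlane, ‖F p‖ ^ 2 =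
      (∫ x, ‖P x‖ ^ 2) * ∫ t in Ioi (0 : ℝ), ‖Q t‖ ^ 2 := by
  rw [volume_restrict_halfPlane,
    ← integral_prod_mul (fun x => ‖P x‖ ^ 2) (fun t => ‖Q t‖ ^ 2)]
  simp only [h, mul_pow]

/-! ### Gaussian integrals and the one-dimensional energy -/

lemma memLp_gaussian {ε : ℝ} (hε : 0 < ε) :
    MemLp (fun x : ℝ => ((Real.exp (-ε * x ^ 2) : ℝ) : ℂ)) 2 volume := by
  rw [memLp_two_iff_integrable_sq_norm (by fun_prop)]
  refine (integrable_exp_neg_mul_sq (by positivity : 0 < 2 * ε)).congr (.of_forall fun x => ?_)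
  simp only [Complex.norm_real, Real.norm_eq_abs, sq_abs]
  rw [← Real.exp_nat_mul]
  congr 1
  push_cast
  ring

lemma integrable_sq_mul_gaussian {b : ℝ} (hb : 0 < b) :
    Integrable fun x : ℝ => x ^ 2 * Real.exp (-b * x ^ 2) := by
  simpa using integrable_rpow_mul_exp_neg_mul_sq hb (s := 2) (by norm_num)

lemma memLp_mul_gaussian {ε : ℝ} (hε : 0 < ε) :
    MemLp (fun x : ℝ => ((x * Real.exp (-ε * x ^ 2) : ℝ) : ℂ)) 2 volume := by
  rw [memLp_two_iff_integrable_sq_norm (by fun_prop)]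
  refine (integrable_sq_mul_gaussian (by positivity : 0 < 2 * ε)).congr (.of_forall fun x => ?_)
  simp only [Complex.norm_real, Real.norm_eq_abs, sq_abs, mul_pow]
  rw [← Real.exp_nat_mul]
  congr 2
  push_cast
  ring

/-- The derivative of x e^{-2εx²} has integral zero. This makes the energy of the envelope,
4ε²∫x²e^{-2εx²}, exactly ε times its squared norm. -/
lemma integral_norm_sq_mul_gaussian {ε : ℝ} (hε : 0 < ε) :
    4 * ε * ∫ x : ℝ, ‖((x * Real.exp (-ε * x ^ 2) : ℝ) : ℂ)‖ ^ 2 =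
      ∫ x : ℝ, ‖((Real.exp (-ε * x ^ 2) : ℝ) : ℂ)‖ ^ 2 := by
  have e : ∀ x : ℝ, Real.exp (-ε * x ^ 2) ^ 2 = Real.exp (-(2 * ε) * x ^ 2) := fun x => by
    rw [← Real.exp_nat_mul]
    congr 1
    push_cast
    ring
  have hb : 0 < 2 * ε := by positivity
  simp only [Complex.norm_real, Real.norm_eq_abs, sq_abs, mul_pow, e]
  have i1 := integrable_exp_neg_mul_sq hb
  have i2 := (integrable_sq_mul_gaussian hb).const_mul (4 * ε)
  have hd : ∀ x : ℝ, HasDerivAt (fun x => x * Real.exp (-(2 * ε) * x ^ 2))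
      (Real.exp (-(2 * ε) * x ^ 2) - 4 * ε * (x ^ 2 * Real.exp (-(2 * ε) * x ^ 2))) x := by
    intro x
    have h2 := ((hasDerivAt_pow 2 x).const_mul (-(2 * ε))).exp
    refine ((hasDerivAt_id x).fun_mul h2).congr_deriv ?_
    simp only [id]
    push_cast
    ring
  have := integral_eq_zero_of_hasDerivAt_of_integrable hd (i1.sub i2)
    (integrable_mul_exp_neg_mul_sq hb)
  rw [integral_sub i1 i2, integral_const_mul, sub_eq_zero] at this
  exact this.symm

lemma memLp_sub_mul_cyl (α ξ : ℝ) :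
    MemLp (fun t => (((t - ξ) * cyl α (t - ξ) : ℝ) : ℂ)) 2 (volume.restrict (Ioi 0)) := by
  have := continuous_cyl α
  -- The value -1 produces the weight x² + 1, which dominates |x|.
  refine (memLp_quadratic_mul_cyl α ξ ξ (-1)).mono
    (by fun_prop : Continuous _).aestronglyMeasurable (.of_forall fun t => ?_)
  simp only [Complex.norm_real, norm_mul, Real.norm_eq_abs]
  gcongr ?_ * _
  rw [abs_of_pos (by linarith [sq_nonneg (t - ξ)] : (0 : ℝ) < (t - ξ) ^ 2 - -1)]
  nlinarith [sq_abs (t - ξ), abs_nonneg (t - ξ), sq_nonneg (|t - ξ| - 1)]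

/-- Integrate (f'f)' = f'² + (s² - λ)f²: the product decays at infinity and its value at the
boundary is γf². -/
lemma cyl_energy {α γ R : ℝ} (h : cylDeriv α (-R) = γ * cyl α (-R)) :
    (∫ t in Ioi (0 : ℝ), ‖((cylDeriv α (t - R) : ℝ) : ℂ)‖ ^ 2) +
      (∫ t in Ioi (0 : ℝ), ‖(((t - R) * cyl α (t - R) : ℝ) : ℂ)‖ ^ 2) + γ * cyl α (-R) ^ 2 =
      (1 - 2 * α) * ∫ t in Ioi (0 : ℝ), ‖((cyl α (t - R) : ℝ) : ℂ)‖ ^ 2 := by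
  have i0 := (memLp_cyl α R).integrable_norm_pow (p := 2) (by norm_num)
  have i1 := (memLp_cylDeriv α R).integrable_norm_pow (p := 2) (by norm_num)
  have i2 := (memLp_sub_mul_cyl α R).integrable_norm_pow (p := 2) (by norm_num)
  simp only [Complex.norm_real, Real.norm_eq_abs, sq_abs] at i0 i1 i2 ⊢
  have hsh : ∀ t : ℝ, HasDerivAt (fun t => t - R) 1 t := fun t => (hasDerivAt_id t).sub_const R
  have hd : ∀ t, HasDerivAt (fun t => cylDeriv α (t - R) * cyl α (t - R))
      (cylDeriv α (t - R) ^ 2 + ((t - R) * cyl α (t - R)) ^ 2 -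
        (1 - 2 * α) * cyl α (t - R) ^ 2) t := by
    intro t
    refine (((hasDerivAt_cylDeriv α (t - R)).comp t (hsh t)).fun_mul
      ((hasDerivAt_cyl α (t - R)).comp t (hsh t))).congr_deriv ?_
    simp only [Function.comp_apply]
    ring
  obtain ⟨C, hC⟩ := exists_cyl_bound α R
  have hlim : Tendsto (fun t => cylDeriv α (t - R) * cyl α (t - R)) atTop (𝓝 0) := by
    have he : Tendsto (fun t : ℝ => C * Real.exp (-2 * t)) atTop (𝓝 0) := by
      have : Tendsto (fun t : ℝ => Real.exp (-2 * t)) atTop (𝓝 0) :=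
        Real.tendsto_exp_atBot.comp (tendsto_id.const_mul_atTop_of_neg (by norm_num))
      simpa using this.const_mul C
    have hee := he.mul he
    rw [mul_zero] at hee
    refine squeeze_zero_norm' ?_ hee
    filter_upwards [eventually_ge_atTop 0] with t ht
    rw [norm_mul]
    exact mul_le_mul (hC t ht).2 (hC t ht).1 (norm_nonneg _) ((abs_nonneg _).trans (hC t ht).2)
  have hint := integral_Ioi_of_hasDerivAt_of_tendsto (a := 0)
    (hd 0).continuousAt.continuousWithinAt (fun t _ => hd t)
    ((i1.fun_add i2).sub (i0.const_mul (1 - 2 * α))) hlim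
  rw [integral_sub (i1.fun_add i2) (i0.const_mul _), integral_const_mul] at hint
  simp only [zero_sub, h] at hint
  rw [integral_add i1 i2] at hint
  linear_combination hint

/-! ### Trial functions -/

/-- A Gaussian wave packet in the tangential variable with the phase adapted to `A₀`. -/
noncomputable def wavePacket (ε R : ℝ) (p : ℝ × ℝ) : ℂ :=
  Complex.exp (Complex.I * (p.1 * p.2 / 2 - R * p.1) - ε * p.1 ^ 2)

lemma norm_wavePacket (ε R : ℝ) (p : ℝ × ℝ) :
    ‖wavePacket ε R p‖ = ‖((Real.exp (-ε * p.1 ^ 2) : ℝ) : ℂ)‖ := by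
  have : Complex.I * (p.1 * p.2 / 2 - R * p.1) - ε * p.1 ^ 2 =
      ((-ε * p.1 ^ 2 : ℝ) : ℂ) + ((p.1 * p.2 / 2 - R * p.1 : ℝ) : ℂ) * Complex.I := by
    push_cast
    ring
  rw [wavePacket, this, Complex.exp_add, norm_mul, Complex.norm_exp_ofReal_mul_I, mul_one,
    Complex.ofReal_exp]

lemma continuous_wavePacket (ε R : ℝ) : Continuous (wavePacket ε R) := by
  unfold wavePacket
  fun_prop

lemma hasDerivAt_wavePacket_fst (ε R x t : ℝ) :
    HasDerivAt (fun x => wavePacket ε R (x, t))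
      ((Complex.I * (t / 2 - R) - 2 * ε * x) * wavePacket ε R (x, t)) x := by
  have h1 : HasDerivAt (fun x : ℝ => (x : ℂ)) 1 x := Complex.ofRealCLM.hasDerivAt
  have h2 := ((((h1.mul_const (t : ℂ)).div_const 2).fun_sub
    (h1.const_mul (R : ℂ))).const_mul Complex.I).fun_sub ((h1.fun_pow 2).const_mul (ε : ℂ))
  refine h2.cexp.congr_deriv ?_
  simp only [wavePacket]
  push_cast
  ring

lemma hasDerivAt_wavePacket_snd (ε R x t : ℝ) :
    HasDerivAt (fun t => wavePacket ε R (x, t))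
      (Complex.I * (x / 2) * wavePacket ε R (x, t)) t := by
  have h1 : HasDerivAt (fun t : ℝ => (t : ℂ)) 1 t := Complex.ofRealCLM.hasDerivAt
  have h2 := ((((h1.const_mul (x : ℂ)).div_const 2).sub_const
    ((R : ℂ) * x)).const_mul Complex.I).sub_const ((ε : ℂ) * x ^ 2)
  refine h2.cexp.congr_deriv ?_
  simp only [wavePacket]
  ring

/-- Since v₁ = (i(t-R) - 2εx)u, the density |v₁|² splits without cross term. The part in t - R joins
the energy of f from `cyl_energy`, and the part in x adds exactly ε. -/
theorem add_mem_rayleighQuotients {α γ R ε : ℝ} (hα : 0 < α) (hε : 0 < ε)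
    (h : cylDeriv α (-R) = γ * cyl α (-R)) : 1 - 2 * α + ε ∈ rayleighQuotients γ := by
  have cf := continuous_cyl α
  have cf' := continuous_cylDeriv α
  have cw := continuous_wavePacket ε R
  set u : ℝ × ℝ → ℂ := fun p => wavePacket ε R p * ((cyl α (p.2 - R) : ℝ) : ℂ) with hu
  set v₁ : ℝ × ℝ → ℂ := fun p => (Complex.I * (p.2 - R) - 2 * ε * p.1) * u p with hv₁
  set v₂ : ℝ × ℝ → ℂ := fun p => wavePacket ε R p * ((cylDeriv α (p.2 - R) : ℝ) : ℂ) with hv₂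
  have cu : Continuous u := by fun_prop
  have cv₁ : Continuous v₁ := by fun_prop
  have cv₂ : Continuous v₂ := by fun_prop
  have nu : ∀ p : ℝ × ℝ, ‖u p‖ = ‖((Real.exp (-ε * p.1 ^ 2) : ℝ) : ℂ)‖ *
      ‖((cyl α (p.2 - R) : ℝ) : ℂ)‖ := fun p => by rw [hu, norm_mul, norm_wavePacket]
  have nv₂ : ∀ p : ℝ × ℝ, ‖v₂ p‖ = ‖((Real.exp (-ε * p.1 ^ 2) : ℝ) : ℂ)‖ *
      ‖((cylDeriv α (p.2 - R) : ℝ) : ℂ)‖ := fun p => by rw [hv₂, norm_mul, norm_wavePacket]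
  have nA : ∀ p : ℝ × ℝ, ‖((p.2 - R : ℝ) : ℂ) * u p‖ = ‖((Real.exp (-ε * p.1 ^ 2) : ℝ) : ℂ)‖ *
      ‖(((p.2 - R) * cyl α (p.2 - R) : ℝ) : ℂ)‖ := fun p => by
    rw [norm_mul, nu, Complex.ofReal_mul, norm_mul]
    ring
  have nB : ∀ p : ℝ × ℝ, ‖(p.1 : ℂ) * u p‖ = ‖((p.1 * Real.exp (-ε * p.1 ^ 2) : ℝ) : ℂ)‖ *
      ‖((cyl α (p.2 - R) : ℝ) : ℂ)‖ := fun p => by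
    rw [norm_mul, nu, Complex.ofReal_mul, norm_mul]
    ring
  have mG := memLp_gaussian hε
  have mu : MemLp u 2 (volume.restrict halfPlane) := memLp_of_norm_eq_mul cu mG (memLp_cyl α R) nu
  have mv₂ : MemLp v₂ 2 (volume.restrict halfPlane) :=
    memLp_of_norm_eq_mul cv₂ mG (memLp_cylDeriv α R) nv₂
  have mA : MemLp (fun p : ℝ × ℝ => ((p.2 - R : ℝ) : ℂ) * u p) 2 (volume.restrict halfPlane) :=
    memLp_of_norm_eq_mul (by fun_prop) mG (memLp_sub_mul_cyl α R) nA
  have mB : MemLp (fun p : ℝ × ℝ => (p.1 : ℂ) * u p) 2 (volume.restrict halfPlane) :=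
    memLp_of_norm_eq_mul (by fun_prop) (memLp_mul_gaussian hε) (memLp_cyl α R) nB
  have mv₁ : MemLp v₁ 2 (volume.restrict halfPlane) := by
    refine ((mA.const_mul Complex.I).sub (mB.const_mul (2 * ε : ℂ))).congr_norm
      cv₁.aestronglyMeasurable (.of_forall fun p => ?_)
    simp only [hv₁, Pi.sub_apply]
    congr 1
    push_cast
    ring
  have nv₁ : ∀ p : ℝ × ℝ, ‖v₁ p‖ ^ 2 =
      ‖((p.2 - R : ℝ) : ℂ) * u p‖ ^ 2 + 4 * ε ^ 2 * ‖(p.1 : ℂ) * u p‖ ^ 2 := by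
    intro p
    have : Complex.I * (p.2 - R) - 2 * ε * p.1 =
        ((-(2 * ε * p.1) : ℝ) : ℂ) + ((p.2 - R : ℝ) : ℂ) * Complex.I := by
      push_cast
      ring
    simp only [hv₁, norm_mul, mul_pow, this]
    rw [Complex.sq_norm (_ + _), Complex.normSq_add_mul_I]
    simp only [Complex.norm_real, Real.norm_eq_abs, sq_abs]
    ring
  have du : ∀ x t, HasDerivAt (fun t => u (x, t))
      (v₂ (x, t) + Complex.I * ((A₀ (x, t)).2 : ℂ) * u (x, t)) t := fun x t => by
    refine ((hasDerivAt_wavePacket_snd ε R x t).fun_mul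
      (hasDerivAt_cyl_shift α R t)).congr_deriv ?_
    simp only [hu, hv₂, A₀]
    push_cast
    ring
  have cA : Continuous A₀ := by unfold A₀; fun_prop
  have hT : IsTrace u (fun p => v₂ p + Complex.I * ((A₀ p).2 : ℂ) * u p)
      (fun s => u (s, 0)) := by
    refine ⟨?_, fun φ hφ hφc => green_of_hasDerivAt cu (by fun_prop) du hφ hφc⟩
    refine (mG.const_mul ((cyl α (-R) : ℝ) : ℂ)).congr_norm
      (by fun_prop : Continuous fun s : ℝ => u (s, 0)).aestronglyMeasurable
      (.of_forall fun s => ?_)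
    rw [norm_mul, nu, zero_sub, mul_comm]
  have hM : MemMagneticH1 u v₁ v₂ := by
    refine ⟨mu, mv₁, mv₂, hasWeakDirDeriv_fst_of_hasDerivAt cu (by fun_prop) fun x t => ?_,
      hasWeakDirDeriv_snd_of_green hT⟩
    refine ((hasDerivAt_wavePacket_fst ε R x t).mul_const
      ((cyl α (t - R) : ℝ) : ℂ)).congr_deriv ?_
    simp only [hu, hv₁, A₀]
    push_cast
    ring
  have hne : ¬ u =ᵐ[volume.restrict halfPlane] 0 := by
    intro h0
    have hopen : IsOpen halfPlane := isOpen_lt continuous_const continuous_snd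
    have : (ae (volume.restrict halfPlane)).NeBot :=
      ae_restrict_neBot.2 (hopen.measure_ne_zero volume ⟨((0 : ℝ), (1 : ℝ)), show (0 : ℝ) < 1 from one_pos⟩)
    obtain ⟨p, hp⟩ := h0.exists
    refine absurd hp (mul_ne_zero (Complex.exp_ne_zero _) ?_)
    exact Complex.ofReal_ne_zero.2 (cyl_pos hα _).ne'
  refine ⟨u, v₁, v₂, _, hM, hT, hne, ?_⟩
  have hpos := integral_norm_sq_pos mu hne
  rw [eq_div_iff hpos.ne']
  have sq {F : ℝ × ℝ → ℂ} (hF : MemLp F 2 (volume.restrict halfPlane)) :=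
    hF.integrable_norm_pow (p := 2) (by norm_num)
  have e1 : ∫ p in halfPlane, ‖v₁ p‖ ^ 2 = (∫ p in halfPlane, ‖((p.2 - R : ℝ) : ℂ) * u p‖ ^ 2) +
      4 * ε ^ 2 * ∫ p in halfPlane, ‖(p.1 : ℂ) * u p‖ ^ 2 := by
    rw [← integral_const_mul, ← integral_add (sq mA) ((sq mB).const_mul _)]
    simp only [nv₁]
  have e2 : ∫ s : ℝ, ‖u (s, 0)‖ ^ 2 =
      (∫ x : ℝ, ‖((Real.exp (-ε * x ^ 2) : ℝ) : ℂ)‖ ^ 2) * cyl α (-R) ^ 2 := by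
    rw [← integral_mul_const]
    refine integral_congr_ae (.of_forall fun s => ?_)
    simp only [nu, mul_pow, zero_sub, Complex.norm_real (cyl α (-R)), Real.norm_eq_abs (cyl _ _),
      sq_abs]
  rw [integral_add (sq mv₁) (sq mv₂), e1, e2,
    integral_sq_of_norm_eq_mul (P := fun x : ℝ => ((Real.exp (-ε * x ^ 2) : ℝ) : ℂ))
    (Q := fun t : ℝ => ((cyl α (t - R) : ℝ) : ℂ)) nu,
    integral_sq_of_norm_eq_mul (P := fun x : ℝ => ((Real.exp (-ε * x ^ 2) : ℝ) : ℂ))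
    (Q := fun t : ℝ => ((cylDeriv α (t - R) : ℝ) : ℂ)) nv₂,
    integral_sq_of_norm_eq_mul (P := fun x : ℝ => ((Real.exp (-ε * x ^ 2) : ℝ) : ℂ))
    (Q := fun t : ℝ => (((t - R) * cyl α (t - R) : ℝ) : ℂ)) nA,
    integral_sq_of_norm_eq_mul (P := fun x : ℝ => ((x * Real.exp (-ε * x ^ 2) : ℝ) : ℂ))
    (Q := fun t : ℝ => ((cyl α (t - R) : ℝ) : ℂ)) nB,
    ← integral_norm_sq_mul_gaussian hε]
  linear_combination (-4 * ε * ∫ x : ℝ, ‖((x * Real.exp (-ε * x ^ 2) : ℝ) : ℂ)‖ ^ 2) *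
    cyl_energy h

/-! ### The ground state energy -/

theorem isGLB_rayleighQuotients {α γ R : ℝ} (hα : 0 < α)
    (hle : ∀ s, cylDeriv α s ≤ γ * cyl α s) (h : cylDeriv α (-R) = γ * cyl α (-R)) :
    IsGLB (rayleighQuotients γ) (1 - 2 * α) :=
  ⟨fun _ hr => le_of_mem_rayleighQuotients hα hle hr, fun _ hb =>
    le_of_forall_pos_le_add fun _ hε => hb (add_mem_rayleighQuotients hα hε h)⟩

end RobinModel

theorem mainTheorem6 (γ : ℝ) :
    -- `Θ(γ)` is a genuine (finite) infimum, and `H[γ, ξ]` does have a lowest eigenvalue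
    IsGLB (RobinModel.rayleighQuotients γ) (RobinModel.Theta γ) ∧
    (∀ ξ : ℝ, IsLeast (RobinModel.eigenvalues γ ξ) (RobinModel.mu γ ξ)) ∧
    RobinModel.Theta γ < 1 ∧
    ∃ ξ₀ : ℝ, 0 < ξ₀ ∧
      (∀ ξ : ℝ, ξ ≠ ξ₀ → RobinModel.mu γ ξ₀ < RobinModel.mu γ ξ) ∧
      ξ₀ ^ 2 = RobinModel.Theta γ + γ ^ 2 := by
  obtain ⟨α, R, hα, hR, hR2, hbd, hle, hmu, hlt⟩ := RobinModel.exists_minimal_mu γ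
  have hglb := RobinModel.isGLB_rayleighQuotients hα hle hbd
  have hne : (RobinModel.rayleighQuotients γ).Nonempty :=
    ⟨_, RobinModel.add_mem_rayleighQuotients hα one_pos hbd⟩
  have hΘ : RobinModel.Theta γ = 1 - 2 * α := hglb.csInf_eq hne
  rw [hΘ]
  exact ⟨hglb, hmu, by linarith, R, hR, hlt, hR2⟩
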